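/- **Setting.** Consider episodic tabular Markov decision processes $M$ with $S$ states, $A$ actions, horizon $H$, transition kernels $P_h$, initial law $\nu$ and deterministic rewards $r_h(s,a)\in[0,1]$, $h\in[H]$. For a Markov policy $\pi$ let $d^\pi_h(s,a)$ be the probability that $(s_h,a_h)=(s,a)$ in an episode played with $\pi$, and let $V^\pi_1$ be the expected total reward of an episode. Given $K$ distinct target policies $\pi^1,\dots,\pi^K$, an accuracy $\varepsilon$ and a confidence level $\delta$, the algorithm CAESAR, with tuning constants $n_0\in\mathbb N_{>0}$, $\varepsilon',C_h,C_{\mathrm{fin}}>0$ and step sizes $\eta_h^i>0$, does the following. 1. *Coarse estimation.* Play $n_0$ episodes with each $\pi^k$; let $\hat d^{k}_h(s,a)$ be the empirical frequency of $(s,a)$ at step $h$, replaced by $0$ (the pair is then ignored for $\pi^k$ at step $h$) if it is smaller than $5\varepsilon'$. 2. *Sampling distribution.* For each $h$ take weights $\hat\alpha_h$ in the simplex for which $\hat\mu_h=\sum_k\hat\alpha_{h,k}\hat d^k_h$ minimizes $\max_k\sum_{s,a}\hat d^k_h(s,a)^2/\hat\mu_h(s,a)$. A draw from $\tilde\mu_h$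 is made by drawing $k\sim\hat\alpha_h$, playing one episode with $\pi^k$ and taking its pair $(s_h,a_h)$; the pair is discarded if it is ignored for $\pi^k$ at step $h$. 3. *Importance density estimation (IDES).* Put $\hat\rho^k_h=\sum_{s,a}\hat d^k_h(s,a)^2/\hat\mu_h(s,a)$, $\hat\rho^k_0=1$ and $n^k_h=\big\lceil C_h\frac{H^4}{\varepsilon^2}(\hat\rho^k_h+\hat\rho^k_{h-1})\big\rceil$. For $h=1,\dots,H$ and each $k$, start from $w^0=0$ and run $n^k_h$ iterations $w^i=\mathrm{Proj}\{w^{i-1}-\eta_h^i g_i\}$ of stochastic gradient descent, projected on $\prod_{s,a}[0,2\hat d^k_h(s,a)]$, with $$g_i(s,a)=\frac{w^{i-1}(s,a)}{\hat\mu_h(s,a)}\mathbb 1\{(s^i_h,a^i_h)=(s,a)\}-\frac{\hat w^k_{h-1}(s^i_{h-1},a^i_{h-1})}{\hat\mu_{h-1}(s^i_{h-1},a^i_{h-1})}\pi^k_h(a|s)\mathbb 1\{s^{i\prime}_h=s\},$$ where $(s_h^i,a_h^i)$ is a fresh draw from $\tilde\mu_h$ and $(s^i_{h-1},a^i_{h-1},s^{i\prime}_h)$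 is an independent fresh draw from $\tilde\mu_{h-1}$ with its next state (for $h=1$ the factor $\hat w^k_0/\hat\mu_0$ is $1$ and $s_1^{i\prime}\sim\nu$; a discarded pair contributes $0$). The same $\max_k n_h^k$ draws serve all policies. Output $\hat w^k_h=\sum_i i\,w^i/\sum_i i$. 4. *Estimation.* With $n=\big\lceil C_{\mathrm{fin}}\frac{H^2}{\varepsilon^2}\sum_h\max_k\hat\rho^k_h\big\rceil$ fresh draws $(s^i_h,a^i_h)\sim\tilde\mu_h$ for each $h$, output $\hat V^{k}_1=\frac1n\sum_{i=1}^n\sum_{h=1}^H\frac{\hat w^k_h(s^i_h,a^i_h)}{\hat\mu_h(s^i_h,a^i_h)}r_h(s^i_h,a^i_h)$, where a discarded draw contributes $0$. The number of episodes played is $Kn_0+\sum_h2\max_kn^k_h+Hn$. **Statement.** If all target policies are deterministic, the sample complexity of CAESAR is at most $\tilde O(\mathrm{poly}(H)S^2A/\varepsilon^2)$, uniformly over instances. Precisely: there are universal constants $C>0$ and $c\in\mathbb N$ such that for all $S,A,H,K$, all $0<\varepsilon\le H$ and all $0<\delta<1$ the tuning constants can be chosen, depending only on $(S,A,H,K,\varepsilon,\delta)$,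 so that for every such $M$, every $K$ distinct deterministic policies $\pi^1,\dots,\pi^K$ and every choice of exact minimizers in step 2: * with probability at least $1-\delta$, $|\hat V^{k}_1-V^{\pi^k}_1|\le\varepsilon$ for all $k\in[K]$; * the number of episodes played is always at most $$C\,\frac{H^{c}S^2A}{\varepsilon^2}\,L^{c}+C\,\frac{K\,(SAH)^{c}}{\varepsilon}\,L^{c},\qquad L=\log\frac{2SAH}{\varepsilon\delta}.$$ The second term is the lower-order term, in $1/\varepsilon$, that $\tilde O$ hides; the leading term does not depend on $K$. -/

import Mathlib

open scoped ENNReal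

noncomputable section

namespace Caesar

/-- The law of independent draws, one from each of finitely many distributions on finite types. -/
def indep {ι : Type*} [Fintype ι] [DecidableEq ι] {β : ι → Type*} [∀ i, Fintype (β i)]
    (p : ∀ i, PMF (β i)) : PMF (∀ i, β i) :=
  PMF.ofFintype (fun x => ∏ i, p i (x i)) (by
    rw [← Fintype.piFinset_univ, ← Finset.prod_univ_sum]
    exact Finset.prod_eq_one fun i _ => by
      simpa [tsum_fintype] using (p i).tsum_coe)

/-! ### Episodic tabular Markov decision processes -/

/-- An episodic Markov decision process with horizon `H`; the steps are `0, …, H - 1`. -/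
structure MDP (S A : Type*) (H : ℕ) where
  /-- `P h s a` is the law of the next state after taking action `a` in state `s` at step `h`. -/
  P : Fin H → S → A → PMF S
  /-- The deterministic reward. -/
  r : Fin H → S → A → ℝ
  /-- The law of the initial state. -/
  ν : PMF S
  r_mem : ∀ h s a, r h s a ∈ Set.Icc (0 : ℝ) 1

/-- A (possibly randomized) Markov policy. -/
abbrev Policy (S A : Type*) (H : ℕ) := Fin H → S → PMF A

/-- A trajectory `(s_h, a_h)` over all steps of an episode. -/
abbrev Traj (S A : Type*) (H : ℕ) := Fin H → S × A

/-- The policy takes one fixed action in each state at each step. -/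
def Policy.IsDeterministic {S A : Type*} {H : ℕ} (π : Policy S A H) : Prop :=
  ∀ h s, ∃ a, π h s = PMF.pure a

/-- The law of a trajectory of `n` steps that starts in the state `s`. -/
def rollout {S A : Type*} : (n : ℕ) → (Fin n → S → A → PMF S) → Policy S A n → S →
    PMF (Traj S A n)
  | 0, _, _, _ => PMF.pure Fin.elim0
  | n + 1, P, π, s => (π 0 s).bind fun a => (P 0 s a).bind fun s' =>
      (rollout n (fun h => P h.succ) (fun h => π h.succ) s').map
        fun τ => (Fin.cons (s, a) τ : Fin (n + 1) → S × A)

/-- The law of one episode played with the policy `π`. -/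
def MDP.trajectory {S A : Type*} {H : ℕ} (M : MDP S A H) (π : Policy S A H) :
    PMF (Traj S A H) :=
  M.ν.bind fun s => rollout H M.P π s

/-- The performance of `π`: the expected total reward of one episode. -/
def MDP.value {S A : Type*} [Fintype S] [Fintype A] [DecidableEq S] [DecidableEq A] {H : ℕ}
    (M : MDP S A H) (π : Policy S A H) : ℝ :=
  ∑ τ : Traj S A H, (M.trajectory π τ).toReal * ∑ h, M.r h (τ h).1 (τ h).2

/-! ### Optimal sampling weights -/

/-- The mixture `∑ j, α j • d j`. -/
def mix {K : ℕ} {X : Type*} (d : Fin K → X → ℝ) (α : PMF (Fin K)) (x : X) : ℝ :=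
  ∑ j, (α j).toReal * d j x

/-- `max_k ∑_x (d k x)² / μ x` for the mixture `μ = ∑ j, α j • d j`; here `0 / 0 = 0` and
`a / 0 = ∞` for `a > 0`. -/
def worstRatio {K : ℕ} {X : Type*} [Fintype X] (d : Fin K → X → ℝ) (α : PMF (Fin K)) : ℝ≥0∞ :=
  ⨆ k, ∑ x, ENNReal.ofReal (d k x) ^ 2 / ENNReal.ofReal (mix d α x)

/-- `α` minimizes the worst ratio over the convex hull of the `d j`. -/
def IsOptimal {K : ℕ} {X : Type*} [Fintype X] (d : Fin K → X → ℝ) (α : PMF (Fin K)) : Prop :=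
  ∀ β : PMF (Fin K), worstRatio d α ≤ worstRatio d β

/-- An exact solver of the convex program `min_α worstRatio d α`. -/
def IsSolver {K : ℕ} {X : Type*} [Fintype X]
    (solve : (Fin K → X → ℝ) → PMF (Fin K)) : Prop :=
  ∀ d : Fin K → X → ℝ, (∀ k x, 0 ≤ d k x) → IsOptimal d (solve d)

/-! ### The algorithm -/

/-- The tuning constants of the algorithm. -/
structure Params (H : ℕ) where
  /-- number of episodes played with each target policy for the coarse estimates -/
  n₀ : ℕ
  /-- accuracy `ε'` of the coarse estimates: entries below `5 ε'` are ignored -/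
  acc : ℝ
  /-- factor `C_h` of the number of iterations at step `h` -/
  C : Fin H → ℝ
  /-- factor of the sample size of the final estimator -/
  Cfin : ℝ
  /-- step size at step `h`, iteration `i ≥ 1` -/
  η : Fin H → ℕ → ℝ
  n₀_pos : 0 < n₀
  acc_pos : 0 < acc
  C_pos : ∀ h, 0 < C h
  Cfin_pos : 0 < Cfin
  η_pos : ∀ h i, 0 < η h i

/-- The coarse estimate of the visitation probabilities from `n` episodes: the empirical
frequencies, with those below `5 ε'` replaced by `0`. -/
def coarse {S A : Type*} [DecidableEq S] [DecidableEq A] {H n : ℕ} (acc : ℝ)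
    (data : Fin n → Traj S A H) (h : Fin H) (x : S × A) : ℝ :=
  let p : ℝ := ((Finset.univ.filter fun i => data i h = x).card : ℝ) / n
  if p < 5 * acc then 0 else p

/-- The outcome of the first phase: the coarse estimates and the sampling weights at each step. -/
structure Design (S A : Type*) (H K : ℕ) where
  /-- coarse estimate of the visitation probabilities of policy `k` at step `h` -/
  d : Fin K → Fin H → S × A → ℝ
  /-- weights of the sampling mixture at step `h` -/
  α : Fin H → PMF (Fin K)

/-- The step before `h`, if there is one. -/
def prev {H : ℕ} (h : Fin H) : Option (Fin H) :=
  if (h : ℕ) = 0 then none else some ⟨(h : ℕ) - 1, by omega⟩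

section Run

variable {S A : Type*} [Fintype S] [Fintype A] [DecidableEq S] [DecidableEq A] {H K : ℕ}

/-- The estimated sampling distribution at step `h`. -/
def Design.mu (D : Design S A H K) (h : Fin H) (x : S × A) : ℝ :=
  mix (fun k => D.d k h) (D.α h) x

/-- The estimated visitation ratio `∑_x d̂_h^k(x)² / μ̂_h(x)` of policy `k` at step `h`. -/
def Design.ratio (D : Design S A H K) (k : Fin K) (h : Fin H) : ℝ :=
  ∑ x, D.d k h x ^ 2 / D.mu h x

/-- The same at the step before `h`; it is `1` at the fictitious step before the first one. -/
def Design.ratioPrev (D : Design S A H K) (k : Fin K) (h : Fin H) : ℝ :=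
  (prev h).elim 1 fun p => D.ratio k p

/-- Number of iterations of the density estimation for policy `k` at step `h`. -/
def Design.iters (D : Design S A H K) (θ : Params H) (ε : ℝ) (k : Fin K) (h : Fin H) : ℕ :=
  ⌈θ.C h * ((H : ℝ) ^ 4 / ε ^ 2 * (D.ratio k h + D.ratioPrev k h))⌉₊

/-- Number of samples drawn at step `h`; they are shared by all policies. -/
def Design.pool (D : Design S A H K) (θ : Params H) (ε : ℝ) (h : Fin H) : ℕ :=
  Finset.univ.sup fun k => D.iters θ ε k h

/-- Sample size of the final estimator. -/
def Design.final (D : Design S A H K) (θ : Params H) (ε : ℝ) : ℕ :=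
  ⌈θ.Cfin * ((H : ℝ) ^ 2 / ε ^ 2 * ∑ h, ⨆ k, D.ratio k h)⌉₊

/-- The step-`h` pair of an episode of policy `k`; it is `none` if the pair is ignored for `k`
at step `h`. -/
def Design.keep (D : Design S A H K) (k : Fin K) (h : Fin H) (τ : Traj S A H) :
    Option (S × A) :=
  if D.d k h (τ h) = 0 then none else some (τ h)

/-- One draw from the sampling distribution at step `h`: draw `k` with the weights of step `h`,
play one episode with policy `k`, keep its step-`h` pair. -/
def pairLaw (M : MDP S A H) (π : Fin K → Policy S A H) (D : Design S A H K) (h : Fin H) :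
    PMF (Option (S × A)) :=
  (D.α h).bind fun k => (M.trajectory (π k)).map fun τ => D.keep k h τ

/-- One draw of a pair from the sampling distribution at the step before `h`, together with the
state that follows it. At the first step the pair is the fictitious one, written `none`, and the
state is the initial state of an episode. -/
def transLaw (M : MDP S A H) (π : Fin K → Policy S A H) (D : Design S A H K) (h : Fin H) :
    PMF (Option (S × A) × S) :=
  (prev h).elim (M.ν.map fun s => (none, s)) fun p =>
    (D.α p).bind fun k => (M.trajectory (π k)).map fun τ => (D.keep k p τ, (τ h).1)

/-- What one iteration of the density estimation consumes: a pair from the sampling distribution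
at the current step and a transition from the one at the step before. -/
abbrev Sample (S A : Type*) := Option (S × A) × (Option (S × A) × S)

/-- Independent draws from `pairLaw` and `transLaw`. -/
def sampleLaw (M : MDP S A H) (π : Fin K → Policy S A H) (D : Design S A H K) (h : Fin H) :
    PMF (Sample S A) :=
  (pairLaw M π D h).bind fun x => (transLaw M π D h).map fun y => (x, y)

/-- The stochastic gradient at `w`, for a policy with action probabilities `pol` at the current
step; `u` is the estimated density ratio of the step before. -/
def grad (pol : S → PMF A) (mu : S × A → ℝ) (u : Option (S × A) → ℝ) (w : S × A → ℝ)
    (z : Sample S A) (x : S × A) : ℝ :=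
  (if z.1 = some x then w x / mu x else 0)
    - (if z.2.2 = x.1 then u z.2.1 * (pol x.1 x.2).toReal else 0)

/-- Projected stochastic gradient descent on the box `∏ x, [0, 2 d̂(x)]`, started at `0`. -/
def sgd (dhat : S × A → ℝ) (η : ℕ → ℝ) (pol : S → PMF A) (mu : S × A → ℝ)
    (u : Option (S × A) → ℝ) {N : ℕ} (data : Fin N → Sample S A) : ℕ → S × A → ℝ
  | 0 => fun _ => 0
  | i + 1 => fun x =>
      if hi : i < N then
        max 0 (min (2 * dhat x) (sgd dhat η pol mu u data i x
          - η (i + 1) * grad pol mu u (sgd dhat η pol mu u data i) (data ⟨i, hi⟩) x))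
      else sgd dhat η pol mu u data i x

/-- The average of the first `n` iterates with weights proportional to `i`. -/
def average (n : ℕ) (w : ℕ → S × A → ℝ) (x : S × A) : ℝ :=
  (∑ i ∈ Finset.Icc 1 n, (i : ℝ) * w i x) / ∑ i ∈ Finset.Icc 1 n, (i : ℝ)

/-- Importance density estimation for policy `k`: the estimate `ŵ_m`, from the samples of the
steps `0, …, m`. -/
def ides (π : Fin K → Policy S A H) (D : Design S A H K) (θ : Params H) (ε : ℝ)
    (data : ∀ h, Fin (D.pool θ ε h) → Sample S A) (k : Fin K) :
    (m : ℕ) → m < H → S × A → ℝ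
  | 0, hm => average (D.iters θ ε k ⟨0, hm⟩)
      (sgd (D.d k ⟨0, hm⟩) (θ.η ⟨0, hm⟩) (π k ⟨0, hm⟩) (D.mu ⟨0, hm⟩) (fun _ => 1)
        (data ⟨0, hm⟩))
  | m + 1, hm => average (D.iters θ ε k ⟨m + 1, hm⟩)
      (sgd (D.d k ⟨m + 1, hm⟩) (θ.η ⟨m + 1, hm⟩) (π k ⟨m + 1, hm⟩) (D.mu ⟨m + 1, hm⟩)
        (fun o => o.elim 0 fun y =>
          ides π D θ ε data k m (Nat.lt_of_succ_lt hm) y / D.mu ⟨m, Nat.lt_of_succ_lt hm⟩ y)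
        (data ⟨m + 1, hm⟩))

/-- The importance-weighted estimate of the performance of policy `k`. -/
def estimate (M : MDP S A H) (π : Fin K → Policy S A H) (D : Design S A H K) (θ : Params H)
    (ε : ℝ) (data : ∀ h, Fin (D.pool θ ε h) → Sample S A)
    (fresh : Fin H → Fin (D.final θ ε) → Option (S × A)) (k : Fin K) : ℝ :=
  (∑ i, ∑ h, (fresh h i).elim 0 fun x =>
    ides π D θ ε data k h h.isLt x / D.mu h x * M.r h x.1 x.2) / (D.final θ ε : ℝ)

/-- The outcome of the first phase, computed from the episodes played with the target policies. -/
def design (θ : Params H) (solve : (Fin K → S × A → ℝ) → PMF (Fin K))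
    (data : Fin K → Fin θ.n₀ → Traj S A H) : Design S A H K where
  d k h := coarse θ.acc (data k) h
  α h := solve fun k => coarse θ.acc (data k) h

/-- Number of episodes played: `n₀` with each policy for the coarse estimates, two for each
iteration of the density estimation, and, for each step, the sample of the final estimator. -/
def Design.episodes (D : Design S A H K) (θ : Params H) (ε : ℝ) : ℕ :=
  K * θ.n₀ + ∑ h, 2 * D.pool θ ε h + H * D.final θ ε

/-- CAESAR, as the joint law of its output and of the number of episodes that it plays. -/
def caesar (M : MDP S A H) (π : Fin K → Policy S A H) (θ : Params H) (ε : ℝ)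
    (solve : (Fin K → S × A → ℝ) → PMF (Fin K)) : PMF ((Fin K → ℝ) × ℕ) :=
  (indep fun k => indep fun _ : Fin θ.n₀ => M.trajectory (π k)).bind fun data₀ =>
    let D := design θ solve data₀
    (indep fun h => indep fun _ : Fin (D.pool θ ε h) => sampleLaw M π D h).bind fun data =>
      (indep fun h => indep fun _ : Fin (D.final θ ε) => pairLaw M π D h).map fun fresh =>
        (fun k => estimate M π D θ ε data fresh k, D.episodes θ ε)

end Run

end Caesar

end

open scoped ENNReal

noncomputable section

set_option linter.unusedSectionVars false

/-! The leading factor S²A arises as follows. The ratios `D.ratio` are at most S·A: the solver is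
exact, and the uniform mixture over policies that maximize the coarse frequency of the single pairs
already achieves S·A. The second factor S has two sources. A deterministic policy uses one action
per state, so the ℓ¹ error of its density estimate costs a factor S over the sum of the squared
errors. And there are at most A^(SH) distinct deterministic policies, so a union bound over all
targets costs log K ≤ S·H·L. The two sources must be added, not multiplied.

This is achieved by treating the ℓ¹ error as mean plus deviation. The mean is bounded by second
moments and AM-GM (`Stage.expect_dev_le`) and carries the first factor S. The deviation is
controlled by a Bernstein inequality for functions of independent draws (`prob_indep_tail_le`), in
which the confidence T of order log K multiplies only the largest increment
(`Stage.prob_dev_ge_le`).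

Gradient descent cannot be fed to this inequality directly: its early steps are too long, and the
density ratio u of the previous step may take large values. Iterate j is therefore compared with an
auxiliary run that starts in its minimizer at time j/2 and only sees the part of u below 2B. Over
half of the time axis the steps p/i forget the start up to a factor exp(-p/10). The large values of
u are handled through counts of draws; the event that counts are typical is shared by all targets
and costs no log K. Coordinates for which the steps are too long, or the sampling probability too
small relative to the estimate, are bounded by the size of the box. The outcome,
`Stage.sum_abs_sgd_sub_target_le`, is an error c + κ/j, and the weights proportional to i turn it
into c + 2κ/n.

Along the steps of the episode the errors only add up (`sum_abs_density_sub_occ_le`), since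
transitions followed by a policy contract ℓ¹. The final sample again enters through counts, on an
event uniform over the weights (`sum_final_error_le`), so it needs no log K either.

The coarse phase must be correct up to constant factors, and only for pairs of probability above a
multiple of ε/(S·H²). It costs of order S²H²t/ε episodes for each policy, which is the only place
where K multiplies the sample size. All failure probabilities are beaten by t = 200·H·L, because
exp(H·L) dominates every parameter of the instance except K (`confidence_bounds`). -/

namespace Caesar

/-! ### Expectations over finite probability spaces -/

section Expect

variable {α β : Type*} [Fintype α] [Fintype β]

/-- The expectation of a real function under a distribution on a finite type. -/
def expect (p : PMF α) (f : α → ℝ) : ℝ := ∑ x, (p x).toReal * f x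

/-- The probability of a set under a distribution on a finite type. -/
def prob (p : PMF α) (s : Set α) : ℝ := expect p (s.indicator fun _ => 1)

theorem sum_toReal (p : PMF α) : ∑ x, (p x).toReal = 1 := by
  rw [← ENNReal.toReal_sum fun x _ => p.apply_ne_top x]
  have := p.tsum_coe
  rw [tsum_fintype] at this
  simp [this]

theorem expect_const (p : PMF α) (c : ℝ) : expect p (fun _ => c) = c := by
  rw [expect, ← Finset.sum_mul, sum_toReal, one_mul]

theorem expect_mono {p : PMF α} {f g : α → ℝ} (h : ∀ x, f x ≤ g x) : expect p f ≤ expect p g :=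
  Finset.sum_le_sum fun x _ => mul_le_mul_of_nonneg_left (h x) ENNReal.toReal_nonneg

theorem expect_nonneg {p : PMF α} {f : α → ℝ} (h : ∀ x, 0 ≤ f x) : 0 ≤ expect p f :=
  Finset.sum_nonneg fun x _ => mul_nonneg ENNReal.toReal_nonneg (h x)

theorem expect_add (p : PMF α) (f g : α → ℝ) :
    expect p (fun x => f x + g x) = expect p f + expect p g := by
  simp [expect, mul_add, Finset.sum_add_distrib]

theorem expect_sub (p : PMF α) (f g : α → ℝ) :
    expect p (fun x => f x - g x) = expect p f - expect p g := by
  simp [expect, mul_sub, Finset.sum_sub_distrib]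

theorem expect_mul_left (p : PMF α) (c : ℝ) (f : α → ℝ) :
    expect p (fun x => c * f x) = c * expect p f := by
  simp [expect, Finset.mul_sum, mul_left_comm]

theorem expect_mul_right (p : PMF α) (c : ℝ) (f : α → ℝ) :
    expect p (fun x => f x * c) = expect p f * c := by
  simp [expect, Finset.sum_mul, mul_assoc]

theorem expect_neg (p : PMF α) (f : α → ℝ) : expect p (fun x => -f x) = -expect p f := by
  simp [expect]

theorem expect_sum {ι : Type*} (p : PMF α) (s : Finset ι) (f : ι → α → ℝ) :
    expect p (fun x => ∑ i ∈ s, f i x) = ∑ i ∈ s, expect p (f i) := by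
  simp only [expect, Finset.mul_sum]
  exact Finset.sum_comm

theorem abs_expect_le (p : PMF α) (f : α → ℝ) : |expect p f| ≤ expect p fun x => |f x| := by
  refine (Finset.abs_sum_le_sum_abs _ _).trans (le_of_eq ?_)
  simp [expect, abs_mul]

theorem sq_expect_le (p : PMF α) (f : α → ℝ) : expect p f ^ 2 ≤ expect p fun x => f x ^ 2 := by
  have h : 0 ≤ expect p fun x => (f x - expect p f) ^ 2 := expect_nonneg fun x => sq_nonneg _
  have e : (fun x => (f x - expect p f) ^ 2)
      = fun x => f x ^ 2 - 2 * expect p f * f x + expect p f ^ 2 := by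
    funext x; ring
  rw [e, expect_add, expect_sub, expect_mul_left, expect_const] at h
  linarith

theorem expect_congr_support {p : PMF α} {f g : α → ℝ} (h : ∀ x ∈ p.support, f x = g x) :
    expect p f = expect p g := by
  refine Finset.sum_congr rfl fun x _ => ?_
  by_cases hx : p x = 0
  · simp [hx]
  · rw [h x hx]

theorem expect_pure (a : α) (f : α → ℝ) : expect (PMF.pure a) f = f a := by
  classical
  simp [expect, PMF.pure_apply, apply_ite ENNReal.toReal]

theorem expect_bind (p : PMF α) (q : α → PMF β) (f : β → ℝ) :
    expect (p.bind q) f = expect p fun x => expect (q x) f := by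
  simp only [expect, PMF.bind_apply, tsum_fintype]
  simp_rw [ENNReal.toReal_sum fun x _ => ENNReal.mul_ne_top (p.apply_ne_top x)
    ((q x).apply_ne_top _), ENNReal.toReal_mul, Finset.sum_mul, Finset.mul_sum]
  rw [Finset.sum_comm]
  simp only [mul_assoc]

theorem expect_map (p : PMF α) (g : α → β) (f : β → ℝ) :
    expect (p.map g) f = expect p fun x => f (g x) := by
  rw [← PMF.bind_pure_comp, expect_bind]
  simp [expect_pure]

theorem prob_mono {p : PMF α} {s t : Set α} (h : s ⊆ t) : prob p s ≤ prob p t :=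
  expect_mono fun x => Set.indicator_le_indicator_of_subset h (fun _ => zero_le_one) x

theorem prob_nonneg (p : PMF α) (s : Set α) : 0 ≤ prob p s :=
  expect_nonneg fun _ => Set.indicator_nonneg (fun _ _ => zero_le_one) _

theorem prob_union_le (p : PMF α) (s t : Set α) : prob p (s ∪ t) ≤ prob p s + prob p t := by
  rw [prob, prob, prob, ← expect_add]
  refine expect_mono fun x => ?_
  by_cases hs : x ∈ s <;> by_cases ht : x ∈ t <;> simp [hs, ht]

theorem prob_biUnion_le {ι : Type*} (p : PMF α) (I : Finset ι) (s : ι → Set α) :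
    prob p {x | ∃ i ∈ I, x ∈ s i} ≤ ∑ i ∈ I, prob p (s i) := by
  simp only [prob]
  rw [← expect_sum]
  refine expect_mono fun x => ?_
  have h0 : ∀ i ∈ I, 0 ≤ (s i).indicator (fun _ => (1 : ℝ)) x :=
    fun i _ => Set.indicator_nonneg (fun _ _ => zero_le_one) _
  by_cases hx : ∃ i ∈ I, x ∈ s i
  · obtain ⟨i, hi, hxi⟩ := hx
    rw [Set.indicator_of_mem (show x ∈ {x | ∃ i ∈ I, x ∈ s i} from ⟨i, hi, hxi⟩)]
    calc (1 : ℝ) = (s i).indicator (fun _ => 1) x := by simp [hxi]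
      _ ≤ _ := Finset.single_le_sum h0 hi
  · rw [Set.indicator_of_notMem (by simpa using hx)]
    exact Finset.sum_nonneg h0

theorem prob_biUnion_le_card {ι : Type*} (p : PMF α) (I : Finset ι) (s : ι → Set α) {b : ℝ}
    (h : ∀ i ∈ I, prob p (s i) ≤ b) : prob p {x | ∃ i ∈ I, x ∈ s i} ≤ I.card * b := by
  refine (prob_biUnion_le p I s).trans ((Finset.sum_le_sum h).trans ?_)
  simp

theorem prob_le_expect {p : PMF α} {s : Set α} {f : α → ℝ} (h0 : ∀ x, 0 ≤ f x)
    (h : ∀ x ∈ s, 1 ≤ f x) : prob p s ≤ expect p f := by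
  refine expect_mono fun x => ?_
  by_cases hx : x ∈ s <;> simp [hx, h, h0]

theorem toOuterMeasure_eq_prob (p : PMF α) (s : Set α) :
    p.toOuterMeasure s = ENNReal.ofReal (prob p s) := by
  classical
  rw [PMF.toOuterMeasure_apply_fintype, prob, expect, ENNReal.ofReal_sum_of_nonneg]
  · refine Finset.sum_congr rfl fun x _ => ?_
    by_cases hx : x ∈ s <;> simp [hx, ENNReal.ofReal_toReal (p.apply_ne_top x)]
  · exact fun x _ => mul_nonneg ENNReal.toReal_nonneg
      (Set.indicator_nonneg (fun _ _ => zero_le_one) _)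

theorem prob_add_compl (p : PMF α) (s : Set α) : prob p s + prob p sᶜ = 1 := by
  rw [prob, prob, ← expect_add]
  simp only [Set.indicator_self_add_compl_apply]
  exact expect_const p 1

theorem one_sub_le_toOuterMeasure {p : PMF α} {s : Set α} {b : ℝ} (hb : 0 ≤ b)
    (h : prob p sᶜ ≤ b) : 1 - ENNReal.ofReal b ≤ p.toOuterMeasure s := by
  rw [toOuterMeasure_eq_prob, ← ENNReal.ofReal_one, ← ENNReal.ofReal_sub _ hb]
  exact ENNReal.ofReal_le_ofReal (by linarith [prob_add_compl p s])

/-- If the first stage fails with probability at most `a`, and the second one with probability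
at most `b` after each outcome of a successful first stage, then the composition fails with
probability at most `a + b`. -/
theorem one_sub_le_toOuterMeasure_bind {γ : Type*} {p : PMF α} {q : α → PMF γ} {s : Set γ}
    {G : Set α} {a b : ℝ} (ha : 0 ≤ a) (hb : 0 ≤ b) (hG : prob p Gᶜ ≤ a)
    (h : ∀ x ∈ G, 1 - ENNReal.ofReal b ≤ (q x).toOuterMeasure s) :
    1 - ENNReal.ofReal (a + b) ≤ (p.bind q).toOuterMeasure s := by
  classical
  rw [PMF.toOuterMeasure_bind_apply, tsum_fintype, tsub_le_iff_right]
  have h1 : ∑ x, p x = 1 := by simpa [tsum_fintype] using p.tsum_coe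
  have h2 : ∑ x, p x * Gᶜ.indicator (fun _ => 1) x ≤ ENNReal.ofReal a := by
    refine le_trans (le_of_eq ?_) ((toOuterMeasure_eq_prob p Gᶜ).trans_le
      (ENNReal.ofReal_le_ofReal hG))
    rw [PMF.toOuterMeasure_apply_fintype]
    refine Finset.sum_congr rfl fun x _ => ?_
    by_cases hx : x ∈ G <;> simp [hx]
  calc (1 : ℝ≥0∞) = ∑ x, p x := h1.symm
    _ ≤ ∑ x, (p x * (q x).toOuterMeasure s + p x * Gᶜ.indicator (fun _ => 1) x
        + p x * ENNReal.ofReal b) := by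
      refine Finset.sum_le_sum fun x _ => ?_
      rw [← mul_add, ← mul_add]
      refine le_mul_of_one_le_right (by simp) ?_
      by_cases hx : x ∈ G
      · have := tsub_le_iff_right.1 (h x hx)
        simpa [hx] using this
      · simp only [Set.mem_compl_iff, hx, not_false_eq_true, Set.indicator_of_mem]
        exact le_add_right le_add_self
    _ = ∑ x, p x * (q x).toOuterMeasure s + ∑ x, p x * Gᶜ.indicator (fun _ => 1) x
        + ENNReal.ofReal b := by
      rw [Finset.sum_add_distrib, Finset.sum_add_distrib, ← Finset.sum_mul, h1, one_mul]
    _ ≤ ∑ x, p x * (q x).toOuterMeasure s + ENNReal.ofReal (a + b) := by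
      rw [ENNReal.ofReal_add ha hb, ← add_assoc]
      gcongr

end Expect

/-! ### Independent draws -/

section Indep

variable {ι : Type*} [Fintype ι] [DecidableEq ι] {β : ι → Type*} [∀ i, Fintype (β i)]

theorem indep_toReal (p : ∀ i, PMF (β i)) (x : ∀ i, β i) :
    (indep p x).toReal = ∏ i, (p i (x i)).toReal := by
  rw [indep, PMF.ofFintype_apply, ENNReal.toReal_prod]

/-- Resampling one coordinate does not change an expectation. -/
theorem expect_indep_update (p : ∀ i, PMF (β i)) (i : ι) (f : (∀ i, β i) → ℝ) :
    expect (indep p) f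
      = expect (indep p) fun x => expect (p i) fun y => f (Function.update x i y) := by
  have key : ∀ x (y : β i), (indep p x).toReal * (p i y).toReal
      = (indep p (Function.update x i y)).toReal * (p i (x i)).toReal := by
    intro x y
    rw [indep_toReal, indep_toReal, ← Finset.mul_prod_erase _ _ (Finset.mem_univ i),
      ← Finset.mul_prod_erase _ (fun j => (p j (Function.update x i y j)).toReal)
        (Finset.mem_univ i)]
    have : ∏ j ∈ Finset.univ.erase i, (p j (Function.update x i y j)).toReal
        = ∏ j ∈ Finset.univ.erase i, (p j (x j)).toReal :=
      Finset.prod_congr rfl fun j hj => by rw [Function.update_of_ne (Finset.ne_of_mem_erase hj)]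
    rw [this, Function.update_self]
    ring
  -- Exchanging coordinate i with the extra draw is an involution that preserves the product weight.
  let e : ((∀ i, β i) × β i) ≃ ((∀ i, β i) × β i) :=
    { toFun := fun z => (Function.update z.1 i z.2, z.1 i)
      invFun := fun z => (Function.update z.1 i z.2, z.1 i)
      left_inv := fun z => by simp
      right_inv := fun z => by simp }
  have h1 : expect (indep p) (fun x => expect (p i) fun y => f (Function.update x i y))
      = ∑ z : (∀ i, β i) × β i, (indep p z.1).toReal * (p i z.2).toReal
          * f (Function.update z.1 i z.2) := by
    rw [Fintype.sum_prod_type]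
    simp only [expect, Finset.mul_sum, mul_assoc]
  rw [h1, Fintype.sum_equiv e _ (fun z => (indep p z.1).toReal * (p i z.2).toReal * f z.1)
    fun z => by rw [key]; rfl, Fintype.sum_prod_type]
  simp only [mul_right_comm _ _ (f _), ← Finset.mul_sum, sum_toReal, mul_one]
  rfl

theorem expect_indep_apply (p : ∀ i, PMF (β i)) (i : ι) (g : β i → ℝ) :
    expect (indep p) (fun x => g (x i)) = expect (p i) g := by
  rw [expect_indep_update p i]
  simp [expect_const]

/-- Fubini: the other coordinates may be frozen. This is how the samples of one step are analysed
conditionally on those of all other steps. -/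
theorem prob_indep_le (p : ∀ i, PMF (β i)) (i : ι) (s : Set (∀ i, β i)) {b : ℝ}
    (h : ∀ x, prob (p i) {y | Function.update x i y ∈ s} ≤ b) : prob (indep p) s ≤ b := by
  rw [prob, expect_indep_update p i, ← expect_const (indep p) b]
  exact expect_mono h

/-- Uses exp x ≤ 1 + x + x² for |x| ≤ 1 on the centred variable, which is at most γ plus its mean.
The linear term vanishes, and Jensen merges the two squares into the constant 4. -/
theorem expect_exp_centered_le {Z : Type*} [Fintype Z] (p : PMF Z) {φ γ : Z → ℝ} {r : ℝ}
    (hr : 0 ≤ r) (hrγ : ∀ z, r * γ z ≤ 1 / 2)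
    (h : ∀ z z', |φ z - φ z'| ≤ γ z + γ z') :
    expect p (fun z => Real.exp (r * φ z))
      ≤ Real.exp (r * expect p φ + r ^ 2 * (4 * expect p fun z => γ z ^ 2)) := by
  have hE : ∀ z, |φ z - expect p φ| ≤ γ z + expect p γ := by
    intro z
    have : φ z - expect p φ = expect p fun z' => φ z - φ z' := by
      rw [expect_sub, expect_const]
    rw [this]
    refine (abs_expect_le _ _).trans ((expect_mono (h z)).trans ?_)
    rw [expect_add, expect_const]
  have hEγ : r * expect p γ ≤ 1 / 2 := by
    rw [← expect_mul_left, ← expect_const p (1 / 2)]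
    exact expect_mono hrγ
  have hx : ∀ z, Real.exp (r * (φ z - expect p φ))
      ≤ 1 + r * (φ z - expect p φ) + r ^ 2 * (2 * γ z ^ 2 + 2 * expect p γ ^ 2) := by
    intro z
    have h1 : |r * (φ z - expect p φ)| ≤ 1 := by
      rw [abs_mul, abs_of_nonneg hr]
      refine (mul_le_mul_of_nonneg_left (hE z) hr).trans ?_
      linarith [hrγ z]
    have h2 := (abs_le.1 (Real.abs_exp_sub_one_sub_id_le h1)).2
    have h3 : (φ z - expect p φ) ^ 2 ≤ 2 * γ z ^ 2 + 2 * expect p γ ^ 2 := by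
      rw [← sq_abs]
      nlinarith [abs_nonneg (φ z - expect p φ), hE z, sq_nonneg (γ z - expect p γ)]
    nlinarith [mul_le_mul_of_nonneg_left h3 (sq_nonneg r)]
  have e1 : (fun z => Real.exp (r * φ z))
      = fun z => Real.exp (r * expect p φ) * Real.exp (r * (φ z - expect p φ)) := by
    funext z; rw [← Real.exp_add]; ring_nf
  rw [e1, expect_mul_left, Real.exp_add]
  refine mul_le_mul_of_nonneg_left ?_ (Real.exp_pos _).le
  refine (expect_mono hx).trans ?_
  rw [expect_add, expect_add, expect_const, expect_mul_left, expect_mul_left, expect_sub,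
    expect_const, sub_self, mul_zero, add_zero, expect_add, expect_mul_left, expect_const]
  refine le_trans ?_ (Real.add_one_le_exp _)
  nlinarith [sq_expect_le p γ, sq_nonneg r]

/-- Concentration for functions of independent draws whose change under replacing one coordinate
is controlled by the old and the new value of this coordinate: the exponential moment. -/
theorem expect_exp_indep_le (p : ∀ i, PMF (β i)) {γ : ∀ i, β i → ℝ} {r : ℝ} (hr : 0 ≤ r)
    (hγ : ∀ i z, 0 ≤ γ i z) (hrγ : ∀ i z, r * γ i z ≤ 1 / 2) (s : Finset ι) :
    ∀ f : (∀ i, β i) → ℝ, DependsOn f (s : Set ι) →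
      (∀ x i z, |f (Function.update x i z) - f x| ≤ γ i (x i) + γ i z) →
      expect (indep p) (fun x => Real.exp (r * f x)) ≤ Real.exp (r * expect (indep p) f
        + r ^ 2 * ∑ i ∈ s, 4 * expect (p i) fun z => γ i z ^ 2) := by
  induction s using Finset.induction_on with
  | empty =>
    intro f hf _
    obtain ⟨x₀, -⟩ := (indep p).support_nonempty
    have : f = fun _ => f x₀ := by
      funext x; exact hf (by simp)
    rw [this]
    simp [expect_const]
  | insert i s his ih =>
    intro f hf hd
    -- Doob's martingale step: integrating out coordinate i leaves a function of the remaining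
    -- coordinates with the same increments.
    set g : (∀ i, β i) → ℝ := fun x => expect (p i) fun y => f (Function.update x i y) with hg
    have hgd : DependsOn g (s : Set ι) := by
      intro x y hxy
      simp only [hg]
      congr 1
      funext z
      refine hf fun j hj => ?_
      by_cases hji : j = i
      · subst hji; simp
      · rw [Function.update_of_ne hji, Function.update_of_ne hji]
        exact hxy j (by simpa [hji] using hj)
    have hgl : ∀ x j z, |g (Function.update x j z) - g x| ≤ γ j (x j) + γ j z := by
      intro x j z
      simp only [hg]
      rw [← expect_sub]
      refine (abs_expect_le _ _).trans ?_
      rw [← expect_const (p i) (γ j (x j) + γ j z)]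
      refine expect_mono fun y => ?_
      by_cases hji : j = i
      · subst hji
        simp only [Function.update_idem, sub_self, abs_zero]
        exact add_nonneg (hγ _ _) (hγ _ _)
      · rw [Function.update_comm hji]
        refine (hd _ j z).trans ?_
        rw [Function.update_of_ne hji]
    have h1 : ∀ x, expect (p i) (fun y => Real.exp (r * f (Function.update x i y)))
        ≤ Real.exp (r ^ 2 * (4 * expect (p i) fun z => γ i z ^ 2)) * Real.exp (r * g x) := by
      intro x
      rw [← Real.exp_add, add_comm]
      refine expect_exp_centered_le (p i) hr (hrγ i) fun z z' => ?_
      have := hd (Function.update x i z') i z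
      rw [Function.update_idem, Function.update_self] at this
      linarith
    rw [expect_indep_update p i]
    refine (expect_mono h1).trans ?_
    rw [expect_mul_left, Finset.sum_insert his, mul_add, expect_indep_update p i f, add_left_comm,
      Real.exp_add]
    exact mul_le_mul_of_nonneg_left (ih g hgd hgl) (Real.exp_pos _).le

/-- Concentration for functions of independent draws whose change under replacing one coordinate
is controlled by the old and the new value of this coordinate: the upper tail. -/
theorem prob_indep_tail_le (p : ∀ i, PMF (β i)) {γ : ∀ i, β i → ℝ} {r V : ℝ} (hr : 0 < r)
    (hγ : ∀ i z, 0 ≤ γ i z) (hrγ : ∀ i z, r * γ i z ≤ 1 / 2) (f : (∀ i, β i) → ℝ)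
    (hd : ∀ x i z, |f (Function.update x i z) - f x| ≤ γ i (x i) + γ i z)
    (hV : ∑ i, 4 * expect (p i) (fun z => γ i z ^ 2) ≤ V) (t : ℝ) :
    prob (indep p) {x | expect (indep p) f + r * V + t / r ≤ f x} ≤ Real.exp (-t) := by
  have h := expect_exp_indep_le p hr.le hγ hrγ Finset.univ f (by
    intro x y hxy
    rw [funext fun i => hxy i (by simp)]) hd
  refine (prob_le_expect (f := fun x => Real.exp (-(r * expect (indep p) f + r ^ 2 * V + t))
    * Real.exp (r * f x)) (fun x => by positivity) fun x hx => ?_).trans ?_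
  · rw [← Real.exp_add]
    refine Real.one_le_exp ?_
    have := mul_le_mul_of_nonneg_left (show _ ≤ _ from hx) hr.le
    have e : r * (expect (indep p) f + r * V + t / r)
        = r * expect (indep p) f + r ^ 2 * V + t := by
      field_simp
    linarith
  · rw [expect_mul_left]
    refine (mul_le_mul_of_nonneg_left h (Real.exp_pos _).le).trans ?_
    rw [← Real.exp_add]
    refine Real.exp_le_exp.2 ?_
    nlinarith [mul_le_mul_of_nonneg_left hV (sq_nonneg r)]

end Indep

/-! ### Counts of independent draws -/

section Count

variable {Z : Type*} [Fintype Z] {N : ℕ}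

/-- The number of draws with index in `W` that lie in `Q`. -/
def hits (W : Finset (Fin N)) (Q : Set Z) (x : Fin N → Z) : ℝ :=
  ∑ i ∈ W, Q.indicator (fun _ => 1) (x i)

theorem expect_hits (p : PMF Z) (W : Finset (Fin N)) (Q : Set Z) :
    expect (indep fun _ : Fin N => p) (hits W Q) = W.card * prob p Q := by
  unfold hits
  rw [expect_sum]
  simp [expect_indep_apply (fun _ : Fin N => p) _ (Q.indicator fun _ => (1 : ℝ)), prob]

theorem abs_hits_update_le (W : Finset (Fin N)) (Q : Set Z) (x : Fin N → Z) (i : Fin N) (z : Z) :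
    |hits W Q (Function.update x i z) - hits W Q x|
      ≤ (if i ∈ W then Q.indicator (fun _ => (1 : ℝ)) (x i) else 0)
        + (if i ∈ W then Q.indicator (fun _ => (1 : ℝ)) z else 0) := by
  classical
  have h0 : ∀ z, 0 ≤ Q.indicator (fun _ => (1 : ℝ)) z :=
    fun z => Set.indicator_nonneg (fun _ _ => zero_le_one) _
  unfold hits
  rw [← Finset.sum_sub_distrib]
  by_cases hi : i ∈ W
  · rw [Finset.sum_eq_single i (fun j _ hj => by rw [Function.update_of_ne hj, sub_self])
      (fun h => absurd hi h), Function.update_self, if_pos hi, if_pos hi]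
    rw [abs_le]
    constructor <;> linarith [h0 z, h0 (x i)]
  · rw [Finset.sum_eq_zero fun j hj => by
      rw [Function.update_of_ne (show j ≠ i from fun h => hi (by rwa [← h])), sub_self]]
    simp [hi]

/-- An indicator equals its square, so the variance proxy is proportional to the mean; this makes
the count bounds below multiplicative. -/
theorem sum_indicator_variance (p : PMF Z) (W : Finset (Fin N)) (Q : Set Z) :
    ∑ i, 4 * expect p (fun z => (if i ∈ W then Q.indicator (fun _ => (1 : ℝ)) z else 0) ^ 2)
      ≤ 4 * (W.card * prob p Q) := by
  classical
  rw [← Finset.mul_sum]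
  refine mul_le_mul_of_nonneg_left (le_of_eq ?_) (by norm_num)
  have : ∀ i, expect p (fun z => (if i ∈ W then Q.indicator (fun _ => (1 : ℝ)) z else 0) ^ 2)
      = if i ∈ W then prob p Q else 0 := by
    intro i
    by_cases hi : i ∈ W
    · simp only [hi, if_true, prob]
      congr 1
      funext z
      by_cases hz : z ∈ Q <;> simp [hz]
    · simp [hi, expect_const]
  simp only [this]
  simp

/-- A constant r gives relative error 4r at the additive price t/r; r is left free because different
phases balance the two differently. -/
theorem prob_hits_ge_le (p : PMF Z) (W : Finset (Fin N)) (Q : Set Z) {r : ℝ} (hr : 0 < r)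
    (hr2 : r ≤ 1 / 2) (t : ℝ) :
    prob (indep fun _ : Fin N => p)
      {x | W.card * prob p Q + r * (4 * (W.card * prob p Q)) + t / r ≤ hits W Q x}
      ≤ Real.exp (-t) := by
  have h01 : ∀ (i : Fin N) z, (if i ∈ W then Q.indicator (fun _ => (1 : ℝ)) z else 0) ≤ 1 ∧
      0 ≤ (if i ∈ W then Q.indicator (fun _ => (1 : ℝ)) z else 0) := by
    intro i z
    by_cases hi : i ∈ W <;> by_cases hz : z ∈ Q <;> simp [hi, hz]
  have := prob_indep_tail_le (fun _ : Fin N => p) hr (fun i z => (h01 i z).2)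
    (fun i z => by nlinarith [(h01 i z).1, (h01 i z).2]) (hits W Q) (abs_hits_update_le W Q)
    (sum_indicator_variance p W Q) t
  rwa [expect_hits] at this

theorem prob_hits_le_le (p : PMF Z) (W : Finset (Fin N)) (Q : Set Z) {r : ℝ} (hr : 0 < r)
    (hr2 : r ≤ 1 / 2) (t : ℝ) :
    prob (indep fun _ : Fin N => p)
      {x | hits W Q x ≤ W.card * prob p Q - r * (4 * (W.card * prob p Q)) - t / r}
      ≤ Real.exp (-t) := by
  have h01 : ∀ (i : Fin N) z, (if i ∈ W then Q.indicator (fun _ => (1 : ℝ)) z else 0) ≤ 1 ∧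
      0 ≤ (if i ∈ W then Q.indicator (fun _ => (1 : ℝ)) z else 0) := by
    intro i z
    by_cases hi : i ∈ W <;> by_cases hz : z ∈ Q <;> simp [hi, hz]
  have := prob_indep_tail_le (fun _ : Fin N => p) hr (fun i z => (h01 i z).2)
    (fun i z => by nlinarith [(h01 i z).1, (h01 i z).2]) (fun x => -hits W Q x)
    (fun x i z => by
      rw [neg_sub_neg, abs_sub_comm]
      exact abs_hits_update_le W Q x i z)
    (sum_indicator_variance p W Q) t
  rw [expect_neg, expect_hits] at this
  refine le_trans (prob_mono fun x hx => ?_) this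
  simp only [Set.mem_ofPred_eq] at hx ⊢
  linarith

/-- Two-sided Bernstein bound for counts. -/
theorem prob_abs_hits_ge_le (p : PMF Z) (W : Finset (Fin N)) (Q : Set Z) {r : ℝ} (hr : 0 < r)
    (hr2 : r ≤ 1 / 2) (t : ℝ) :
    prob (indep fun _ : Fin N => p)
      {x | r * (4 * (W.card * prob p Q)) + t / r ≤ |hits W Q x - W.card * prob p Q|}
      ≤ 2 * Real.exp (-t) := by
  rw [two_mul]
  refine le_trans (prob_mono fun x hx => ?_) ((prob_union_le _ _ _).trans
    (add_le_add (prob_hits_ge_le p W Q hr hr2 t) (prob_hits_le_le p W Q hr hr2 t)))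
  simp only [Set.mem_ofPred_eq, Set.mem_union] at hx ⊢
  rcases le_abs'.1 hx with h | h
  · right; linarith
  · left; linarith

end Count

/-! ### Visitation probabilities -/

section Occupancy

variable {S A : Type*} [Fintype S] [Fintype A] [DecidableEq S] [DecidableEq A]

theorem fst_of_mem_support_rollout {n : ℕ} {P : Fin (n + 1) → S → A → PMF S}
    {π : Policy S A (n + 1)} {s : S} {τ : Traj S A (n + 1)} (h : τ ∈ (rollout (n + 1) P π s).support) :
    (τ 0).1 = s := by
  simp only [rollout, PMF.mem_support_bind_iff, PMF.mem_support_map_iff] at h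
  obtain ⟨a, -, s', -, τ', -, rfl⟩ := h
  simp

theorem expect_rollout_succ {n : ℕ} (P : Fin (n + 1) → S → A → PMF S) (π : Policy S A (n + 1))
    (s : S) (f : Traj S A (n + 1) → ℝ) :
    expect (rollout (n + 1) P π s) f = expect (π 0 s) fun a => expect (P 0 s a) fun s' =>
      expect (rollout n (fun h => P h.succ) (fun h => π h.succ) s') fun τ =>
        f (Fin.cons (s, a) τ : Fin (n + 1) → S × A) := by
  rw [rollout, expect_bind]
  congr 1; funext a
  rw [expect_bind]
  congr 1; funext s'
  rw [expect_map]

/-- The Markov property for actions, by induction on the horizon; the lemma after it does the same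
for the next state. -/
theorem expect_rollout_action {n : ℕ} (P : Fin n → S → A → PMF S) (π : Policy S A n) (s : S)
    (h : Fin n) (F : S → A → ℝ) :
    expect (rollout n P π s) (fun τ => F (τ h).1 (τ h).2)
      = expect (rollout n P π s) fun τ => expect (π h (τ h).1) (F (τ h).1) := by
  induction n generalizing s with
  | zero => exact h.elim0
  | succ n ih =>
    rw [expect_rollout_succ, expect_rollout_succ]
    refine Fin.cases ?_ (fun i => ?_) h
    · simp only [Fin.cons_zero, expect_const]
    · simp only [Fin.cons_succ, ih]

theorem expect_rollout_next {n : ℕ} (P : Fin n → S → A → PMF S) (π : Policy S A n) (s : S)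
    (h : ℕ) (hh : h + 1 < n) (F : S × A → S → ℝ) :
    expect (rollout n P π s) (fun τ => F (τ ⟨h, by omega⟩) (τ ⟨h + 1, hh⟩).1)
      = expect (rollout n P π s) fun τ =>
        expect (P ⟨h, by omega⟩ (τ ⟨h, by omega⟩).1 (τ ⟨h, by omega⟩).2) (F (τ ⟨h, by omega⟩)) := by
  induction n generalizing s h with
  | zero => omega
  | succ n ih =>
    rw [expect_rollout_succ, expect_rollout_succ]
    congr 1; funext a
    cases h with
    | zero =>
      obtain ⟨n, rfl⟩ : ∃ m, n = m + 1 := ⟨n - 1, by omega⟩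
      have e0 : (⟨0, by omega⟩ : Fin (n + 1 + 1)) = 0 := rfl
      have e1 : (⟨0 + 1, hh⟩ : Fin (n + 1 + 1)) = Fin.succ 0 := rfl
      simp only [e0, e1, Fin.cons_zero, Fin.cons_succ, expect_const]
      congr 1; funext s'
      rw [← expect_const (rollout (n + 1) (fun h => P h.succ) (fun h => π h.succ) s')
        (F (s, a) s')]
      exact expect_congr_support fun τ hτ => by rw [fst_of_mem_support_rollout hτ]
    | succ h =>
      have e0 : (⟨h + 1, by omega⟩ : Fin (n + 1)) = Fin.succ ⟨h, by omega⟩ := rfl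
      have e1 : (⟨h + 1 + 1, hh⟩ : Fin (n + 1)) = Fin.succ ⟨h + 1, by omega⟩ := rfl
      simp only [e0, e1, Fin.cons_succ]
      congr 1; funext s'
      exact ih (fun h => P h.succ) (fun h => π h.succ) s' h (by omega)

variable {H : ℕ}

/-- The probability that an episode played with `π` visits the pair `x` at step `h`. -/
def occ (M : MDP S A H) (π : Policy S A H) (h : Fin H) (x : S × A) : ℝ :=
  prob (M.trajectory π) {τ | τ h = x}

theorem occ_nonneg (M : MDP S A H) (π : Policy S A H) (h : Fin H) (x : S × A) :
    0 ≤ occ M π h x := prob_nonneg _ _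

theorem expect_trajectory_apply (M : MDP S A H) (π : Policy S A H) (h : Fin H)
    (f : S × A → ℝ) :
    expect (M.trajectory π) (fun τ => f (τ h)) = ∑ x, occ M π h x * f x := by
  simp only [occ, prob, ← expect_mul_right]
  rw [← expect_sum]
  congr 1; funext τ
  rw [Finset.sum_eq_single (τ h)]
  · simp
  · intro x _ hx
    rw [Set.indicator_of_notMem (by simpa using hx.symm), zero_mul]
  · simp

theorem sum_occ (M : MDP S A H) (π : Policy S A H) (h : Fin H) : ∑ x, occ M π h x = 1 := by
  have := expect_trajectory_apply M π h fun _ => 1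
  simpa [expect_const] using this.symm

theorem expect_trajectory_next (M : MDP S A H) (π : Policy S A H) (h : ℕ) (hh : h + 1 < H)
    (F : S × A → S → ℝ) :
    expect (M.trajectory π) (fun τ => F (τ ⟨h, by omega⟩) (τ ⟨h + 1, hh⟩).1)
      = ∑ x, occ M π ⟨h, by omega⟩ x * expect (M.P ⟨h, by omega⟩ x.1 x.2) (F x) := by
  rw [← expect_trajectory_apply M π ⟨h, by omega⟩ fun x =>
    expect (M.P ⟨h, by omega⟩ x.1 x.2) (F x), MDP.trajectory, expect_bind, expect_bind]
  congr 1; funext s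
  exact expect_rollout_next M.P π s h hh F

theorem expect_trajectory_action (M : MDP S A H) (π : Policy S A H) (h : Fin H)
    (F : S → A → ℝ) :
    expect (M.trajectory π) (fun τ => F (τ h).1 (τ h).2)
      = expect (M.trajectory π) fun τ => expect (π h (τ h).1) (F (τ h).1) := by
  rw [MDP.trajectory, expect_bind, expect_bind]
  congr 1; funext s
  exact expect_rollout_action M.P π s h F

theorem expect_trajectory_first (M : MDP S A H) (π : Policy S A H) (hH : 0 < H) (F : S → ℝ) :
    expect (M.trajectory π) (fun τ => F (τ ⟨0, hH⟩).1) = expect M.ν F := by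
  obtain ⟨n, rfl⟩ : ∃ n, H = n + 1 := ⟨H - 1, by omega⟩
  rw [MDP.trajectory, expect_bind]
  congr 1; funext s
  rw [← expect_const (rollout (n + 1) M.P π s) (F s)]
  exact expect_congr_support fun τ hτ => by
    rw [← fst_of_mem_support_rollout hτ]; rfl

/-- Splitting off the action probability yields the flow equation of the visitation probabilities
and their vanishing at actions that are never taken. -/
theorem occ_eq (M : MDP S A H) (π : Policy S A H) (h : Fin H) (x : S × A) :
    occ M π h x = expect (M.trajectory π) (fun τ => if (τ h).1 = x.1 then 1 else 0)
      * (π h x.1 x.2).toReal := by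
  have h1 : occ M π h x = expect (M.trajectory π) fun τ =>
      if (τ h).1 = x.1 then (if (τ h).2 = x.2 then (1 : ℝ) else 0) else 0 := by
    rw [occ, prob]
    congr 1; funext τ
    by_cases h1 : (τ h).1 = x.1 <;> by_cases h2 : (τ h).2 = x.2 <;>
      simp [Set.indicator, Prod.ext_iff, h1, h2]
  rw [h1, expect_trajectory_action M π h fun s a =>
    if s = x.1 then (if a = x.2 then (1 : ℝ) else 0) else 0, ← expect_mul_right]
  congr 1; funext τ
  by_cases h1 : (τ h).1 = x.1
  · simp [h1, expect]
  · simp [h1, expect_const]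

theorem occ_zero (M : MDP S A H) (π : Policy S A H) (hH : 0 < H) (x : S × A) :
    occ M π ⟨0, hH⟩ x = (M.ν x.1).toReal * (π ⟨0, hH⟩ x.1 x.2).toReal := by
  rw [occ_eq, expect_trajectory_first M π hH fun s => if s = x.1 then 1 else 0]
  simp [expect]

theorem occ_succ (M : MDP S A H) (π : Policy S A H) (h : ℕ) (hh : h + 1 < H) (x : S × A) :
    occ M π ⟨h + 1, hh⟩ x = (∑ y, occ M π ⟨h, by omega⟩ y
      * (M.P ⟨h, by omega⟩ y.1 y.2 x.1).toReal) * (π ⟨h + 1, hh⟩ x.1 x.2).toReal := by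
  rw [occ_eq, expect_trajectory_next M π h hh fun _ s => if s = x.1 then 1 else 0]
  simp [expect]

theorem occ_eq_zero {M : MDP S A H} {π : Policy S A H} {h : Fin H} {s : S} {a b : A}
    (hπ : π h s = PMF.pure a) (hb : b ≠ a) : occ M π h (s, b) = 0 := by
  rw [occ_eq, hπ]
  simp [hb]

theorem value_eq (M : MDP S A H) (π : Policy S A H) :
    M.value π = ∑ h, ∑ x : S × A, occ M π h x * M.r h x.1 x.2 := by
  have : M.value π = expect (M.trajectory π) fun τ => ∑ h, M.r h (τ h).1 (τ h).2 := by
    rw [MDP.value, expect]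
  rw [this, expect_sum]
  exact Finset.sum_congr rfl fun h _ =>
    expect_trajectory_apply M π h fun x => M.r h x.1 x.2

end Occupancy

/-! ### The design -/

section DesignFacts

variable {S A : Type*} [Fintype S] [Fintype A] [DecidableEq S] [DecidableEq A] {H K : ℕ}

theorem mix_eq_expect {X : Type*} (d : Fin K → X → ℝ) (α : PMF (Fin K)) (x : X) :
    mix d α x = expect α fun k => d k x := rfl

/-- The properties of the coarse estimates and the sampling weights that always hold. -/
structure Design.Valid (D : Design S A H K) : Prop where
  nonneg : ∀ k h x, 0 ≤ D.d k h x
  sum_le : ∀ k h, ∑ x, D.d k h x ≤ 1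
  optimal : ∀ h, IsOptimal (fun k => D.d k h) (D.α h)

/-- The coarse estimates are accurate up to constant factors, except for the ignored pairs. -/
structure Design.Accurate (D : Design S A H K) (M : MDP S A H) (π : Fin K → Policy S A H)
    (acc : ℝ) : Prop where
  le : ∀ k h x, D.d k h x ≠ 0 → 5 * acc ≤ D.d k h x
  le_occ : ∀ k h x, D.d k h x ≠ 0 → 4 / 5 * D.d k h x ≤ occ M (π k) h x
  occ_le : ∀ k h x, D.d k h x ≠ 0 → occ M (π k) h x ≤ 5 / 4 * D.d k h x
  occ_le_of_ignored : ∀ k h x, D.d k h x = 0 → occ M (π k) h x ≤ 8 * acc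

/-- Uniform weights on maximizers of the coordinates have worst ratio at most the number of
coordinates. -/
theorem exists_worstRatio_le {X : Type*} [Fintype X] [Nonempty X] [Nonempty (Fin K)]
    (d : Fin K → X → ℝ) (h0 : ∀ k x, 0 ≤ d k x) (h1 : ∀ k, ∑ x, d k x ≤ 1) :
    ∃ α : PMF (Fin K), worstRatio d α ≤ ENNReal.ofReal (Fintype.card X) := by
  choose κ hκ using fun x => Finite.exists_max fun k => d k x
  refine ⟨(PMF.uniformOfFintype X).map κ, iSup_le fun k => ?_⟩
  have hX : (0 : ℝ) < Fintype.card X := by exact_mod_cast Fintype.card_pos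
  -- The mixture carries at each x at least the share 1/|X| of the largest density there, hence d²/μ
  -- ≤ |X|·d.
  have hmix : ∀ x, d k x ≤ Fintype.card X * mix d ((PMF.uniformOfFintype X).map κ) x := by
    intro x
    rw [mix_eq_expect, expect_map, expect]
    simp only [PMF.uniformOfFintype_apply, ENNReal.toReal_inv, ENNReal.toReal_natCast]
    rw [← Finset.mul_sum, mul_inv_cancel_left₀ hX.ne']
    exact (hκ x k).trans
      (Finset.single_le_sum (f := fun y => d (κ y) x) (fun y _ => h0 _ _) (Finset.mem_univ x))
  calc ∑ x, ENNReal.ofReal (d k x) ^ 2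
        / ENNReal.ofReal (mix d ((PMF.uniformOfFintype X).map κ) x)
      ≤ ∑ x, ENNReal.ofReal (Fintype.card X * d k x) := by
        refine Finset.sum_le_sum fun x _ => ENNReal.div_le_of_le_mul ?_
        rw [← ENNReal.ofReal_pow (h0 k x), ← ENNReal.ofReal_mul (by have := h0 k x; positivity)]
        refine ENNReal.ofReal_le_ofReal ?_
        nlinarith [mul_le_mul_of_nonneg_left (hmix x) (h0 k x)]
    _ = ENNReal.ofReal (∑ x, Fintype.card X * d k x) := by
        rw [ENNReal.ofReal_sum_of_nonneg fun x _ => by have := h0 k x; positivity]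
    _ ≤ ENNReal.ofReal (Fintype.card X) := by
        refine ENNReal.ofReal_le_ofReal ?_
        rw [← Finset.mul_sum]
        exact mul_le_of_le_one_right hX.le (h1 k)

namespace Design.Valid

variable {D : Design S A H K} (hD : D.Valid)

include hD

theorem mu_nonneg (h : Fin H) (x : S × A) : 0 ≤ D.mu h x :=
  expect_nonneg fun k => hD.nonneg k h x

theorem worstRatio_le (h : Fin H) :
    worstRatio (fun k => D.d k h) (D.α h) ≤ ENNReal.ofReal (Fintype.card (S × A)) := by
  obtain ⟨k, -⟩ := (D.α h).support_nonempty
  haveI : Nonempty (Fin K) := ⟨k⟩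
  rcases isEmpty_or_nonempty (S × A) with hX | hX
  · simp [worstRatio]
  · obtain ⟨β, hβ⟩ := exists_worstRatio_le (fun k => D.d k h) (fun k => hD.nonneg k h)
      fun k => hD.sum_le k h
    exact (hD.optimal h β).trans hβ

theorem sum_ofReal_le (k : Fin K) (h : Fin H) :
    ∑ x, ENNReal.ofReal (D.d k h x) ^ 2 / ENNReal.ofReal (D.mu h x)
      ≤ ENNReal.ofReal (Fintype.card (S × A)) :=
  (le_iSup (fun k => ∑ x, ENNReal.ofReal (D.d k h x) ^ 2 / ENNReal.ofReal (D.mu h x)) k).trans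
    (hD.worstRatio_le h)

/-- In `worstRatio` a positive number divided by 0 is infinite, so a finite optimum forces μ to be
positive wherever some estimate is. Therefore the real-valued `D.ratio`, where division by 0 gives
0, loses nothing. -/
theorem mu_pos {k : Fin K} {h : Fin H} {x : S × A} (hx : D.d k h x ≠ 0) : 0 < D.mu h x := by
  refine lt_of_le_of_ne (hD.mu_nonneg h x) fun h0 => ?_
  have h1 := (Finset.single_le_sum (f := fun x => ENNReal.ofReal (D.d k h x) ^ 2
    / ENNReal.ofReal (D.mu h x)) (fun _ _ => zero_le) (Finset.mem_univ x)).trans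
    (hD.sum_ofReal_le k h)
  have hp : 0 < D.d k h x := lt_of_le_of_ne (hD.nonneg k h x) hx.symm
  rw [← h0, ENNReal.ofReal_zero, ENNReal.div_zero (by simpa using hp)] at h1
  exact ENNReal.ofReal_ne_top (top_le_iff.1 h1)

theorem ratio_nonneg (k : Fin K) (h : Fin H) : 0 ≤ D.ratio k h :=
  Finset.sum_nonneg fun x _ => div_nonneg (sq_nonneg _) (hD.mu_nonneg h x)

theorem ratio_le (k : Fin K) (h : Fin H) :
    D.ratio k h ≤ Fintype.card S * Fintype.card A := by
  have h1 := hD.sum_ofReal_le k h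
  have h2 : ∑ x, ENNReal.ofReal (D.d k h x) ^ 2 / ENNReal.ofReal (D.mu h x)
      = ENNReal.ofReal (D.ratio k h) := by
    rw [Design.ratio, ENNReal.ofReal_sum_of_nonneg fun x _ =>
      div_nonneg (sq_nonneg _) (hD.mu_nonneg h x)]
    refine Finset.sum_congr rfl fun x _ => ?_
    by_cases hx : D.d k h x = 0
    · simp [hx]
    · rw [ENNReal.ofReal_div_of_pos (hD.mu_pos hx), ENNReal.ofReal_pow (hD.nonneg k h x)]
  rw [h2, ENNReal.ofReal_le_ofReal_iff (Nat.cast_nonneg _), Fintype.card_prod, Nat.cast_mul] at h1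
  exact h1

theorem ratio_pos {k : Fin K} {h : Fin H} {x : S × A} (hx : D.d k h x ≠ 0) :
    0 < D.ratio k h :=
  Finset.sum_pos' (fun x _ => div_nonneg (sq_nonneg _) (hD.mu_nonneg h x))
    ⟨x, Finset.mem_univ x, div_pos (sq_pos_of_ne_zero hx) (hD.mu_pos hx)⟩

end Design.Valid

/-- The probability that a draw from the sampling distribution at step `h` yields the pair `x`. -/
def Design.smp (D : Design S A H K) (M : MDP S A H) (π : Fin K → Policy S A H) (h : Fin H)
    (x : S × A) : ℝ :=
  expect (D.α h) fun k => if D.d k h x = 0 then 0 else occ M (π k) h x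

theorem Design.smp_nonneg (D : Design S A H K) (M : MDP S A H) (π : Fin K → Policy S A H)
    (h : Fin H) (x : S × A) : 0 ≤ D.smp M π h x :=
  expect_nonneg fun k => by split_ifs <;> simp [occ_nonneg]

/-- Both sides mix with the same weights and both drop the ignored pairs, so the constant of the
coarse estimates carries over. -/
theorem Design.Accurate.mu_le_smp {D : Design S A H K} {M : MDP S A H}
    {π : Fin K → Policy S A H} {acc : ℝ} (hA : D.Accurate M π acc) (h : Fin H) (x : S × A) :
    4 / 5 * D.mu h x ≤ D.smp M π h x := by
  rw [Design.mu, mix_eq_expect, ← expect_mul_left]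
  refine expect_mono fun k => ?_
  split_ifs with hx
  · simp [hx]
  · exact hA.le_occ k h x hx

theorem Design.Accurate.smp_le_mu {D : Design S A H K} {M : MDP S A H}
    {π : Fin K → Policy S A H} {acc : ℝ} (hA : D.Accurate M π acc) (h : Fin H) (x : S × A) :
    D.smp M π h x ≤ 5 / 4 * D.mu h x := by
  rw [Design.mu, mix_eq_expect, ← expect_mul_left]
  refine expect_mono fun k => ?_
  split_ifs with hx
  · simp [hx]
  · exact hA.occ_le k h x hx

theorem expect_pairLaw (M : MDP S A H) (π : Fin K → Policy S A H) (D : Design S A H K)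
    (h : Fin H) (f : Option (S × A) → ℝ) (hf : f none = 0) :
    expect (pairLaw M π D h) f = ∑ x, D.smp M π h x * f (some x) := by
  have h1 : ∀ k, expect (M.trajectory (π k)) (fun τ => f (D.keep k h τ))
      = ∑ x, (if D.d k h x = 0 then 0 else occ M (π k) h x) * f (some x) := by
    intro k
    have := expect_trajectory_apply M (π k) h fun x =>
      if D.d k h x = 0 then 0 else f (some x)
    have e : (fun τ : Traj S A H => f (D.keep k h τ))
        = fun τ => if D.d k h (τ h) = 0 then 0 else f (some (τ h)) := by
      funext τ
      rw [Design.keep]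
      split_ifs <;> simp [hf]
    rw [e, this]
    refine Finset.sum_congr rfl fun x _ => ?_
    split_ifs <;> simp
  rw [pairLaw, expect_bind]
  simp_rw [expect_map, h1, expect_sum, expect_mul_right]
  rfl

theorem expect_transLaw_zero (M : MDP S A H) (π : Fin K → Policy S A H) (D : Design S A H K)
    (hH : 0 < H) (f : Option (S × A) × S → ℝ) :
    expect (transLaw M π D ⟨0, hH⟩) f = expect M.ν fun s => f (none, s) := by
  simp [transLaw, prev, expect_map]

/-- Whether a pair is discarded depends on the pair and the policy drawn only, so the state that
follows still has the true transition law. -/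
theorem expect_transLaw_succ (M : MDP S A H) (π : Fin K → Policy S A H) (D : Design S A H K)
    (m : ℕ) (hm : m + 1 < H) (f : Option (S × A) × S → ℝ) (hf : ∀ s, f (none, s) = 0) :
    expect (transLaw M π D ⟨m + 1, hm⟩) f
      = ∑ y, D.smp M π ⟨m, by omega⟩ y
        * expect (M.P ⟨m, by omega⟩ y.1 y.2) fun s => f (some y, s) := by
  have h1 : ∀ k, expect (M.trajectory (π k))
      (fun τ => f (D.keep k ⟨m, by omega⟩ τ, (τ ⟨m + 1, hm⟩).1))
      = ∑ x, (if D.d k ⟨m, by omega⟩ x = 0 then 0 else occ M (π k) ⟨m, by omega⟩ x)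
        * expect (M.P ⟨m, by omega⟩ x.1 x.2) fun s => f (some x, s) := by
    intro k
    have := expect_trajectory_next M (π k) m hm fun x s =>
      if D.d k ⟨m, by omega⟩ x = 0 then 0 else f (some x, s)
    have e : (fun τ : Traj S A H => f (D.keep k ⟨m, by omega⟩ τ, (τ ⟨m + 1, hm⟩).1))
        = fun τ => if D.d k ⟨m, by omega⟩ (τ ⟨m, by omega⟩) = 0 then 0
          else f (some (τ ⟨m, by omega⟩), (τ ⟨m + 1, hm⟩).1) := by
      funext τ
      rw [Design.keep]
      split_ifs <;> simp [hf]
    rw [e, this]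
    refine Finset.sum_congr rfl fun x _ => ?_
    split_ifs <;> simp [expect_const]
  have e : prev (⟨m + 1, hm⟩ : Fin H) = some ⟨m, by omega⟩ := by
    simp [prev]
  rw [transLaw, e, Option.elim_some, expect_bind]
  simp_rw [expect_map, h1, expect_sum, expect_mul_right]
  rfl

theorem expect_sampleLaw_fst (M : MDP S A H) (π : Fin K → Policy S A H) (D : Design S A H K)
    (h : Fin H) (f : Option (S × A) → ℝ) :
    expect (sampleLaw M π D h) (fun z => f z.1) = expect (pairLaw M π D h) f := by
  rw [sampleLaw, expect_bind]
  simp [expect_map, expect_const]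

theorem expect_sampleLaw_snd (M : MDP S A H) (π : Fin K → Policy S A H) (D : Design S A H K)
    (h : Fin H) (f : Option (S × A) × S → ℝ) :
    expect (sampleLaw M π D h) (fun z => f z.2) = expect (transLaw M π D h) f := by
  rw [sampleLaw, expect_bind]
  simp [expect_map, expect_const]

/-! ### The coarse estimates -/

theorem coarse_nonneg {n : ℕ} (acc : ℝ) (data : Fin n → Traj S A H) (h : Fin H) (x : S × A) :
    0 ≤ coarse acc data h x := by
  rw [coarse]
  split_ifs <;> positivity

theorem sum_coarse_le {n : ℕ} {acc : ℝ} (data : Fin n → Traj S A H) (h : Fin H) :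
    ∑ x, coarse acc data h x ≤ 1 := by
  have h1 : ∀ x, coarse acc data h x
      ≤ ((Finset.univ.filter fun i => data i h = x).card : ℝ) / n := by
    intro x
    rw [coarse]
    split_ifs
    · positivity
    · exact le_rfl
  refine (Finset.sum_le_sum fun x _ => h1 x).trans ?_
  rw [← Finset.sum_div, ← Nat.cast_sum, ← Finset.card_eq_sum_card_fiberwise
    (fun i _ => Finset.mem_coe.2 (Finset.mem_univ _)), Finset.card_univ, Fintype.card_fin]
  exact div_self_le_one _

theorem design_valid {θ : Params H} {solve : (Fin K → S × A → ℝ) → PMF (Fin K)}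
    (hs : IsSolver solve) (data : Fin K → Fin θ.n₀ → Traj S A H) :
    (design θ solve data).Valid where
  nonneg k h x := coarse_nonneg _ _ _ _
  sum_le k h := sum_coarse_le _ _
  optimal h := hs _ fun k x => coarse_nonneg _ _ _ _

theorem hits_univ_eq_card {n : ℕ} (data : Fin n → Traj S A H) (h : Fin H) (x : S × A) :
    hits Finset.univ {τ : Traj S A H | τ h = x} data
      = ((Finset.univ.filter fun i => data i h = x).card : ℝ) := by
  simp [hits, Set.indicator]

/-- The count has relative error 1/16 and additive error acc/2. For a kept frequency, at least
5·acc, the latter is at most a tenth of it, and both fit into the factors 4/5 and 5/4. -/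
theorem coarse_accurate {n : ℕ} (hn : 0 < n) {acc t : ℝ} (hacc : 0 < acc)
    (hn' : 64 * t / n ≤ acc / 2) {data : Fin n → Traj S A H} {h : Fin H} {x : S × A} {p : ℝ}
    (hp0 : 0 ≤ p)
    (hp : |hits Finset.univ {τ : Traj S A H | τ h = x} data - n * p|
      < 1 / 64 * (4 * (n * p)) + t / (1 / 64)) :
    (coarse acc data h x ≠ 0 → 5 * acc ≤ coarse acc data h x
      ∧ 4 / 5 * coarse acc data h x ≤ p ∧ p ≤ 5 / 4 * coarse acc data h x)
      ∧ (coarse acc data h x = 0 → p ≤ 8 * acc) := by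
  have hn0 : (0 : ℝ) < n := by exact_mod_cast hn
  rw [hits_univ_eq_card] at hp
  set c : ℝ := ((Finset.univ.filter fun i => data i h = x).card : ℝ) with hc
  have h1 : |c / n - p| ≤ p / 16 + acc / 2 := by
    have e : c / n - p = (c - n * p) / n := by field_simp
    rw [e, abs_div, abs_of_pos hn0, div_le_iff₀ hn0]
    have h2 : 64 * t ≤ acc / 2 * n := (div_le_iff₀ hn0).1 hn'
    nlinarith [hp.le]
  obtain ⟨h2, h3⟩ := abs_le.1 h1
  have hdef : coarse acc data h x = if c / n < 5 * acc then 0 else c / n := rfl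
  rw [hdef]
  split_ifs with hlt
  · exact ⟨fun h => absurd rfl h, fun _ => by linarith⟩
  · exact ⟨fun _ => ⟨by linarith, by linarith, by linarith⟩, fun h => by linarith⟩

theorem prob_not_accurate_le (M : MDP S A H) (π : Fin K → Policy S A H) (θ : Params H)
    (solve : (Fin K → S × A → ℝ) → PMF (Fin K)) {t : ℝ} (hn : 64 * t / θ.n₀ ≤ θ.acc / 2) :
    prob (indep fun k => indep fun _ : Fin θ.n₀ => M.trajectory (π k))
      {data | (design θ solve data).Accurate M π θ.acc}ᶜ
      ≤ (K * (H * (Fintype.card S * Fintype.card A))) * (2 * Real.exp (-t)) := by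
  set E : Fin K × Fin H × (S × A) → Set (Fin K → Fin θ.n₀ → Traj S A H) := fun i =>
    {data | 1 / 64 * (4 * (θ.n₀ * occ M (π i.1) i.2.1 i.2.2)) + t / (1 / 64)
      ≤ |hits Finset.univ {τ : Traj S A H | τ i.2.1 = i.2.2} (data i.1)
        - θ.n₀ * occ M (π i.1) i.2.1 i.2.2|} with hE
  have h1 : {data | (design θ solve data).Accurate M π θ.acc}ᶜ
      ⊆ {data | ∃ i ∈ (Finset.univ : Finset (Fin K × Fin H × (S × A))), data ∈ E i} := by
    intro data hdata
    by_contra hcon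
    simp only [Finset.mem_univ, true_and, Set.mem_ofPred_eq, not_exists, hE, not_le] at hcon
    have key : ∀ k h x, _ := fun k h x => coarse_accurate θ.n₀_pos θ.acc_pos hn
      (occ_nonneg M (π k) h x) (hcon (k, h, x))
    exact hdata ⟨fun k h x hx => ((key k h x).1 hx).1, fun k h x hx => ((key k h x).1 hx).2.1,
      fun k h x hx => ((key k h x).1 hx).2.2, fun k h x hx => (key k h x).2 hx⟩
  refine (prob_mono h1).trans ((prob_biUnion_le_card _ _ _ (b := 2 * Real.exp (-t))
    fun i _ => ?_).trans (le_of_eq ?_))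
  · refine prob_indep_le _ i.1 _ fun data => ?_
    have := prob_abs_hits_ge_le (M.trajectory (π i.1)) (Finset.univ : Finset (Fin θ.n₀))
      {τ : Traj S A H | τ i.2.1 = i.2.2} (r := 1 / 64) (by norm_num) (by norm_num) t
    refine le_trans (prob_mono fun y hy => ?_) this
    simpa [hE, occ] using hy
  · simp

end DesignFacts

/-! ### Projected stochastic gradient descent in one dimension -/

/-- Projected stochastic gradient descent on `[0, cap]` for a quadratic function whose gradient
at `v` has the estimate `a i * v - b i` in iteration `i`. -/
def chain (cap : ℝ) (η a b : ℕ → ℝ) (v : ℝ) : ℕ → ℝ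
  | 0 => v
  | i + 1 => max 0 (min cap
      (chain cap η a b v i - η (i + 1) * (a i * chain cap η a b v i - b i)))

theorem clip_mem {cap : ℝ} (hcap : 0 ≤ cap) (v : ℝ) :
    max 0 (min cap v) ∈ Set.Icc 0 cap :=
  ⟨le_max_left _ _, max_le hcap (min_le_left _ _)⟩

theorem clip_of_mem {cap v : ℝ} (hv : v ∈ Set.Icc 0 cap) : max 0 (min cap v) = v := by
  rw [min_eq_right hv.2, max_eq_right hv.1]

theorem abs_clip_sub_clip_le (cap u v : ℝ) :
    |max 0 (min cap u) - max 0 (min cap v)| ≤ |u - v| := by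
  rcases max_cases 0 (min cap u) with h | h <;> rcases max_cases 0 (min cap v) with h' | h' <;>
  rcases min_cases cap u with g | g <;> rcases min_cases cap v with g' | g' <;>
  rcases abs_cases (u - v) with k | k <;> rw [abs_le] <;> constructor <;> linarith

theorem chain_mem {cap : ℝ} (hcap : 0 ≤ cap) (η a b : ℕ → ℝ) {v : ℝ} (hv : v ∈ Set.Icc 0 cap)
    (i : ℕ) : chain cap η a b v i ∈ Set.Icc 0 cap := by
  cases i with
  | zero => exact hv
  | succ i => exact clip_mem hcap _

theorem chain_congr (cap : ℝ) (η : ℕ → ℝ) {a b a' b' : ℕ → ℝ} (v : ℝ) (m : ℕ)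
    (ha : ∀ i < m, a i = a' i) (hb : ∀ i < m, b i = b' i) :
    chain cap η a b v m = chain cap η a' b' v m := by
  induction m with
  | zero => rfl
  | succ m ih =>
    rw [chain, chain, ih (fun i hi => ha i (hi.trans m.lt_succ_self))
      (fun i hi => hb i (hi.trans m.lt_succ_self)), ha m m.lt_succ_self, hb m m.lt_succ_self]

/-- The dependence of the iterates on the gradient estimates. -/
theorem abs_chain_sub_le {cap : ℝ} (hcap : 0 ≤ cap) {η a b a' b' : ℕ → ℝ} {v : ℝ}
    (hv : v ∈ Set.Icc 0 cap) (hη : ∀ i, 0 ≤ η i) (ha0 : ∀ i, 0 ≤ η (i + 1) * a' i)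
    (ha1 : ∀ i, η (i + 1) * a' i ≤ 1) (m : ℕ) :
    |chain cap η a b v m - chain cap η a' b' v m|
      ≤ ∑ l ∈ Finset.range m, η (l + 1) * (|a l - a' l| * cap + |b l - b' l|) := by
  induction m with
  | zero => simp [chain]
  | succ m ih =>
    rw [chain, chain, Finset.sum_range_succ]
    refine (abs_clip_sub_clip_le _ _ _).trans ?_
    set u := chain cap η a b v m with hu
    set u' := chain cap η a' b' v m
    have hum : u ∈ Set.Icc 0 cap := chain_mem hcap _ _ _ hv m
    have e : u - η (m + 1) * (a m * u - b m) - (u' - η (m + 1) * (a' m * u' - b' m))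
        = (1 - η (m + 1) * a' m) * (u - u')
          + η (m + 1) * (-((a m - a' m) * u) + (b m - b' m)) := by ring
    rw [e]
    refine (abs_add_le _ _).trans (add_le_add ?_ ?_)
    · rw [abs_mul, abs_of_nonneg (by linarith [ha1 m])]
      exact (mul_le_of_le_one_left (abs_nonneg _) (by linarith [ha0 m])).trans ih
    · rw [abs_mul, abs_of_nonneg (hη _)]
      refine mul_le_mul_of_nonneg_left ((abs_add_le _ _).trans ?_) (hη _)
      rw [abs_neg, abs_mul, abs_of_nonneg hum.1]
      gcongr
      exact hum.2

/-- Two runs with the same step sizes and curvatures after time `j₀` approach each other. -/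
theorem abs_chain_sub_chain_le {cap : ℝ} (hcap : 0 ≤ cap) {η η' a b b' : ℕ → ℝ} {v v' : ℝ}
    (hv : v ∈ Set.Icc 0 cap) (hv' : v' ∈ Set.Icc 0 cap) {j₀ j : ℕ} (hj : j₀ ≤ j)
    (hη : ∀ i, 0 ≤ η i) (hηη : ∀ i, j₀ ≤ i → η' (i + 1) = η (i + 1))
    (ha0 : ∀ i, 0 ≤ η (i + 1) * a i) (ha1 : ∀ i, j₀ ≤ i → η (i + 1) * a i ≤ 1) :
    |chain cap η a b v j - chain cap η' a b' v' j|
      ≤ cap * Real.exp (-∑ l ∈ Finset.Ico j₀ j, η (l + 1) * a l)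
        + ∑ l ∈ Finset.Ico j₀ j, η (l + 1) * |b l - b' l| := by
  induction j, hj using Nat.le_induction with
  -- At time j₀ nothing is known except that both runs lie in [0, cap]; the two histories need not
  -- be related.
  | base =>
    have h1 := chain_mem hcap η a b hv j₀
    have h2 := chain_mem hcap η' a b' hv' j₀
    simp only [Finset.Ico_self, Finset.sum_empty, neg_zero, Real.exp_zero, mul_one, add_zero]
    rw [abs_le]
    constructor <;> linarith [h1.1, h1.2, h2.1, h2.2]
  | succ j hj ih =>
    rw [chain, chain, Finset.sum_Ico_succ_top hj, Finset.sum_Ico_succ_top hj, hηη j hj]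
    refine (abs_clip_sub_clip_le _ _ _).trans ?_
    set u := chain cap η a b v j
    set u' := chain cap η' a b' v' j
    have e : u - η (j + 1) * (a j * u - b j) - (u' - η (j + 1) * (a j * u' - b' j))
        = (1 - η (j + 1) * a j) * (u - u') + η (j + 1) * (b j - b' j) := by ring
    rw [e]
    have h0 : 0 ≤ 1 - η (j + 1) * a j := by linarith [ha1 j hj]
    have hs : 0 ≤ ∑ l ∈ Finset.Ico j₀ j, η (l + 1) * |b l - b' l| :=
      Finset.sum_nonneg fun l _ => mul_nonneg (hη _) (abs_nonneg _)
    have hneg := ha0 j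
    calc |(1 - η (j + 1) * a j) * (u - u') + η (j + 1) * (b j - b' j)|
        ≤ (1 - η (j + 1) * a j) * |u - u'| + η (j + 1) * |b j - b' j| := by
          refine (abs_add_le _ _).trans ?_
          rw [abs_mul, abs_mul, abs_of_nonneg h0, abs_of_nonneg (hη _)]
      _ ≤ (1 - η (j + 1) * a j) * (cap * Real.exp (-∑ l ∈ Finset.Ico j₀ j, η (l + 1) * a l)
            + ∑ l ∈ Finset.Ico j₀ j, η (l + 1) * |b l - b' l|)
            + η (j + 1) * |b j - b' j| := by gcongr
      _ ≤ _ := by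
          rw [neg_add, Real.exp_add, mul_add, add_assoc]
          refine add_le_add ?_ (add_le_add ?_ le_rfl)
          · have := Real.one_sub_le_exp_neg (η (j + 1) * a j)
            have hc : 0 ≤ cap * Real.exp (-∑ l ∈ Finset.Ico j₀ j, η (l + 1) * a l) := by
              positivity
            nlinarith
          · exact mul_le_of_le_one_left hs (by linarith)

/-- The sequence of values of a function at the draws, continued by `0`. -/
def seqOf {Z : Type*} {N : ℕ} (f : Z → ℝ) (data : Fin N → Z) (i : ℕ) : ℝ :=
  if hi : i < N then f (data ⟨i, hi⟩) else 0

theorem seqOf_update_of_ne {Z : Type*} {N : ℕ} (f : Z → ℝ) (data : Fin N → Z) (m : Fin N) (z : Z)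
    {i : ℕ} (hi : i ≠ m) : seqOf f (Function.update data m z) i = seqOf f data i := by
  unfold seqOf
  split_ifs with h
  · rw [Function.update_of_ne]
    exact fun h' => hi (congrArg Fin.val h')
  · rfl

theorem seqOf_update_self {Z : Type*} {N : ℕ} (f : Z → ℝ) (data : Fin N → Z) (m : Fin N) (z : Z) :
    seqOf f (Function.update data m z) m = f z := by
  simp [seqOf]

theorem seqOf_nonneg {Z : Type*} {N : ℕ} {f : Z → ℝ} (hf : ∀ z, 0 ≤ f z) (data : Fin N → Z)
    (i : ℕ) : 0 ≤ seqOf f data i := by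
  unfold seqOf
  split_ifs
  exacts [hf _, le_rfl]

theorem seqOf_le {Z : Type*} {N : ℕ} {f : Z → ℝ} {c : ℝ} (hc : 0 ≤ c) (hf : ∀ z, f z ≤ c)
    (data : Fin N → Z) (i : ℕ) : seqOf f data i ≤ c := by
  unfold seqOf
  split_ifs
  exacts [hf _, hc]

/-- Mean squared distance of the iterates to the minimizer, for a start in the minimizer. -/
theorem expect_chain_sq_le {Z : Type*} [Fintype Z] {N : ℕ} (q : PMF Z) {cap θ σ : ℝ}
    (hθ : θ ∈ Set.Icc 0 cap) (η : ℕ → ℝ) (hη : ∀ i, 0 ≤ η i) (a b : Z → ℝ)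
    (hopt : ∀ v ∈ Set.Icc 0 cap, 0 ≤ (expect q a * v - expect q b) * (v - θ))
    (hσ : ∀ v ∈ Set.Icc 0 cap, expect q (fun z => (a z * v - b z) ^ 2) ≤ σ) {m : ℕ} (hm : m ≤ N) :
    expect (indep fun _ : Fin N => q)
        (fun data => (chain cap η (seqOf a data) (seqOf b data) θ m - θ) ^ 2)
      ≤ ∑ l ∈ Finset.range m, η (l + 1) ^ 2 * σ := by
  have hcap : 0 ≤ cap := hθ.1.trans hθ.2
  induction m with
  | zero => simp [chain, expect_const]
  | succ m ih =>
    have hmN : m < N := hm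
    rw [Finset.sum_range_succ, expect_indep_update _ ⟨m, hmN⟩]
    refine le_trans ?_ (add_le_add (ih hmN.le) le_rfl)
    rw [← expect_const (indep fun _ : Fin N => q) (η (m + 1) ^ 2 * σ), ← expect_add]
    refine expect_mono fun data => ?_
    set u := chain cap η (seqOf a data) (seqOf b data) θ m with hu
    have hum : u ∈ Set.Icc 0 cap := chain_mem hcap _ _ _ hθ m
    have h1 : ∀ z, chain cap η (seqOf a (Function.update data ⟨m, hmN⟩ z))
        (seqOf b (Function.update data ⟨m, hmN⟩ z)) θ (m + 1)
        = max 0 (min cap (u - η (m + 1) * (a z * u - b z))) := by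
      intro z
      rw [chain, chain_congr cap η θ m
        (fun i hi => seqOf_update_of_ne a data ⟨m, hmN⟩ z (ne_of_lt hi))
        (fun i hi => seqOf_update_of_ne b data ⟨m, hmN⟩ z (ne_of_lt hi)), ← hu]
      rw [show seqOf a (Function.update data ⟨m, hmN⟩ z) m = a z from
        seqOf_update_self a data ⟨m, hmN⟩ z, show seqOf b (Function.update data ⟨m, hmN⟩ z) m = b z
        from seqOf_update_self b data ⟨m, hmN⟩ z]
    -- Projection does not increase the distance to θ, and the cross term has the right sign in mean
    -- by `hopt`, as draw m is independent of u. Since the run starts in θ, no strong convexity is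
    -- needed.
    have h2 : ∀ z, (max 0 (min cap (u - η (m + 1) * (a z * u - b z))) - θ) ^ 2
        ≤ ((u - θ) ^ 2 - 2 * η (m + 1) * (u - θ) * (a z * u - b z))
          + η (m + 1) ^ 2 * (a z * u - b z) ^ 2 := by
      intro z
      have h3 := abs_clip_sub_clip_le cap (u - η (m + 1) * (a z * u - b z)) θ
      rw [clip_of_mem hθ] at h3
      have h4 := sq_le_sq.2 h3
      refine h4.trans (le_of_eq ?_)
      ring
    simp only [h1]
    refine (expect_mono h2).trans ?_
    rw [expect_add, expect_sub, expect_const, expect_mul_left, expect_mul_left, expect_sub,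
      expect_mul_right]
    have h5 := hopt u hum
    have h6 := mul_le_mul_of_nonneg_left (hσ u hum) (sq_nonneg (η (m + 1)))
    nlinarith [mul_nonneg (hη (m + 1)) h5]

/-- The projection of the unconstrained minimizer is the minimizer of a quadratic function on an
interval. -/
theorem clip_div_optimal {cap a b v : ℝ} (ha : 0 < a) (hv : v ∈ Set.Icc 0 cap) :
    0 ≤ (a * v - b) * (v - max 0 (min cap (b / a))) := by
  have e : a * v - b = a * (v - b / a) := by field_simp
  rw [e, mul_assoc]
  refine mul_nonneg ha.le ?_
  rcases max_cases 0 (min cap (b / a)) with h | h <;> rcases min_cases cap (b / a) with g | g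
  · rw [h.1]; nlinarith [hv.1, hv.2]
  · rw [h.1]; nlinarith [hv.1, hv.2]
  · rw [h.1, g.1]; nlinarith [hv.1, hv.2]
  · rw [h.1, g.1]; nlinarith [hv.1, hv.2]

/-- The draws with indices in `[j₀, j)`. -/
def window (N j₀ j : ℕ) : Finset (Fin N) := Finset.univ.filter fun i => j₀ ≤ (i : ℕ) ∧ (i : ℕ) < j

theorem map_window {N j₀ j : ℕ} (hj : j ≤ N) :
    (window N j₀ j).map Fin.valEmbedding = Finset.Ico j₀ j := by
  ext l
  simp only [window, Finset.mem_map, Finset.mem_filter, Finset.mem_univ, true_and,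
    Fin.valEmbedding_apply, Finset.mem_Ico]
  constructor
  · rintro ⟨i, hi, rfl⟩
    exact hi
  · intro hl
    exact ⟨⟨l, by omega⟩, hl, rfl⟩

theorem card_window {N j₀ j : ℕ} (hj : j ≤ N) : (window N j₀ j).card = j - j₀ := by
  rw [← Finset.card_map Fin.valEmbedding, map_window hj, Nat.card_Ico]

theorem sum_Ico_seqOf {Z : Type*} {N j₀ j : ℕ} (hj : j ≤ N) (f : Z → ℝ) (data : Fin N → Z) :
    ∑ l ∈ Finset.Ico j₀ j, seqOf f data l = ∑ i ∈ window N j₀ j, f (data i) := by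
  rw [← map_window hj, Finset.sum_map]
  refine Finset.sum_congr rfl fun i _ => ?_
  simp [seqOf]

/-! ### One step of the density estimation -/

section Stage

variable {S A : Type*} [Fintype S] [Fintype A] [DecidableEq S] [DecidableEq A]

/-- The coefficient of the iterate in the stochastic gradient. -/
def hit (mu : S × A → ℝ) (x : S × A) (z : Sample S A) : ℝ := if z.1 = some x then (mu x)⁻¹ else 0

/-- The part of the stochastic gradient that does not depend on the iterate. -/
def push (pol : S → PMF A) (u : Option (S × A) → ℝ) (x : S × A) (z : Sample S A) : ℝ :=
  if z.2.2 = x.1 then u z.2.1 * (pol x.1 x.2).toReal else 0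

/-- The minimizer of the expected loss on the box. -/
def target (q : PMF (Sample S A)) (dhat mu : S × A → ℝ) (pol : S → PMF A)
    (u : Option (S × A) → ℝ) (x : S × A) : ℝ :=
  max 0 (min (2 * dhat x) (expect q (push pol u x) / expect q (hit mu x)))

/-- The gradient at x involves the iterate only through its value at x, so the descent decouples
into one-dimensional runs. Beyond the sample both sides stay constant. -/
theorem sgd_eq_chain {dhat : S × A → ℝ} (hd : ∀ x, 0 ≤ dhat x) (η : ℕ → ℝ) (pol : S → PMF A)
    (mu : S × A → ℝ) (u : Option (S × A) → ℝ) {N : ℕ} (data : Fin N → Sample S A) (i : ℕ)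
    (x : S × A) :
    sgd dhat η pol mu u data i x
      = chain (2 * dhat x) η (seqOf (hit mu x) data) (seqOf (push pol u x) data) 0 i := by
  have hcap : 0 ≤ 2 * dhat x := by have := hd x; positivity
  induction i with
  | zero => rfl
  | succ i ih =>
    rw [sgd, chain]
    split_ifs with hi
    · beta_reduce
      rw [ih]
      simp only [grad, seqOf, hi, dif_pos, hit, push, ih]
      congr 4
      split_ifs <;> simp [div_eq_mul_inv, mul_comm]
    · simp only [seqOf, hi, dif_neg, not_false_eq_true, zero_mul, sub_zero, mul_zero, ih]
      rw [clip_of_mem]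
      exact chain_mem hcap _ _ _ ⟨le_rfl, hcap⟩ i

theorem hit_nonneg {mu : S × A → ℝ} {x : S × A} (hx : 0 ≤ mu x) (z : Sample S A) :
    0 ≤ hit mu x z := by
  unfold hit
  split_ifs
  exacts [inv_nonneg.2 hx, le_rfl]

theorem hit_le {mu : S × A → ℝ} {x : S × A} (hx : 0 ≤ mu x) (z : Sample S A) :
    hit mu x z ≤ (mu x)⁻¹ := by
  unfold hit
  split_ifs
  exacts [le_rfl, inv_nonneg.2 hx]

theorem push_nonneg (pol : S → PMF A) {u : Option (S × A) → ℝ} (hu : ∀ o, 0 ≤ u o) (x : S × A)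
    (z : Sample S A) : 0 ≤ push pol u x z := by
  unfold push
  split_ifs
  exacts [mul_nonneg (hu _) ENNReal.toReal_nonneg, le_rfl]

/-- Action probabilities sum to one at the observed next state, so in ℓ¹ one draw moves all
coordinates together by no more than u. -/
theorem sum_push (pol : S → PMF A) (u : Option (S × A) → ℝ) (z : Sample S A) :
    ∑ x, push pol u x z = u z.2.1 := by
  rw [Fintype.sum_prod_type, Finset.sum_eq_single z.2.2]
  · simp [push, ← Finset.mul_sum, sum_toReal]
  · intro s _ hs
    simp [push, hs.symm]
  · simp

theorem sum_push_sq_le (pol : S → PMF A) {u : Option (S × A) → ℝ} (hu : ∀ o, 0 ≤ u o)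
    (z : Sample S A) : ∑ x, push pol u x z ^ 2 ≤ u z.2.1 ^ 2 := by
  calc ∑ x, push pol u x z ^ 2 ≤ ∑ x, push pol u x z * u z.2.1 := by
        refine Finset.sum_le_sum fun x _ => ?_
        rw [sq]
        refine mul_le_mul_of_nonneg_left ?_ (push_nonneg pol hu x z)
        rw [← sum_push pol u z]
        exact Finset.single_le_sum (f := fun x => push pol u x z)
          (fun x _ => push_nonneg pol hu x z) (Finset.mem_univ x)
    _ = u z.2.1 ^ 2 := by rw [← Finset.sum_mul, sum_push, sq]

theorem sum_some_eq {X : Type*} [DecidableEq X] (I : Finset X) (o : Option X) (g : X → ℝ) :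
    ∑ x ∈ I, (if o = some x then g x else 0) = o.elim 0 fun y => if y ∈ I then g y else 0 := by
  cases o <;> simp

theorem sum_hit_mul_le {mu : S × A → ℝ} {I : Finset (S × A)} {c : S × A → ℝ} {M : ℝ} (hM : 0 ≤ M)
    (h : ∀ x ∈ I, (mu x)⁻¹ * c x ≤ M) (z : Sample S A) : ∑ x ∈ I, hit mu x z * c x ≤ M := by
  simp only [hit, ite_mul, zero_mul]
  rw [sum_some_eq]
  cases z.1 with
  | none => exact hM
  | some y =>
    simp only [Option.elim_some]
    split_ifs with hy
    exacts [h y hy, hM]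

/-- A draw hits at most one pair, so no cross terms occur. -/
theorem sum_hit_mul_sq (mu : S × A → ℝ) (I : Finset (S × A)) (c : S × A → ℝ) (z : Sample S A) :
    (∑ x ∈ I, hit mu x z * c x) ^ 2 = ∑ x ∈ I, hit mu x z ^ 2 * c x ^ 2 := by
  have e : ∀ x, hit mu x z ^ 2 * c x ^ 2
      = if z.1 = some x then ((mu x)⁻¹) ^ 2 * c x ^ 2 else 0 := by
    intro x
    unfold hit
    split_ifs <;> simp
  simp only [e]
  simp only [hit, ite_mul, zero_mul]
  rw [sum_some_eq, sum_some_eq]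
  cases z.1 with
  | none => simp
  | some y =>
    simp only [Option.elim_some]
    split_ifs <;> ring

theorem expect_hit (q : PMF (Sample S A)) (mu : S × A → ℝ) (x : S × A) :
    expect q (hit mu x) = (mu x)⁻¹ * prob q {z | z.1 = some x} := by
  rw [prob, ← expect_mul_left]
  congr 1; funext z
  simp [hit, Set.indicator]

theorem expect_hit_sq (q : PMF (Sample S A)) (mu : S × A → ℝ) (x : S × A) :
    expect q (fun z => hit mu x z ^ 2) = (mu x)⁻¹ ^ 2 * prob q {z | z.1 = some x} := by
  rw [prob, ← expect_mul_left]
  congr 1; funext z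
  simp [hit, Set.indicator]

/-- What the analysis of one step needs to know about the sampling law `q`, the coarse estimates
`dhat`, the sampling distribution `mu` and the density ratio `u` of the step before. -/
structure Stage (q : PMF (Sample S A)) (dhat mu : S × A → ℝ) (u : Option (S × A) → ℝ)
    (ρ s : ℝ) : Prop where
  dhat_nonneg : ∀ x, 0 ≤ dhat x
  sum_dhat_le : ∑ x, dhat x ≤ 1
  mu_pos : ∀ x, dhat x ≠ 0 → 0 < mu x
  le_hit : ∀ x, dhat x ≠ 0 → 4 / 5 * mu x ≤ prob q {z | z.1 = some x}
  hit_le : ∀ x, dhat x ≠ 0 → prob q {z | z.1 = some x} ≤ 5 / 4 * mu x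
  sum_sq_le : ∑ x, dhat x ^ 2 / mu x ≤ ρ
  u_nonneg : ∀ o, 0 ≤ u o
  u_sq_le : expect q (fun z => u z.2.1 ^ 2) ≤ 5 * ρ
  card_le : ((Finset.univ.filter fun x => dhat x ≠ 0).card : ℝ) ≤ s
  ρ_pos : 0 < ρ
  s_pos : 0 < s

/-- The part of `u` that is at most `2 B`. -/
def low (B : ℝ) (u : Option (S × A) → ℝ) (o : Option (S × A)) : ℝ :=
  if u o ≤ 2 * B then u o else 0

/-- The part of `u` that exceeds `2 B`. -/
def high (B : ℝ) (u : Option (S × A) → ℝ) (o : Option (S × A)) : ℝ :=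
  if u o ≤ 2 * B then 0 else u o

/-- The step sizes `p / i`, switched off up to time `j₀`. -/
def steps (p : ℝ) (j₀ i : ℕ) : ℝ := if j₀ < i then p / i else 0

/-- The coordinates whose iterates are stable in the window that ends at time `j`. -/
def stable (dhat mu : S × A → ℝ) (p B : ℝ) (j : ℕ) : Finset (S × A) :=
  Finset.univ.filter fun x => dhat x ≠ 0 ∧ dhat x ≤ B * mu x ∧ 2 * p / j ≤ mu x

/-- The deviation at time `j` of the descent that is started at time `j / 2` in its target and
restricted to moderate gradients. -/
def dev (q : PMF (Sample S A)) (dhat mu : S × A → ℝ) (pol : S → PMF A) (u : Option (S × A) → ℝ)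
    (p B : ℝ) (j : ℕ) {N : ℕ} (data : Fin N → Sample S A) : ℝ :=
  ∑ x ∈ stable dhat mu p B j,
    |chain (2 * dhat x) (steps p (j / 2)) (seqOf (hit mu x) data)
        (seqOf (push pol (low B u) x) data) (target q dhat mu pol (low B u) x) j
      - target q dhat mu pol (low B u) x|

theorem steps_nonneg {p : ℝ} (hp : 0 ≤ p) (j₀ i : ℕ) : 0 ≤ steps p j₀ i := by
  unfold steps
  split_ifs <;> positivity

theorem steps_le {p : ℝ} (hp : 0 ≤ p) {j : ℕ} (hj : 0 < j) (i : ℕ) :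
    steps p (j / 2) i ≤ 2 * p / j := by
  unfold steps
  split_ifs with h
  · have hi : (0 : ℝ) < i := by exact_mod_cast (Nat.zero_le _).trans_lt h
    have hj' : (0 : ℝ) < j := by exact_mod_cast hj
    have h2 : (j : ℝ) ≤ 2 * i := by exact_mod_cast (by omega : j ≤ 2 * i)
    rw [div_le_div_iff₀ hi hj']
    nlinarith
  · positivity

theorem low_nonneg {u : Option (S × A) → ℝ} (hu : ∀ o, 0 ≤ u o) (B : ℝ) (o : Option (S × A)) :
    0 ≤ low B u o := by
  unfold low; split_ifs <;> simp [hu]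

theorem high_nonneg {u : Option (S × A) → ℝ} (hu : ∀ o, 0 ≤ u o) (B : ℝ) (o : Option (S × A)) :
    0 ≤ high B u o := by
  unfold high; split_ifs <;> simp [hu]

theorem low_add_high (u : Option (S × A) → ℝ) (B : ℝ) (o : Option (S × A)) :
    low B u o + high B u o = u o := by
  unfold low high; split_ifs <;> simp

theorem low_le {u : Option (S × A) → ℝ} {B : ℝ} (hB : 0 ≤ B) (o : Option (S × A)) :
    low B u o ≤ 2 * B := by
  unfold low; split_ifs <;> linarith

theorem low_sq_le {u : Option (S × A) → ℝ} (B : ℝ) (o : Option (S × A)) :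
    low B u o ^ 2 ≤ u o ^ 2 := by
  unfold low; split_ifs
  · exact le_rfl
  · simpa using sq_nonneg (u o)

theorem high_le_sq {u : Option (S × A) → ℝ} {B : ℝ} (hB : 0 < B) (o : Option (S × A)) :
    high B u o ≤ (2 * B)⁻¹ * u o ^ 2 := by
  unfold high; split_ifs with h
  · positivity
  · rw [inv_mul_eq_div, le_div_iff₀ (by positivity)]
    push Not at h
    nlinarith

theorem mem_stable {dhat mu : S × A → ℝ} {p B : ℝ} {j : ℕ} {x : S × A} :
    x ∈ stable dhat mu p B j ↔ dhat x ≠ 0 ∧ dhat x ≤ B * mu x ∧ 2 * p / j ≤ mu x := by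
  simp [stable]

/-- AM-GM in place of Cauchy-Schwarz: summed over at most s coordinates it gives τ + s/(4τ) times
the sum of squares, without square roots. -/
theorem le_add_mul_sq {τ s v : ℝ} (hτ : 0 < τ) (hs : 0 < s) : v ≤ τ / s + s / (4 * τ) * v ^ 2 := by
  have : τ / s + s / (4 * τ) * v ^ 2 - v = (s / (4 * τ)) * (v - 2 * τ / s) ^ 2 := by
    field_simp; ring
  have h : 0 ≤ (s / (4 * τ)) * (v - 2 * τ / s) ^ 2 := by positivity
  linarith

namespace Stage

variable {q : PMF (Sample S A)} {dhat mu : S × A → ℝ} {u : Option (S × A) → ℝ} {ρ s : ℝ}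
  (hS : Stage q dhat mu u ρ s)

include hS

theorem expect_hit_ge {x : S × A} (hx : dhat x ≠ 0) : 4 / 5 ≤ expect q (hit mu x) := by
  rw [expect_hit, inv_mul_eq_div, le_div_iff₀ (hS.mu_pos x hx)]
  exact hS.le_hit x hx

theorem cap_nonneg (x : S × A) : 0 ≤ 2 * dhat x := by
  have := hS.dhat_nonneg x; positivity

theorem target_mem (pol : S → PMF A) (v : Option (S × A) → ℝ) (x : S × A) :
    target q dhat mu pol v x ∈ Set.Icc 0 (2 * dhat x) :=
  clip_mem (hS.cap_nonneg x) _

theorem sq_mul_expect_hit_sq_le (x : S × A) :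
    (2 * dhat x) ^ 2 * expect q (fun z => hit mu x z ^ 2) ≤ 5 * (dhat x ^ 2 / mu x) := by
  by_cases hx : dhat x = 0
  · simp [hx]
  · have hm := hS.mu_pos x hx
    rw [expect_hit_sq]
    have h := mul_le_mul_of_nonneg_left (hS.hit_le x hx)
      (show 0 ≤ (2 * dhat x) ^ 2 * (mu x)⁻¹ ^ 2 by positivity)
    calc (2 * dhat x) ^ 2 * ((mu x)⁻¹ ^ 2 * prob q {z | z.1 = some x})
        = (2 * dhat x) ^ 2 * (mu x)⁻¹ ^ 2 * prob q {z | z.1 = some x} := by ring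
      _ ≤ _ := h
      _ = 5 * (dhat x ^ 2 / mu x) := by field_simp; ring

theorem expect_low_sq_le (B : ℝ) : expect q (fun z => low B u z.2.1 ^ 2) ≤ 5 * ρ :=
  (expect_mono fun _ => low_sq_le B _).trans hS.u_sq_le

theorem expect_high_le {B : ℝ} (hB : 0 < B) :
    expect q (fun z => high B u z.2.1) ≤ 5 * ρ / (2 * B) := by
  refine (expect_mono fun z => high_le_sq hB _).trans ?_
  rw [expect_mul_left, inv_mul_eq_div]
  gcongr
  exact hS.u_sq_le

theorem sq_div_nonneg (x : S × A) : 0 ≤ dhat x ^ 2 / mu x := by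
  by_cases hx : dhat x = 0
  · simp [hx]
  · exact div_nonneg (sq_nonneg _) (hS.mu_pos x hx).le

theorem sum_subset_le (I : Finset (S × A)) : ∑ x ∈ I, dhat x ^ 2 / mu x ≤ ρ :=
  (Finset.sum_le_sum_of_subset_of_nonneg (Finset.subset_univ I)
    fun x _ _ => hS.sq_div_nonneg x).trans hS.sum_sq_le

theorem card_stable_le (p B : ℝ) (j : ℕ) : ((stable dhat mu p B j).card : ℝ) ≤ s := by
  refine le_trans ?_ hS.card_le
  exact_mod_cast Finset.card_le_card fun x hx => by
    simpa using (mem_stable.1 hx).1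

/-- The window has at most j active steps of size at most 2p/j, so the squared errors, summed over
the stable coordinates, are of order p²ρ/j; AM-GM passes to ℓ¹ and produces the factor s. -/
theorem expect_dev_le (pol : S → PMF A) {p B τ : ℝ} (hp : 0 ≤ p) (hτ : 0 < τ)
    {j N : ℕ} (hj : 0 < j) (hjN : j ≤ N) :
    expect (indep fun _ : Fin N => q) (dev q dhat mu pol u p B j)
      ≤ τ + 20 * s * p ^ 2 * ρ / τ / j := by
  have hj' : (0 : ℝ) < j := by exact_mod_cast hj
  have hs := hS.s_pos
  set G := stable dhat mu p B j with hG
  set θ := target q dhat mu pol (low B u) with hθ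
  set D : S × A → (Fin N → Sample S A) → ℝ := fun x data =>
    chain (2 * dhat x) (steps p (j / 2)) (seqOf (hit mu x) data)
      (seqOf (push pol (low B u) x) data) (θ x) j - θ x with hD
  have h1 : ∀ x ∈ G, expect (indep fun _ : Fin N => q) (fun data => D x data ^ 2)
      ≤ 4 * p ^ 2 / j * (10 * (dhat x ^ 2 / mu x)
        + 2 * expect q fun z => push pol (low B u) x z ^ 2) := by
    intro x hx
    have hx0 := (mem_stable.1 hx).1
    refine (expect_chain_sq_le q (hS.target_mem pol _ x) (steps p (j / 2)) (steps_nonneg hp _)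
      (hit mu x) (push pol (low B u) x) (fun v hv => clip_div_optimal
        (by linarith [hS.expect_hit_ge hx0]) hv)
      (σ := 10 * (dhat x ^ 2 / mu x) + 2 * expect q fun z => push pol (low B u) x z ^ 2)
      (fun v hv => ?_) hjN).trans ?_
    · have h2 : ∀ z, (hit mu x z * v - push pol (low B u) x z) ^ 2
          ≤ 2 * (2 * dhat x) ^ 2 * hit mu x z ^ 2 + 2 * push pol (low B u) x z ^ 2 := by
        intro z
        have hv2 : v ^ 2 ≤ (2 * dhat x) ^ 2 := pow_le_pow_left₀ hv.1 hv.2 2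
        nlinarith [sq_nonneg (hit mu x z * v + push pol (low B u) x z),
          mul_le_mul_of_nonneg_left hv2 (sq_nonneg (hit mu x z))]
      refine (expect_mono h2).trans ?_
      rw [expect_add, expect_mul_left, expect_mul_left]
      linarith [hS.sq_mul_expect_hit_sq_le x]
    · rw [← Finset.sum_mul]
      refine mul_le_mul_of_nonneg_right ?_ ?_
      · calc ∑ l ∈ Finset.range j, steps p (j / 2) (l + 1) ^ 2
            ≤ ∑ l ∈ Finset.range j, (2 * p / j) ^ 2 := Finset.sum_le_sum fun l _ =>
              pow_le_pow_left₀ (steps_nonneg hp _ _) (steps_le hp hj _) 2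
          _ = 4 * p ^ 2 / j := by
              rw [Finset.sum_const, Finset.card_range, nsmul_eq_mul]
              field_simp; ring
      · have := hS.sq_div_nonneg x
        have : 0 ≤ expect q fun z => push pol (low B u) x z ^ 2 :=
          expect_nonneg fun z => sq_nonneg _
        positivity
  have h3 : ∑ x ∈ G, expect q (fun z => push pol (low B u) x z ^ 2) ≤ 5 * ρ := by
    rw [← expect_sum]
    refine le_trans (expect_mono fun z => ?_) (hS.expect_low_sq_le B)
    refine le_trans ?_ (sum_push_sq_le pol (low_nonneg hS.u_nonneg B) z)
    exact Finset.sum_le_sum_of_subset_of_nonneg (Finset.subset_univ G) fun x _ _ => sq_nonneg _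
  have h4 : ∀ data, dev q dhat mu pol u p B j data
      ≤ τ + s / (4 * τ) * ∑ x ∈ G, D x data ^ 2 := by
    intro data
    calc dev q dhat mu pol u p B j data = ∑ x ∈ G, |D x data| := rfl
      _ ≤ ∑ x ∈ G, (τ / s + s / (4 * τ) * D x data ^ 2) := by
          refine Finset.sum_le_sum fun x _ => ?_
          have := le_add_mul_sq (v := |D x data|) hτ hs
          rwa [sq_abs] at this
      _ = G.card * (τ / s) + s / (4 * τ) * ∑ x ∈ G, D x data ^ 2 := by
          rw [Finset.sum_add_distrib, Finset.sum_const, nsmul_eq_mul, Finset.mul_sum]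
      _ ≤ _ := by
          refine add_le_add ?_ le_rfl
          calc (G.card : ℝ) * (τ / s) ≤ s * (τ / s) := by
                gcongr; exact hS.card_stable_le p B j
            _ = τ := by field_simp
  refine (expect_mono h4).trans ?_
  rw [expect_add, expect_const, expect_mul_left, expect_sum]
  have h5 : ∑ x ∈ G, expect (indep fun _ : Fin N => q) (fun data => D x data ^ 2)
      ≤ 4 * p ^ 2 / j * (20 * ρ) := by
    refine (Finset.sum_le_sum h1).trans ?_
    rw [← Finset.mul_sum, Finset.sum_add_distrib, ← Finset.mul_sum, ← Finset.mul_sum]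
    gcongr
    linarith [hS.sum_subset_le G]
  calc τ + s / (4 * τ) * ∑ x ∈ G, expect (indep fun _ : Fin N => q) (fun data => D x data ^ 2)
      ≤ τ + s / (4 * τ) * (4 * p ^ 2 / j * (20 * ρ)) := by gcongr
    _ = τ + 20 * s * p ^ 2 * ρ / τ / j := by field_simp

/-- A new draw i changes gradient i only, and at stable coordinates every later step is nonexpansive
because step size times curvature is at most 1. The bound keeps its dependence on the draws since
their second moment, of order ρ, is what the Bernstein inequality needs. -/
theorem abs_dev_update_le (pol : S → PMF A) {p B : ℝ} (hp : 0 < p) {j N : ℕ}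
    (hj : 0 < j) (data : Fin N → Sample S A) (i : Fin N) (z : Sample S A) :
    |dev q dhat mu pol u p B j (Function.update data i z) - dev q dhat mu pol u p B j data|
      ≤ (if (i : ℕ) < j then 2 * p / j else 0)
          * (∑ x ∈ stable dhat mu p B j, hit mu x (data i) * (2 * dhat x)
            + low B u (data i).2.1)
        + (if (i : ℕ) < j then 2 * p / j else 0)
          * (∑ x ∈ stable dhat mu p B j, hit mu x z * (2 * dhat x) + low B u z.2.1) := by
  have hj' : (0 : ℝ) < j := by exact_mod_cast hj
  set G := stable dhat mu p B j with hG
  set η : ℕ → ℝ := steps p (j / 2)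
  set c : ℝ := if (i : ℕ) < j then 2 * p / j else 0 with hc
  have hc0 : 0 ≤ c := by rw [hc]; split_ifs <;> positivity
  have hmu : ∀ x ∈ G, 0 < mu x := fun x hx => hS.mu_pos x (mem_stable.1 hx).1
  have hpush : ∀ x z, 0 ≤ push pol (low B u) x z := push_nonneg pol (low_nonneg hS.u_nonneg B)
  have h1 : ∀ x ∈ G,
      |chain (2 * dhat x) η (seqOf (hit mu x) (Function.update data i z))
          (seqOf (push pol (low B u) x) (Function.update data i z))
          (target q dhat mu pol (low B u) x) j
        - chain (2 * dhat x) η (seqOf (hit mu x) data)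
          (seqOf (push pol (low B u) x) data) (target q dhat mu pol (low B u) x) j|
      ≤ c * ((hit mu x (data i) * (2 * dhat x) + push pol (low B u) x (data i))
        + (hit mu x z * (2 * dhat x) + push pol (low B u) x z)) := by
    intro x hx
    have hm := hmu x hx
    have hd := hS.cap_nonneg x
    have h0 : ∀ l, 0 ≤ seqOf (hit mu x) data l := seqOf_nonneg (hit_nonneg hm.le) data
    refine (abs_chain_sub_le hd (hS.target_mem pol _ x) (steps_nonneg hp.le _)
      (fun l => mul_nonneg (steps_nonneg hp.le _ _) (h0 l)) (fun l => ?_) j).trans ?_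
    · calc steps p (j / 2) (l + 1) * seqOf (hit mu x) data l ≤ mu x * (mu x)⁻¹ :=
            mul_le_mul ((steps_le hp.le hj _).trans (mem_stable.1 hx).2.2)
              (seqOf_le (inv_nonneg.2 hm.le) (Caesar.hit_le hm.le) data l) (h0 l) hm.le
        _ = 1 := mul_inv_cancel₀ hm.ne'
    · have hz : ∀ l ∈ Finset.range j, l ≠ i → η (l + 1)
          * (|seqOf (hit mu x) (Function.update data i z) l - seqOf (hit mu x) data l|
            * (2 * dhat x) + |seqOf (push pol (low B u) x) (Function.update data i z) l
              - seqOf (push pol (low B u) x) data l|) = 0 := by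
        intro l _ hl
        rw [seqOf_update_of_ne _ _ _ _ hl, seqOf_update_of_ne _ _ _ _ hl]
        simp
      have hA := hit_nonneg (S := S) (A := A) hm.le
      by_cases hij : (i : ℕ) < j
      · rw [Finset.sum_eq_single (i : ℕ) hz (fun h => absurd (Finset.mem_range.2 hij) h),
          seqOf_update_self, seqOf_update_self]
        have e : ∀ f : Sample S A → ℝ, seqOf f data i = f (data i) := fun f => by simp [seqOf]
        rw [e, e]
        refine mul_le_mul (by rw [hc, if_pos hij]; exact steps_le hp.le hj _) ?_ (by positivity) hc0
        have a1 : |hit mu x z - hit mu x (data i)| ≤ hit mu x (data i) + hit mu x z := by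
          rw [abs_le]; constructor <;> linarith [hA z, hA (data i)]
        have a2 : |push pol (low B u) x z - push pol (low B u) x (data i)|
            ≤ push pol (low B u) x (data i) + push pol (low B u) x z := by
          rw [abs_le]; constructor <;> linarith [hpush x z, hpush x (data i)]
        nlinarith [mul_le_mul_of_nonneg_right a1 hd]
      · rw [Finset.sum_eq_zero fun l hl => hz l hl (by rw [Finset.mem_range] at hl; omega)]
        have := hA z; have := hA (data i); have := hpush x z; have := hpush x (data i)
        positivity
  have h2 : ∀ z, ∑ x ∈ G, push pol (low B u) x z ≤ low B u z.2.1 := by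
    intro z
    rw [← sum_push pol (low B u) z]
    exact Finset.sum_le_sum_of_subset_of_nonneg (Finset.subset_univ G) fun x _ _ => hpush x z
  unfold dev
  rw [← Finset.sum_sub_distrib]
  refine (Finset.abs_sum_le_sum_abs _ _).trans ((Finset.sum_le_sum (g := fun x =>
    c * ((hit mu x (data i) * (2 * dhat x) + push pol (low B u) x (data i))
      + (hit mu x z * (2 * dhat x) + push pol (low B u) x z))) fun x hx => ?_).trans ?_)
  · refine (abs_abs_sub_abs_le _ _).trans ?_
    rw [sub_sub_sub_cancel_right]
    exact h1 x hx
  · rw [← Finset.mul_sum, ← mul_add]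
    refine mul_le_mul_of_nonneg_left ?_ hc0
    rw [Finset.sum_add_distrib, Finset.sum_add_distrib, Finset.sum_add_distrib]
    linarith [h2 z, h2 (data i)]

/-- Increments are at most 8pB/j, so r = j/(16pB) is the largest exponent this bound admits. It lets
T enter only through 16pBT/j, without the factor s. -/
theorem prob_dev_ge_le (pol : S → PMF A) {p B τ : ℝ} (hp : 0 < p) (hB : 0 < B) (hτ : 0 < τ)
    {j N : ℕ} (hj : 0 < j) (hjN : j ≤ N) (T : ℝ) :
    prob (indep fun _ : Fin N => q) {data | τ + 20 * p * ρ / B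
        + (20 * s * p ^ 2 * ρ / τ + 16 * p * B * T) / j ≤ dev q dhat mu pol u p B j data}
      ≤ Real.exp (-T) := by
  have hj' : (0 : ℝ) < j := by exact_mod_cast hj
  set G := stable dhat mu p B j with hG
  set c : Fin N → ℝ := fun i => if (i : ℕ) < j then 2 * p / j else 0 with hc
  have hc0 : ∀ i, 0 ≤ c i := fun i => by simp only [hc]; split_ifs <;> positivity
  set g : Sample S A → ℝ := fun z => ∑ x ∈ G, hit mu x z * (2 * dhat x) + low B u z.2.1 with hg
  have hg0 : ∀ z, 0 ≤ g z := fun z => add_nonneg (Finset.sum_nonneg fun x hx => mul_nonneg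
    (hit_nonneg (hS.mu_pos x (mem_stable.1 hx).1).le z) (hS.cap_nonneg x))
    (low_nonneg hS.u_nonneg B _)
  have hg1 : ∀ z, g z ≤ 4 * B := by
    intro z
    have h1 : ∑ x ∈ G, hit mu x z * (2 * dhat x) ≤ 2 * B := by
      refine sum_hit_mul_le (by positivity) (fun x hx => ?_) z
      obtain ⟨hx0, hx1, -⟩ := mem_stable.1 hx
      rw [inv_mul_eq_div, div_le_iff₀ (hS.mu_pos x hx0)]
      linarith
    have h2 := low_le (u := u) hB.le z.2.1
    simp only [hg]; linarith
  have hr : (0 : ℝ) < j / (16 * p * B) := by positivity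
  have hc1 : ∀ i, c i ≤ 2 * p / j := fun i => by
    simp only [hc]; split_ifs
    · exact le_rfl
    · positivity
  have hgE : expect q (fun z => g z ^ 2) ≤ 20 * ρ := by
    have h1 : ∀ z, g z ^ 2 ≤ 2 * (∑ x ∈ G, hit mu x z ^ 2 * (2 * dhat x) ^ 2)
        + 2 * low B u z.2.1 ^ 2 := by
      intro z
      rw [← sum_hit_mul_sq]
      simp only [hg]
      nlinarith [sq_nonneg (∑ x ∈ G, hit mu x z * (2 * dhat x) - low B u z.2.1)]
    refine (expect_mono h1).trans ?_
    rw [expect_add, expect_mul_left, expect_mul_left, expect_sum]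
    have h2 : ∑ x ∈ G, expect q (fun z => hit mu x z ^ 2 * (2 * dhat x) ^ 2) ≤ 5 * ρ := by
      calc ∑ x ∈ G, expect q (fun z => hit mu x z ^ 2 * (2 * dhat x) ^ 2)
          ≤ ∑ x ∈ G, 5 * (dhat x ^ 2 / mu x) := by
            refine Finset.sum_le_sum fun x _ => ?_
            rw [expect_mul_right, mul_comm]
            exact hS.sq_mul_expect_hit_sq_le x
        _ ≤ 5 * ρ := by
            rw [← Finset.mul_sum]
            linarith [hS.sum_subset_le G]
    linarith [hS.expect_low_sq_le B]
  have key := prob_indep_tail_le (fun _ : Fin N => q) (γ := fun i z => c i * g z)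
    (r := j / (16 * p * B)) (V := 320 * p ^ 2 * ρ / j) hr
    (fun i z => mul_nonneg (hc0 i) (hg0 z)) (fun i z => ?_) (dev q dhat mu pol u p B j)
    (fun data i z => hS.abs_dev_update_le pol hp hj data i z) ?_ T
  · refine le_trans (prob_mono fun data hdata => ?_) key
    have h1 := hS.expect_dev_le pol (B := B) hp.le hτ hj hjN
    simp only [Set.mem_ofPred_eq] at hdata ⊢
    refine le_trans ?_ hdata
    have e1 : j / (16 * p * B) * (320 * p ^ 2 * ρ / j) = 20 * p * ρ / B := by
      field_simp; ring
    have e2 : T / (j / (16 * p * B)) = 16 * p * B * T / j := by field_simp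
    rw [e1, e2, add_div]
    linarith
  · calc j / (16 * p * B) * (c i * g z) ≤ j / (16 * p * B) * (2 * p / j * (4 * B)) := by
          have := hg0 z; have := hg1 z; have := hc1 i; have := hc0 i
          gcongr
      _ = 1 / 2 := by field_simp; norm_num
  · have h1 : ∀ i : Fin N, 4 * expect q (fun z => (c i * g z) ^ 2)
        ≤ if (i : ℕ) < j then 4 * ((2 * p / j) ^ 2 * (20 * ρ)) else 0 := by
      intro i
      simp only [mul_pow, expect_mul_left, hc]
      split_ifs
      · gcongr
      · simp
    refine (Finset.sum_le_sum fun i _ => h1 i).trans ?_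
    rw [← Finset.sum_filter, Finset.sum_const, nsmul_eq_mul]
    have h2 : (Finset.univ.filter fun i : Fin N => (i : ℕ) < j).card = j := by
      have := card_window (N := N) (j₀ := 0) hjN
      simpa [window] using this
    rw [h2]
    refine le_of_eq ?_
    field_simp; ring

end Stage

end Stage

/-! ### Truncation, unstable coordinates and the ℓ¹ error of one iterate -/

section Stage

variable {S A : Type*} [Fintype S] [Fintype A] [DecidableEq S] [DecidableEq A]

theorem push_eq_low_add_high (pol : S → PMF A) (u : Option (S × A) → ℝ) (B : ℝ) (x : S × A)
    (z : Sample S A) : push pol u x z = push pol (low B u) x z + push pol (high B u) x z := by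
  unfold push
  split_ifs
  · rw [← add_mul, low_add_high]
  · simp

/-- Rewriting weighted sums through counts lets a single event on the counts serve all weights. -/
theorem sum_mul_hits {Z Y : Type*} [Fintype Z] [Fintype Y] {N : ℕ} (W : Finset (Fin N))
    (φ : Z → Y) (g : Y → ℝ) (data : Fin N → Z) :
    ∑ i ∈ W, g (φ (data i)) = ∑ y, g y * hits W {z | φ z = y} data := by
  classical
  simp only [hits, Finset.mul_sum]
  rw [Finset.sum_comm]
  refine Finset.sum_congr rfl fun i _ => ?_
  rw [Finset.sum_eq_single (φ (data i))]
  · simp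
  · intro y _ hy
    simp [Set.indicator, hy.symm]
  · simp

theorem expect_comp {Z Y : Type*} [Fintype Z] [Fintype Y] (q : PMF Z) (φ : Z → Y) (g : Y → ℝ) :
    expect q (fun z => g (φ z)) = ∑ y, g y * prob q {z | φ z = y} := by
  classical
  simp only [prob, ← expect_mul_left]
  rw [← expect_sum]
  congr 1; funext z
  rw [Finset.sum_eq_single (φ z)]
  · simp
  · intro y _ hy
    simp [Set.indicator, hy.symm]
  · simp

namespace Stage

variable {q : PMF (Sample S A)} {dhat mu : S × A → ℝ} {u : Option (S × A) → ℝ} {ρ s : ℝ}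
  (hS : Stage q dhat mu u ρ s)

include hS

theorem abs_target_low_sub_le (pol : S → PMF A) (B : ℝ) {x : S × A} (hx : dhat x ≠ 0) :
    |target q dhat mu pol (low B u) x - target q dhat mu pol u x|
      ≤ 5 / 4 * expect q (push pol (high B u) x) := by
  have hk := hS.expect_hit_ge hx
  have h0 : 0 ≤ expect q (push pol (high B u) x) :=
    expect_nonneg (push_nonneg pol (high_nonneg hS.u_nonneg B) x)
  have e : expect q (push pol u x)
      = expect q (push pol (low B u) x) + expect q (push pol (high B u) x) := by
    rw [← expect_add]
    congr 1; funext z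
    exact push_eq_low_add_high pol u B x z
  unfold target
  refine (abs_clip_sub_clip_le _ _ _).trans ?_
  rw [e, ← sub_div, sub_add_cancel_left, abs_div, abs_neg, abs_of_nonneg h0,
    abs_of_pos (by linarith), div_le_iff₀ (by linarith)]
  nlinarith

/-- The bound for the pairs outside the stable set. -/
theorem two_mul_dhat_le {p B τ : ℝ} (hp : 0 < p) (hB : 0 < B) (hτ : 0 < τ) {j : ℕ} (hj : 0 < j)
    {x : S × A} (hx : x ∉ stable dhat mu p B j) :
    2 * dhat x ≤ (if dhat x ≠ 0 then 2 * τ / s else 0)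
      + (s * p / τ / j + 2 / B) * (dhat x ^ 2 / mu x) := by
  have hj' : (0 : ℝ) < j := by exact_mod_cast hj
  have hs := hS.s_pos
  by_cases hx0 : dhat x = 0
  · simp [hx0]
  have hd : 0 < dhat x := lt_of_le_of_ne (hS.dhat_nonneg x) (Ne.symm hx0)
  have hm := hS.mu_pos x hx0
  rw [if_pos hx0]
  have h1 : 0 ≤ 2 * τ / s := by positivity
  -- A coordinate is unstable because μ < 2p/j, where dhat² is at most 2p/j times its share of the
  -- ratio and AM-GM applies, or because dhat > B·μ, where dhat itself is at most 1/B times this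
  -- share.
  by_cases hbad : dhat x ≤ B * mu x
  · have hact : mu x < 2 * p / j := by
      by_contra hcon
      exact hx (mem_stable.2 ⟨hx0, hbad, not_lt.1 hcon⟩)
    have h2 := le_add_mul_sq (v := dhat x) hτ hs
    have h3 : s / (4 * τ) * dhat x ^ 2 ≤ s / (4 * τ) * (2 * p / j * (dhat x ^ 2 / mu x)) := by
      refine mul_le_mul_of_nonneg_left ?_ (by positivity)
      calc dhat x ^ 2 = mu x * (dhat x ^ 2 / mu x) := by field_simp
        _ ≤ 2 * p / j * (dhat x ^ 2 / mu x) := by gcongr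
    have h4 : 2 * (s / (4 * τ) * (2 * p / j * (dhat x ^ 2 / mu x)))
        = s * p / τ / j * (dhat x ^ 2 / mu x) := by field_simp; ring
    have h5 : 0 ≤ 2 / B * (dhat x ^ 2 / mu x) := by positivity
    have h6 : 2 * τ / s = 2 * (τ / s) := by ring
    rw [add_mul]
    linarith
  · push Not at hbad
    have h2 : 2 * dhat x ≤ 2 / B * (dhat x ^ 2 / mu x) := by
      rw [div_mul_div_comm, le_div_iff₀ (by positivity)]
      nlinarith
    have h5 : 0 ≤ s * p / τ / j * (dhat x ^ 2 / mu x) := by positivity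
    rw [add_mul]
    linarith

/-- The curvature collected in a window by a stable coordinate. -/
theorem sum_window_hit_ge {p B t : ℝ} (hp : 0 < p) (hpt : 80 * t ≤ p) {η : ℕ → ℝ}
    (hη : ∀ i : ℕ, η (i + 1) = p / ((i + 1 : ℕ) : ℝ)) {j N : ℕ} (hj : 0 < j) (hjN : j ≤ N)
    {x : S × A} (hx : x ∈ stable dhat mu p B j) {data : Fin N → Sample S A}
    (hE : (window N (j / 2) j).card * prob q {z | z.1 = some x} / 2 - 8 * t
      ≤ hits (window N (j / 2) j) {z | z.1 = some x} data) :
    p / 10 ≤ ∑ l ∈ Finset.Ico (j / 2) j, η (l + 1) * seqOf (hit mu x) data l := by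
  have hj' : (0 : ℝ) < j := by exact_mod_cast hj
  obtain ⟨hx0, -, hact⟩ := mem_stable.1 hx
  have hm := hS.mu_pos x hx0
  have h1 : ∑ l ∈ Finset.Ico (j / 2) j, p / j * seqOf (hit mu x) data l
      ≤ ∑ l ∈ Finset.Ico (j / 2) j, η (l + 1) * seqOf (hit mu x) data l := by
    refine Finset.sum_le_sum fun l hl => mul_le_mul_of_nonneg_right ?_
      (seqOf_nonneg (hit_nonneg hm.le) data l)
    rw [hη]
    have : ((l + 1 : ℕ) : ℝ) ≤ j := by exact_mod_cast (Finset.mem_Ico.1 hl).2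
    gcongr
  refine le_trans ?_ h1
  rw [← Finset.mul_sum, sum_Ico_seqOf hjN]
  have h2 : ∑ i ∈ window N (j / 2) j, hit mu x (data i)
      = (mu x)⁻¹ * hits (window N (j / 2) j) {z | z.1 = some x} data := by
    rw [hits, Finset.mul_sum]
    refine Finset.sum_congr rfl fun i _ => ?_
    simp [hit, Set.indicator]
  have hW : (j : ℝ) / 2 ≤ (window N (j / 2) j).card := by
    rw [card_window hjN, div_le_iff₀ two_pos]
    exact_mod_cast (by omega : j ≤ (j - j / 2) * 2)
  have h3 : (j : ℝ) / 2 * (4 / 5 * mu x)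
      ≤ (window N (j / 2) j).card * prob q {z | z.1 = some x} :=
    mul_le_mul hW (hS.le_hit x hx0) (by positivity) (by positivity)
  have h4 : 2 * p ≤ mu x * j := (div_le_iff₀ hj').1 hact
  -- The window has at least j/2 draws, so half the expected count is at least jμ/5, while 8t ≤ p/10
  -- ≤ jμ/20.
  have h5 : (j : ℝ) * mu x / 10 ≤ hits (window N (j / 2) j) {z | z.1 = some x} data := by
    linarith
  rw [h2]
  calc p / 10 = p / j * ((mu x)⁻¹ * (j * mu x / 10)) := by field_simp
    _ ≤ _ := by gcongr

/-- The error of one iterate, on the event that all counts and the deviation are typical. -/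
theorem sum_abs_sgd_sub_target_le (pol : S → PMF A) {p B τ t T U : ℝ} (hp : 1 ≤ p)
    (hB : 0 < B) (hτ : 0 < τ) (ht : 0 ≤ t) (hpt : 80 * t ≤ p) {η : ℕ → ℝ} (hη0 : ∀ i, 0 ≤ η i)
    (hη : ∀ i : ℕ, η (i + 1) = p / ((i + 1 : ℕ) : ℝ)) {j N : ℕ} (hj : 0 < j) (hjN : j ≤ N)
    (hU : ∑ o, high B u o ≤ U) {data : Fin N → Sample S A}
    (h₁ : ∀ x, (window N (j / 2) j).card * prob q {z | z.1 = some x} / 2 - 8 * t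
      ≤ hits (window N (j / 2) j) {z | z.1 = some x} data)
    (h₂ : ∀ o, hits (window N (j / 2) j) {z | z.2.1 = o} data
      ≤ 3 / 2 * ((window N (j / 2) j).card * prob q {z | z.2.1 = o}) + 8 * t)
    (h₃ : dev q dhat mu pol u p B j data
      ≤ τ + 20 * p * ρ / B + (20 * s * p ^ 2 * ρ / τ + 16 * p * B * T) / j) :
    ∑ x, |sgd dhat η pol mu u data j x - target q dhat mu pol u x|
      ≤ (3 * τ + 2 * Real.exp (-(p / 10)) + 33 * p * ρ / B)
        + (21 * s * p ^ 2 * ρ / τ + 16 * p * t * U + 16 * p * B * T) / j := by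
  have hp0 : 0 < p := by linarith
  have hρ := hS.ρ_pos
  have hs := hS.s_pos
  have hj' : (0 : ℝ) < j := by exact_mod_cast hj
  have hjlt : j / 2 < j := Nat.div_lt_self hj one_lt_two
  set G := stable dhat mu p B j with hG
  set J := Finset.Ico (j / 2) j with hJ
  have hhigh := high_nonneg hS.u_nonneg B
  have hsteps : ∀ l, j / 2 ≤ l → steps p (j / 2) (l + 1) = η (l + 1) := by
    intro l hl
    rw [steps, if_pos (by omega), hη]
  set ph : S × A → ℕ → ℝ := fun x => seqOf (push pol (high B u) x) data with hph
  have hph0 : ∀ x l, 0 ≤ ph x l := fun x l => seqOf_nonneg (push_nonneg pol hhigh x) data l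
  have hph' : ∀ x l, |seqOf (push pol u x) data l - seqOf (push pol (low B u) x) data l|
      = ph x l := by
    intro x l
    have : seqOf (push pol u x) data l - seqOf (push pol (low B u) x) data l = ph x l := by
      simp only [hph, seqOf]
      split_ifs
      · rw [push_eq_low_add_high pol u B]; ring
      · simp
    rw [this, abs_of_nonneg (hph0 x l)]
  -- Besides the deviation there are three errors: `b₁` for unstable coordinates, `b₂` for the
  -- coupling with the auxiliary run (forgotten start and large gradients), `b₃` for the shift of
  -- the minimizer caused by truncation.
  set b₁ : S × A → ℝ := fun x => (if dhat x ≠ 0 then 2 * τ / s else 0)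
      + (s * p / τ / j + 2 / B) * (dhat x ^ 2 / mu x) with hb₁
  set b₂ : S × A → ℝ := fun x => 2 * dhat x * Real.exp (-(p / 10))
      + ∑ l ∈ J, η (l + 1) * ph x l with hb₂
  set b₃ : S × A → ℝ := fun x => 5 / 4 * expect q (push pol (high B u) x) with hb₃
  have hb₁0 : ∀ x, 0 ≤ b₁ x := by
    intro x
    have := hS.sq_div_nonneg x
    simp only [hb₁]
    split_ifs <;> positivity
  have hb₂0 : ∀ x, 0 ≤ b₂ x := by
    intro x
    have := hS.cap_nonneg x
    have : 0 ≤ ∑ l ∈ J, η (l + 1) * ph x l :=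
      Finset.sum_nonneg fun l _ => mul_nonneg (hη0 _) (hph0 x l)
    simp only [hb₂]
    positivity
  have hb₃0 : ∀ x, 0 ≤ b₃ x := fun x =>
    mul_nonneg (by norm_num) (expect_nonneg (push_nonneg pol hhigh x))
  set D : S × A → ℝ := fun x =>
    |chain (2 * dhat x) (steps p (j / 2)) (seqOf (hit mu x) data)
        (seqOf (push pol (low B u) x) data) (target q dhat mu pol (low B u) x) j
      - target q dhat mu pol (low B u) x| with hD
  have hpoint : ∀ x, |sgd dhat η pol mu u data j x - target q dhat mu pol u x|
      ≤ (if x ∈ G then D x else 0) + (b₁ x + (b₂ x + b₃ x)) := by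
    intro x
    have hcap := hS.cap_nonneg x
    rw [sgd_eq_chain hS.dhat_nonneg]
    split_ifs with hx
    · obtain ⟨hx0, -, hact⟩ := mem_stable.1 hx
      have hm := hS.mu_pos x hx0
      have hh0 : ∀ l, 0 ≤ seqOf (hit mu x) data l := seqOf_nonneg (hit_nonneg hm.le) data
      have k₁ := abs_chain_sub_chain_le hcap (η := η) (η' := steps p (j / 2))
        (a := seqOf (hit mu x) data) (b := seqOf (push pol u x) data)
        (b' := seqOf (push pol (low B u) x) data) ⟨le_rfl, hcap⟩ (hS.target_mem pol (low B u) x)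
        hjlt.le hη0 hsteps (fun l => mul_nonneg (hη0 _) (hh0 l)) fun l hl => by
          rw [← hsteps l hl]
          calc steps p (j / 2) (l + 1) * seqOf (hit mu x) data l ≤ mu x * (mu x)⁻¹ :=
                mul_le_mul ((steps_le hp0.le hj _).trans hact)
                  (seqOf_le (inv_nonneg.2 hm.le) (Caesar.hit_le hm.le) data l) (hh0 l) hm.le
            _ = 1 := mul_inv_cancel₀ hm.ne'
      have k₂ := hS.sum_window_hit_ge hp0 hpt hη hj hjN hx (h₁ x)
      have k₃ := hS.abs_target_low_sub_le pol B hx0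
      have k₄ : 2 * dhat x * Real.exp (-∑ l ∈ J, η (l + 1) * seqOf (hit mu x) data l)
          ≤ 2 * dhat x * Real.exp (-(p / 10)) := by gcongr
      simp only [hph'] at k₁
      have k₅ := abs_sub_le
        (chain (2 * dhat x) η (seqOf (hit mu x) data) (seqOf (push pol u x) data) 0 j)
        (chain (2 * dhat x) (steps p (j / 2)) (seqOf (hit mu x) data)
          (seqOf (push pol (low B u) x) data) (target q dhat mu pol (low B u) x) j)
        (target q dhat mu pol u x)
      have k₆ := abs_sub_le
        (chain (2 * dhat x) (steps p (j / 2)) (seqOf (hit mu x) data)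
          (seqOf (push pol (low B u) x) data) (target q dhat mu pol (low B u) x) j)
        (target q dhat mu pol (low B u) x) (target q dhat mu pol u x)
      have := hb₁0 x
      simp only [hb₂, hb₃, hD]
      linarith
    · have k₁ := hS.two_mul_dhat_le hp0 hB hτ hj hx
      have k₂ := chain_mem hcap η (seqOf (hit mu x) data) (seqOf (push pol u x) data)
        ⟨le_rfl, hcap⟩ j
      have k₃ := hS.target_mem pol u x
      have k₄ : |chain (2 * dhat x) η (seqOf (hit mu x) data) (seqOf (push pol u x) data) 0 j
          - target q dhat mu pol u x| ≤ 2 * dhat x := by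
        rw [abs_le]; constructor <;> linarith [k₂.1, k₂.2, k₃.1, k₃.2]
      have := hb₂0 x
      have := hb₃0 x
      simp only [hb₁]
      linarith
  have hdev : ∑ x, (if x ∈ G then D x else 0) = dev q dhat mu pol u p B j data := by
    rw [Finset.sum_ite_mem, Finset.univ_inter, dev]
  have hsum₁ : ∑ x, b₁ x ≤ 2 * τ + s * p * ρ / τ / j + 2 * ρ / B := by
    simp only [hb₁]
    rw [Finset.sum_add_distrib, ← Finset.mul_sum, ← Finset.sum_filter, Finset.sum_const,
      nsmul_eq_mul]
    have k₁ : ((Finset.univ.filter fun x => dhat x ≠ 0).card : ℝ) * (2 * τ / s) ≤ 2 * τ := by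
      calc _ ≤ s * (2 * τ / s) := by gcongr; exact hS.card_le
        _ = 2 * τ := by field_simp
    have k₂ : (s * p / τ / j + 2 / B) * ∑ x, dhat x ^ 2 / mu x
        ≤ (s * p / τ / j + 2 / B) * ρ := by gcongr; exact hS.sum_sq_le
    have k₃ : (s * p / τ / j + 2 / B) * ρ = s * p * ρ / τ / j + 2 * ρ / B := by ring
    linarith
  have hEhigh := hS.expect_high_le hB
  have hsum₂ : ∑ x, b₂ x ≤ 2 * Real.exp (-(p / 10)) + 15 * p * ρ / (2 * B)
      + 16 * p * t * U / j := by
    simp only [hb₂]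
    rw [Finset.sum_add_distrib, ← Finset.sum_mul, ← Finset.mul_sum, Finset.sum_comm]
    have k₁ : 2 * (∑ x, dhat x) * Real.exp (-(p / 10)) ≤ 2 * Real.exp (-(p / 10)) := by
      have := hS.sum_dhat_le
      have := Real.exp_pos (-(p / 10))
      nlinarith
    have k₂ : ∑ l ∈ J, ∑ x, η (l + 1) * ph x l
        ≤ 2 * p / j * ∑ l ∈ J, seqOf (fun z : Sample S A => high B u z.2.1) data l := by
      rw [Finset.mul_sum]
      refine Finset.sum_le_sum fun l hl => ?_
      have e : ∑ x, ph x l = seqOf (fun z : Sample S A => high B u z.2.1) data l := by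
        simp only [hph, seqOf]
        split_ifs
        · exact sum_push pol _ _
        · simp
      rw [← Finset.mul_sum, e, ← hsteps l (Finset.mem_Ico.1 hl).1]
      exact mul_le_mul_of_nonneg_right (steps_le hp0.le hj _)
        (seqOf_nonneg (fun z => hhigh _) data l)
    have hE0 : 0 ≤ expect q (fun z => high B u z.2.1) := expect_nonneg fun z => hhigh _
    have hW : ((window N (j / 2) j).card : ℝ) ≤ j := by
      rw [card_window hjN]; exact_mod_cast Nat.sub_le _ _
    -- The large values of u are summed through counts: a multiple of the mean plus 8t for each
    -- value, hence a price t·U and no union over policies.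
    have k₃ : ∑ l ∈ J, seqOf (fun z : Sample S A => high B u z.2.1) data l
        ≤ 3 / 2 * j * (5 * ρ / (2 * B)) + 8 * t * U := by
      rw [hJ, sum_Ico_seqOf hjN, sum_mul_hits (window N (j / 2) j)
        (fun z : Sample S A => z.2.1) (high B u) data]
      calc ∑ o, high B u o * hits (window N (j / 2) j) {z | z.2.1 = o} data
          ≤ ∑ o, high B u o * (3 / 2 * ((window N (j / 2) j).card
              * prob q {z : Sample S A | z.2.1 = o}) + 8 * t) :=
            Finset.sum_le_sum fun o _ => mul_le_mul_of_nonneg_left (h₂ o) (hhigh o)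
        _ = 3 / 2 * (window N (j / 2) j).card * expect q (fun z => high B u z.2.1)
              + 8 * t * ∑ o, high B u o := by
            rw [expect_comp q (fun z : Sample S A => z.2.1) (high B u), Finset.mul_sum,
              Finset.mul_sum, ← Finset.sum_add_distrib]
            exact Finset.sum_congr rfl fun o _ => by ring
        _ ≤ _ := by gcongr
    have k₄ : 2 * p / j * (3 / 2 * j * (5 * ρ / (2 * B)) + 8 * t * U)
        = 15 * p * ρ / (2 * B) + 16 * p * t * U / j := by field_simp; ring
    have k₅ : 2 * p / j * ∑ l ∈ J, seqOf (fun z : Sample S A => high B u z.2.1) data l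
        ≤ 2 * p / j * (3 / 2 * j * (5 * ρ / (2 * B)) + 8 * t * U) := by gcongr
    linarith
  have hsum₃ : ∑ x, b₃ x ≤ 5 / 4 * (5 * ρ / (2 * B)) := by
    simp only [hb₃]
    rw [← Finset.mul_sum, ← expect_sum]
    simp only [sum_push]
    gcongr
  refine (Finset.sum_le_sum fun x _ => hpoint x).trans ?_
  have hsplit : ∑ x, (b₁ x + (b₂ x + b₃ x)) = ∑ x, b₁ x + (∑ x, b₂ x + ∑ x, b₃ x) :=
    Finset.sum_add_distrib.trans (congrArg _ Finset.sum_add_distrib)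
  rw [Finset.sum_add_distrib, hdev, hsplit]
  have e₁ : 20 * p * ρ / B = 20 * p * (ρ / B) := by ring
  have e₂ : 15 * p * ρ / (2 * B) = 15 / 2 * p * (ρ / B) := by ring
  have e₃ : 5 / 4 * (5 * ρ / (2 * B)) = 25 / 8 * (ρ / B) := by ring
  have e₄ : 2 * ρ / B = 2 * (ρ / B) := by ring
  have e₅ : 33 * p * ρ / B = 33 * p * (ρ / B) := by ring
  have f₁ : ρ / B ≤ p * (ρ / B) := le_mul_of_one_le_left (by positivity) hp
  have f₂ : s * p * ρ / τ / j ≤ s * p ^ 2 * ρ / τ / j := by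
    gcongr
    nlinarith
  have e₆ : (21 * s * p ^ 2 * ρ / τ + 16 * p * t * U + 16 * p * B * T) / j
      = (20 * s * p ^ 2 * ρ / τ + 16 * p * B * T) / j + s * p ^ 2 * ρ / τ / j
        + 16 * p * t * U / j := by ring
  have f₃ : 0 ≤ ρ / B := by positivity
  rw [e₆]
  rw [e₁] at h₃
  rw [e₂] at hsum₂
  rw [e₃] at hsum₃
  rw [e₄] at hsum₁
  rw [e₅]
  linarith

end Stage

/-! ### The weighted average of the iterates -/

theorem sum_Icc_cast (n : ℕ) : ∑ i ∈ Finset.Icc 1 n, (i : ℝ) = n * (n + 1) / 2 := by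
  induction n with
  | zero => simp
  | succ n ih =>
    rw [Finset.sum_Icc_succ_top (by omega), ih]
    push_cast; ring

/-- The weight i cancels the 1/i in the error of iterate i, so averaging costs a factor 2 and no
logarithm. -/
theorem sum_abs_average_sub_le {n : ℕ} (hn : 0 < n) (w : ℕ → S × A → ℝ) (θ : S × A → ℝ)
    {c κ : ℝ} (hκ : 0 ≤ κ) (h : ∀ j, 0 < j → j ≤ n → ∑ x, |w j x - θ x| ≤ c + κ / j) :
    ∑ x, |average n w x - θ x| ≤ c + 2 * κ / n := by
  have hn' : (0 : ℝ) < n := by exact_mod_cast hn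
  set Z : ℝ := ∑ i ∈ Finset.Icc 1 n, (i : ℝ) with hZ
  have hZe : Z = n * (n + 1) / 2 := sum_Icc_cast n
  have hZ0 : 0 < Z := by rw [hZe]; positivity
  have h1 : ∀ x, |average n w x - θ x| ≤ (∑ i ∈ Finset.Icc 1 n, (i : ℝ) * |w i x - θ x|) / Z := by
    intro x
    have e : average n w x - θ x = (∑ i ∈ Finset.Icc 1 n, (i : ℝ) * (w i x - θ x)) / Z := by
      rw [average, ← hZ]
      simp only [mul_sub]
      rw [Finset.sum_sub_distrib, ← Finset.sum_mul, sub_div, ← hZ, mul_div_cancel_left₀ _ hZ0.ne']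
    rw [e, abs_div, abs_of_pos hZ0]
    gcongr
    refine (Finset.abs_sum_le_sum_abs _ _).trans (le_of_eq ?_)
    exact Finset.sum_congr rfl fun i _ => by rw [abs_mul, abs_of_nonneg (Nat.cast_nonneg _)]
  refine (Finset.sum_le_sum fun x _ => h1 x).trans ?_
  rw [← Finset.sum_div, Finset.sum_comm, div_le_iff₀ hZ0]
  calc ∑ i ∈ Finset.Icc 1 n, ∑ x, (i : ℝ) * |w i x - θ x|
      ≤ ∑ i ∈ Finset.Icc 1 n, ((i : ℝ) * c + κ) := by
        refine Finset.sum_le_sum fun i hi => ?_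
        obtain ⟨hi1, hi2⟩ := Finset.mem_Icc.1 hi
        have hi0 : (0 : ℝ) < i := by exact_mod_cast hi1
        rw [← Finset.mul_sum]
        calc (i : ℝ) * ∑ x, |w i x - θ x| ≤ i * (c + κ / i) := by
              gcongr; exact h i hi1 hi2
          _ = i * c + κ := by field_simp
    _ = Z * c + n * κ := by
        rw [Finset.sum_add_distrib, ← Finset.sum_mul, Finset.sum_const, Nat.card_Icc, nsmul_eq_mul, ← hZ,
          Nat.add_sub_cancel]
    _ ≤ (c + 2 * κ / n) * Z := by
        have e : (c + 2 * κ / n) * Z = Z * c + (n + 1) * κ := by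
          rw [add_mul, hZe]; field_simp
        rw [e]
        nlinarith

end Stage

/-! ### The density estimates along the steps -/

section Flow

variable {S A : Type*} [Fintype S] [Fintype A] [DecidableEq S] [DecidableEq A] {H K : ℕ}

theorem average_mem {n : ℕ} {w : ℕ → S × A → ℝ} {x : S × A} {c : ℝ} (hc : 0 ≤ c)
    (h : ∀ i, w i x ∈ Set.Icc 0 c) : average n w x ∈ Set.Icc 0 c := by
  unfold average
  have h0 : 0 ≤ ∑ i ∈ Finset.Icc 1 n, (i : ℝ) := Finset.sum_nonneg fun i _ => Nat.cast_nonneg i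
  refine ⟨div_nonneg (Finset.sum_nonneg fun i _ => mul_nonneg (Nat.cast_nonneg i) (h i).1) h0,
    div_le_of_le_mul₀ h0 hc ?_⟩
  rw [Finset.mul_sum]
  refine Finset.sum_le_sum fun i _ => ?_
  rw [mul_comm]
  exact mul_le_mul_of_nonneg_right (h i).2 (Nat.cast_nonneg i)

/-- The density ratio of the step before, as it enters the gradients of step `m`. -/
def prevDensity (π : Fin K → Policy S A H) (D : Design S A H K) (θ : Params H) (ε : ℝ)
    (data : ∀ h, Fin (D.pool θ ε h) → Sample S A) (k : Fin K) :
    (m : ℕ) → m < H → Option (S × A) → ℝ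
  | 0, _ => fun _ => 1
  | m + 1, hm => fun o => o.elim 0 fun y =>
      ides π D θ ε data k m (Nat.lt_of_succ_lt hm) y / D.mu ⟨m, Nat.lt_of_succ_lt hm⟩ y

theorem ides_eq (π : Fin K → Policy S A H) (D : Design S A H K) (θ : Params H) (ε : ℝ)
    (data : ∀ h, Fin (D.pool θ ε h) → Sample S A) (k : Fin K) (m : ℕ) (hm : m < H) :
    ides π D θ ε data k m hm = average (D.iters θ ε k ⟨m, hm⟩)
      (sgd (D.d k ⟨m, hm⟩) (θ.η ⟨m, hm⟩) (π k ⟨m, hm⟩) (D.mu ⟨m, hm⟩)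
        (prevDensity π D θ ε data k m hm) (data ⟨m, hm⟩)) := by
  cases m <;> rfl

theorem ides_congr (π : Fin K → Policy S A H) (D : Design S A H K) (θ : Params H) (ε : ℝ)
    {data data' : ∀ h, Fin (D.pool θ ε h) → Sample S A} (k : Fin K) (m : ℕ) (hm : m < H)
    (h : ∀ i : Fin H, (i : ℕ) ≤ m → data i = data' i) :
    ides π D θ ε data k m hm = ides π D θ ε data' k m hm := by
  induction m with
  | zero => rw [ides, ides, h ⟨0, hm⟩ le_rfl]
  | succ m ih =>
    rw [ides, ides, h ⟨m + 1, hm⟩ le_rfl,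
      ih (Nat.lt_of_succ_lt hm) fun i hi => h i (hi.trans m.le_succ)]

/-- The ratio used at step m is a function of earlier samples only, hence independent of the samples
of step m. -/
theorem prevDensity_congr (π : Fin K → Policy S A H) (D : Design S A H K) (θ : Params H) (ε : ℝ)
    {data data' : ∀ h, Fin (D.pool θ ε h) → Sample S A} (k : Fin K) (m : ℕ) (hm : m < H)
    (h : ∀ i : Fin H, (i : ℕ) < m → data i = data' i) :
    prevDensity π D θ ε data k m hm = prevDensity π D θ ε data' k m hm := by
  cases m with
  | zero => rfl
  | succ m =>
    simp only [prevDensity]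
    rw [ides_congr π D θ ε k m (Nat.lt_of_succ_lt hm) fun i hi => h i (Nat.lt_succ_of_le hi)]

/-- Guaranteed by the projection for every realization of the data; in particular the estimate
vanishes at ignored pairs. -/
theorem ides_mem {D : Design S A H K} (hD : D.Valid) (π : Fin K → Policy S A H) (θ : Params H)
    (ε : ℝ) (data : ∀ h, Fin (D.pool θ ε h) → Sample S A) (k : Fin K) (m : ℕ) (hm : m < H)
    (x : S × A) : ides π D θ ε data k m hm x ∈ Set.Icc 0 (2 * D.d k ⟨m, hm⟩ x) := by
  have hc : 0 ≤ 2 * D.d k ⟨m, hm⟩ x := by have := hD.nonneg k ⟨m, hm⟩ x; positivity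
  rw [ides_eq]
  refine average_mem hc fun i => ?_
  rw [sgd_eq_chain fun x => hD.nonneg k ⟨m, hm⟩ x]
  exact chain_mem hc _ _ _ ⟨le_rfl, hc⟩ i

theorem ratioPrev_zero (D : Design S A H K) (k : Fin K) (hH : 0 < H) :
    D.ratioPrev k ⟨0, hH⟩ = 1 := by
  simp [Design.ratioPrev, prev]

theorem ratioPrev_succ (D : Design S A H K) (k : Fin K) (m : ℕ) (hm : m + 1 < H) :
    D.ratioPrev k ⟨m + 1, hm⟩ = D.ratio k ⟨m, Nat.lt_of_succ_lt hm⟩ := by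
  simp [Design.ratioPrev, prev]

theorem ratioPrev_nonneg {D : Design S A H K} (hD : D.Valid) (k : Fin K) (h : Fin H) :
    0 ≤ D.ratioPrev k h := by
  obtain ⟨m, hm⟩ := h
  cases m with
  | zero => rw [ratioPrev_zero]; exact zero_le_one
  | succ m => rw [ratioPrev_succ]; exact hD.ratio_nonneg _ _

theorem sum_le_card_mul_of_graph {f : S × A → ℝ} {g : S → A} {c : ℝ}
    (h0 : ∀ s b, b ≠ g s → f (s, b) = 0) (hc : ∀ x, f x ≤ c) :
    ∑ x, f x ≤ Fintype.card S * c := by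
  rw [Fintype.sum_prod_type]
  calc ∑ s, ∑ a, f (s, a) = ∑ s, f (s, g s) := by
        refine Finset.sum_congr rfl fun s _ => ?_
        rw [Finset.sum_eq_single (g s) (fun b _ hb => h0 s b hb) (by simp)]
    _ ≤ ∑ _s : S, c := Finset.sum_le_sum fun s _ => hc _
    _ = _ := by simp

variable {M : MDP S A H} {π : Fin K → Policy S A H} {D : Design S A H K} {acc : ℝ}

namespace Design.Accurate

variable (hA : D.Accurate M π acc) (hD : D.Valid) (hacc : 0 ≤ acc)
  (hπ : ∀ k, (π k).IsDeterministic)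

include hA in
theorem ne_zero_imp_occ_pos (hD : D.Valid) {k : Fin K} {h : Fin H} {x : S × A}
    (hx : D.d k h x ≠ 0) : 0 < occ M (π k) h x := by
  have h1 := hA.le_occ k h x hx
  have h2 : 0 < D.d k h x := lt_of_le_of_ne (hD.nonneg k h x) hx.symm
  linarith

include hA hD hπ in
-- A kept pair has positive true probability, so its action is the one the deterministic policy
-- prescribes: one pair per state. Here determinism yields S in place of S·A.
theorem card_support_le (k : Fin K) (h : Fin H) :
    ((Finset.univ.filter fun x => D.d k h x ≠ 0).card : ℝ) ≤ Fintype.card S := by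
  choose g hg using hπ k h
  have h1 := sum_le_card_mul_of_graph (f := fun x => if D.d k h x ≠ 0 then (1 : ℝ) else 0)
    (g := g) (c := 1) (fun s b hb => by
      rw [if_neg]
      intro hx
      exact (hA.ne_zero_imp_occ_pos hD hx).ne' (occ_eq_zero (hg s) hb))
    (fun x => by split_ifs <;> norm_num)
  rw [← Finset.sum_filter] at h1
  simpa using h1

include hA hacc hπ in
theorem sum_ignored_le (k : Fin K) (h : Fin H) :
    ∑ x, (if D.d k h x = 0 then occ M (π k) h x else 0) ≤ Fintype.card S * (8 * acc) := by
  choose g hg using hπ k h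
  refine sum_le_card_mul_of_graph (g := g) (fun s b hb => ?_) fun x => ?_
  · rw [occ_eq_zero (hg s) hb, ite_self]
  · split_ifs with hx
    · exact hA.occ_le_of_ignored k h x hx
    · positivity

include hA hD hacc hπ in
-- Otherwise all pairs at this step would be ignored, and the total mass 1 would be at most 8·acc·S.
theorem ratio_pos (hS : Fintype.card S * (8 * acc) < 1) (k : Fin K) (h : Fin H) :
    0 < D.ratio k h := by
  by_contra hcon
  have h0 : ∀ x, D.d k h x = 0 := fun x => by
    by_contra hx
    exact hcon (hD.ratio_pos hx)
  have h1 := hA.sum_ignored_le hacc hπ k h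
  simp only [h0, if_true] at h1
  rw [sum_occ] at h1
  linarith

end Design.Accurate

/-- The sum of the visitation ratios that governs the density estimation at a step. -/
def Design.width (D : Design S A H K) (k : Fin K) (h : Fin H) : ℝ :=
  D.ratio k h + D.ratioPrev k h

theorem prob_sampleLaw_fst (M : MDP S A H) (π : Fin K → Policy S A H) (D : Design S A H K)
    (h : Fin H) (x : S × A) :
    prob (sampleLaw M π D h) {z | z.1 = some x} = D.smp M π h x := by
  have := expect_sampleLaw_fst M π D h (Set.indicator {o | o = some x} fun _ => 1)
  rw [expect_pairLaw M π D h _ (by simp)] at this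
  refine Eq.trans (b := _) ?_ (this.trans ?_)
  · rfl
  · rw [Finset.sum_eq_single x]
    · simp
    · intro y _ hy
      simp [hy]
    · simp

theorem expect_prev_succ (M : MDP S A H) (π : Fin K → Policy S A H) (D : Design S A H K)
    {m : ℕ} (hm : m + 1 < H) (g : S × A → S → ℝ) :
    expect (sampleLaw M π D ⟨m + 1, hm⟩) (fun z => z.2.1.elim 0 fun y => g y z.2.2)
      = ∑ y, D.smp M π ⟨m, Nat.lt_of_succ_lt hm⟩ y
        * expect (M.P ⟨m, Nat.lt_of_succ_lt hm⟩ y.1 y.2) (g y) := by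
  rw [expect_sampleLaw_snd M π D ⟨m + 1, hm⟩ fun y => y.1.elim 0 fun x => g x y.2,
    expect_transLaw_succ M π D m hm _ fun s => rfl]
  rfl

/-! ### Second moments of the estimated densities and propagation of their errors -/

variable (hA : D.Accurate M π acc) (hD : D.Valid) (hacc : 0 < acc)
  (hπ : ∀ k, (π k).IsDeterministic) (hS : Fintype.card S * (8 * acc) < 1)
  (θ : Params H) (ε : ℝ)

include hA hD in
-- The box gives a factor 4 and the sampling law a factor 5/4. Summed over y, this bounds the second
-- moment of the importance weight by the ratio.
theorem smp_mul_sq_le (data : ∀ h, Fin (D.pool θ ε h) → Sample S A) (k : Fin K) (m : ℕ)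
    (hm : m < H) (y : S × A) :
    D.smp M π ⟨m, hm⟩ y * (ides π D θ ε data k m hm y / D.mu ⟨m, hm⟩ y) ^ 2
      ≤ 5 * (D.d k ⟨m, hm⟩ y ^ 2 / D.mu ⟨m, hm⟩ y) := by
  have h1 := ides_mem hD π θ ε data k m hm y
  by_cases hy : D.d k ⟨m, hm⟩ y = 0
  · have : ides π D θ ε data k m hm y = 0 := by
      rw [hy] at h1; exact le_antisymm (by simpa using h1.2) h1.1
    simp [this, hy]
  · have hmu := hD.mu_pos hy
    have h2 := hA.smp_le_mu ⟨m, hm⟩ y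
    have h3 : ides π D θ ε data k m hm y ^ 2 ≤ (2 * D.d k ⟨m, hm⟩ y) ^ 2 :=
      pow_le_pow_left₀ h1.1 h1.2 2
    calc D.smp M π ⟨m, hm⟩ y * (ides π D θ ε data k m hm y / D.mu ⟨m, hm⟩ y) ^ 2
        ≤ 5 / 4 * D.mu ⟨m, hm⟩ y * ((2 * D.d k ⟨m, hm⟩ y) ^ 2 / D.mu ⟨m, hm⟩ y ^ 2) := by
          rw [div_pow]
          gcongr
      _ = _ := by field_simp; ring

include hA hD hacc hπ hS in
-- Only the box constraint on earlier estimates is used, so this holds for every realization of the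
-- earlier samples, accurate or not.
theorem stage_sampleLaw [Nonempty S] (data : ∀ h, Fin (D.pool θ ε h) → Sample S A) (k : Fin K)
    (m : ℕ) (hm : m < H) :
    Stage (sampleLaw M π D ⟨m, hm⟩) (D.d k ⟨m, hm⟩) (D.mu ⟨m, hm⟩)
      (prevDensity π D θ ε data k m hm) (D.width k ⟨m, hm⟩) (Fintype.card S) where
  dhat_nonneg x := hD.nonneg _ _ _
  sum_dhat_le := hD.sum_le _ _
  mu_pos x hx := hD.mu_pos hx
  le_hit x _ := by rw [prob_sampleLaw_fst]; exact hA.mu_le_smp _ x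
  hit_le x _ := by rw [prob_sampleLaw_fst]; exact hA.smp_le_mu _ x
  sum_sq_le := le_add_of_nonneg_right (ratioPrev_nonneg hD k _)
  u_nonneg o := by
    cases m with
    | zero => exact zero_le_one
    | succ m =>
      cases o with
      | none => exact le_rfl
      | some y => exact div_nonneg (ides_mem hD π θ ε data k m _ y).1 (hD.mu_nonneg _ y)
  u_sq_le := by
    have hr := hD.ratio_nonneg k ⟨m, hm⟩
    cases m with
    | zero =>
      simp only [prevDensity, one_pow, expect_const]
      rw [Design.width, ratioPrev_zero]
      linarith
    | succ m =>
      rw [Design.width, ratioPrev_succ]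
      have hm' := Nat.lt_of_succ_lt hm
      have e := expect_prev_succ M π D hm fun y _ =>
        (ides π D θ ε data k m hm' y / D.mu ⟨m, hm'⟩ y) ^ 2
      have e' : ∀ z : Sample S A, prevDensity π D θ ε data k (m + 1) hm z.2.1 ^ 2
          = z.2.1.elim 0 fun y => (ides π D θ ε data k m hm' y / D.mu ⟨m, hm'⟩ y) ^ 2 := by
        intro z
        cases h : z.2.1 <;> simp [prevDensity]
      simp only [e', e, expect_const]
      refine (Finset.sum_le_sum fun y _ => smp_mul_sq_le hA hD θ ε data k m hm' y).trans ?_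
      rw [← Finset.mul_sum]
      have : D.ratio k ⟨m, hm'⟩ = ∑ x, D.d k ⟨m, hm'⟩ x ^ 2 / D.mu ⟨m, hm'⟩ x := rfl
      linarith
  card_le := hA.card_support_le hD hπ k _
  ρ_pos := add_pos_of_pos_of_nonneg (hA.ratio_pos hD hacc.le hπ hS k _) (ratioPrev_nonneg hD k _)
  s_pos := by exact_mod_cast Fintype.card_pos

include hA hD in
-- Kept frequencies are at least 5·acc, which buys a second factor d. The loss 1/acc is affordable
-- because this sum enters the error of iterate j only in a term with the factor t/j.
theorem sum_ratio_le (data : ∀ h, Fin (D.pool θ ε h) → Sample S A) (hacc : 0 < acc)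
    (k : Fin K) (m : ℕ) (hm : m < H) :
    ∑ y, ides π D θ ε data k m hm y / D.mu ⟨m, hm⟩ y ≤ 2 * D.ratio k ⟨m, hm⟩ / (5 * acc) := by
  have h1 : ∀ y, ides π D θ ε data k m hm y / D.mu ⟨m, hm⟩ y
      ≤ 2 / (5 * acc) * (D.d k ⟨m, hm⟩ y ^ 2 / D.mu ⟨m, hm⟩ y) := by
    intro y
    have h1 := ides_mem hD π θ ε data k m hm y
    by_cases hy : D.d k ⟨m, hm⟩ y = 0
    · have : ides π D θ ε data k m hm y = 0 := by
        rw [hy] at h1; exact le_antisymm (by simpa using h1.2) h1.1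
      simp [this, hy]
    · have hmu := hD.mu_pos hy
      have h2 := hA.le k ⟨m, hm⟩ y hy
      rw [← mul_div_assoc]
      gcongr
      rw [div_mul_eq_mul_div, le_div_iff₀ (by positivity)]
      nlinarith [h1.1, h1.2]
  refine (Finset.sum_le_sum fun y _ => h1 y).trans (le_of_eq ?_)
  rw [← Finset.mul_sum, Design.ratio]
  ring

include hA hD in
theorem sum_high_prevDensity_le (hacc : 0 < acc) {b₀ : ℝ} (hb₀ : 0 < b₀) (hb₁ : b₀ ≤ 1)
    (data : ∀ h, Fin (D.pool θ ε h) → Sample S A) (k : Fin K) (m : ℕ) (hm : m < H) :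
    ∑ o, high (D.width k ⟨m, hm⟩ / b₀) (prevDensity π D θ ε data k m hm) o
      ≤ 2 * D.width k ⟨m, hm⟩ / (5 * acc) := by
  have hr := hD.ratio_nonneg k ⟨m, hm⟩
  cases m with
  | zero =>
    -- At the first step u = 1 lies below the truncation level, because the fictitious ratio makes
    -- the width at least 1.
    have h1 : ∀ o, high (D.width k ⟨0, hm⟩ / b₀) (prevDensity π D θ ε data k 0 hm) o = 0 := by
      intro o
      rw [high, if_pos]
      have : 1 ≤ D.width k ⟨0, hm⟩ / b₀ := by
        rw [le_div_iff₀ hb₀, Design.width, ratioPrev_zero]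
        linarith
      simp only [prevDensity]
      linarith
    simp only [h1, Finset.sum_const_zero]
    have : 0 ≤ D.width k ⟨0, hm⟩ := add_nonneg hr (ratioPrev_nonneg hD k _)
    positivity
  | succ m =>
    have hm' := Nat.lt_of_succ_lt hm
    have h0 : ∀ o, 0 ≤ prevDensity π D θ ε data k (m + 1) hm o := by
      intro o
      cases o with
      | none => exact le_rfl
      | some y => exact div_nonneg (ides_mem hD π θ ε data k m _ y).1 (hD.mu_nonneg _ y)
    calc ∑ o, high (D.width k ⟨m + 1, hm⟩ / b₀) (prevDensity π D θ ε data k (m + 1) hm) o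
        ≤ ∑ o, prevDensity π D θ ε data k (m + 1) hm o := by
          refine Finset.sum_le_sum fun o _ => ?_
          unfold high
          split_ifs
          exacts [h0 o, le_rfl]
      _ = ∑ y, ides π D θ ε data k m hm' y / D.mu ⟨m, hm'⟩ y := by
          rw [Fintype.sum_option]
          simp [prevDensity]
      _ ≤ 2 * D.ratio k ⟨m, hm'⟩ / (5 * acc) := sum_ratio_le hA hD θ ε data hacc k m hm'
      _ ≤ _ := by
          rw [Design.width, ratioPrev_succ]
          gcongr
          linarith

include hA hD in
/-- The error of the target of a step, compared with the visitation probabilities, is the error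
of the step before. -/
theorem sum_abs_expect_push_sub_occ_le (data : ∀ h, Fin (D.pool θ ε h) → Sample S A) (k : Fin K)
    (m : ℕ) (hm : m + 1 < H) :
    ∑ x, |expect (sampleLaw M π D ⟨m + 1, hm⟩)
        (push (π k ⟨m + 1, hm⟩) (prevDensity π D θ ε data k (m + 1) hm) x)
          - occ M (π k) ⟨m + 1, hm⟩ x|
      ≤ ∑ y, |D.smp M π ⟨m, Nat.lt_of_succ_lt hm⟩ y
          * (ides π D θ ε data k m (Nat.lt_of_succ_lt hm) y
            / D.mu ⟨m, Nat.lt_of_succ_lt hm⟩ y) - occ M (π k) ⟨m, Nat.lt_of_succ_lt hm⟩ y| := by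
  have hm' := Nat.lt_of_succ_lt hm
  set v : S × A → ℝ := fun y => D.smp M π ⟨m, hm'⟩ y
    * (ides π D θ ε data k m hm' y / D.mu ⟨m, hm'⟩ y) with hv
  have h1 : ∀ x, expect (sampleLaw M π D ⟨m + 1, hm⟩)
      (push (π k ⟨m + 1, hm⟩) (prevDensity π D θ ε data k (m + 1) hm) x)
      = (∑ y, v y * (M.P ⟨m, hm'⟩ y.1 y.2 x.1).toReal) * (π k ⟨m + 1, hm⟩ x.1 x.2).toReal := by
    intro x
    have e := expect_prev_succ M π D hm fun y s => if s = x.1 then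
        ides π D θ ε data k m hm' y / D.mu ⟨m, hm'⟩ y * (π k ⟨m + 1, hm⟩ x.1 x.2).toReal else 0
    have e' : ∀ z, push (π k ⟨m + 1, hm⟩) (prevDensity π D θ ε data k (m + 1) hm) x z
        = z.2.1.elim 0 fun y => if z.2.2 = x.1 then
        ides π D θ ε data k m hm' y / D.mu ⟨m, hm'⟩ y * (π k ⟨m + 1, hm⟩ x.1 x.2).toReal
          else 0 := by
      intro z
      unfold push
      cases h : z.2.1 <;> simp [prevDensity]
    rw [show push (π k ⟨m + 1, hm⟩) (prevDensity π D θ ε data k (m + 1) hm) x = _ from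
      funext e', e, Finset.sum_mul]
    refine Finset.sum_congr rfl fun y _ => ?_
    simp only [expect, mul_ite, mul_zero, Finset.sum_ite_eq', Finset.mem_univ, if_true, hv]
    ring
  -- A transition followed by an action is a stochastic kernel, so it cannot increase ℓ¹ distances.
  have h2 : ∀ x, |expect (sampleLaw M π D ⟨m + 1, hm⟩)
        (push (π k ⟨m + 1, hm⟩) (prevDensity π D θ ε data k (m + 1) hm) x)
          - occ M (π k) ⟨m + 1, hm⟩ x|
      ≤ ∑ y, |v y - occ M (π k) ⟨m, hm'⟩ y| * ((M.P ⟨m, hm'⟩ y.1 y.2 x.1).toReal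
        * (π k ⟨m + 1, hm⟩ x.1 x.2).toReal) := by
    intro x
    rw [h1, occ_succ M (π k) m hm x, ← sub_mul, ← Finset.sum_sub_distrib, Finset.sum_mul]
    refine (Finset.abs_sum_le_sum_abs _ _).trans (le_of_eq (Finset.sum_congr rfl fun y _ => ?_))
    rw [← sub_mul, mul_assoc, abs_mul]
    congr 1
    exact abs_of_nonneg (by positivity)
  refine (Finset.sum_le_sum fun x _ => h2 x).trans (le_of_eq ?_)
  rw [Finset.sum_comm]
  refine Finset.sum_congr rfl fun y _ => ?_
  rw [← Finset.mul_sum, Fintype.sum_prod_type]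
  simp only [← Finset.mul_sum, sum_toReal, mul_one]
  rfl

theorem expect_push_zero (data : ∀ h, Fin (D.pool θ ε h) → Sample S A) (k : Fin K)
    (hH : 0 < H) (x : S × A) :
    expect (sampleLaw M π D ⟨0, hH⟩)
        (push (π k ⟨0, hH⟩) (prevDensity π D θ ε data k 0 hH) x) = occ M (π k) ⟨0, hH⟩ x := by
  rw [occ_zero]
  have := expect_sampleLaw_snd M π D ⟨0, hH⟩ fun y =>
    if y.2 = x.1 then (π k ⟨0, hH⟩ x.1 x.2).toReal else 0
  rw [expect_transLaw_zero] at this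
  simpa [push, prevDensity, expect] using this

include hA hD hacc hπ hS in
/-- The error of the importance-weighted visitation probabilities after one more step. -/
theorem sum_abs_density_sub_occ_le [Nonempty S]
    (data : ∀ h, Fin (D.pool θ ε h) → Sample S A) (k : Fin K)
    {e : ℝ} (he : ∀ m hm, ∑ x, |ides π D θ ε data k m hm x
      - target (sampleLaw M π D ⟨m, hm⟩) (D.d k ⟨m, hm⟩) (D.mu ⟨m, hm⟩) (π k ⟨m, hm⟩)
        (prevDensity π D θ ε data k m hm) x| ≤ e) (m : ℕ) (hm : m < H) :
    ∑ x, |D.smp M π ⟨m, hm⟩ x * (ides π D θ ε data k m hm x / D.mu ⟨m, hm⟩ x)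
      - occ M (π k) ⟨m, hm⟩ x| ≤ (m + 1) * (5 / 4 * e + Fintype.card S * (8 * acc)) := by
  have step : ∀ m (hm : m < H),
      ∑ x, |D.smp M π ⟨m, hm⟩ x * (ides π D θ ε data k m hm x / D.mu ⟨m, hm⟩ x)
        - occ M (π k) ⟨m, hm⟩ x|
      ≤ 5 / 4 * e + Fintype.card S * (8 * acc) + ∑ x, |expect (sampleLaw M π D ⟨m, hm⟩)
        (push (π k ⟨m, hm⟩) (prevDensity π D θ ε data k m hm) x) - occ M (π k) ⟨m, hm⟩ x| := by
    intro m hm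
    have hSt := stage_sampleLaw hA hD hacc hπ hS θ ε data k m hm
    have h1 : ∀ x, |D.smp M π ⟨m, hm⟩ x * (ides π D θ ε data k m hm x / D.mu ⟨m, hm⟩ x)
        - occ M (π k) ⟨m, hm⟩ x|
        ≤ 5 / 4 * |ides π D θ ε data k m hm x
          - target (sampleLaw M π D ⟨m, hm⟩) (D.d k ⟨m, hm⟩) (D.mu ⟨m, hm⟩) (π k ⟨m, hm⟩)
            (prevDensity π D θ ε data k m hm) x|
          + (if D.d k ⟨m, hm⟩ x = 0 then occ M (π k) ⟨m, hm⟩ x else 0)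
          + |expect (sampleLaw M π D ⟨m, hm⟩)
        (push (π k ⟨m, hm⟩) (prevDensity π D θ ε data k m hm) x) - occ M (π k) ⟨m, hm⟩ x| := by
      intro x
      have hi := ides_mem hD π θ ε data k m hm x
      set w := ides π D θ ε data k m hm x
      set b := expect (sampleLaw M π D ⟨m, hm⟩)
        (push (π k ⟨m, hm⟩) (prevDensity π D θ ε data k m hm) x) with hb
      set o := occ M (π k) ⟨m, hm⟩ x with ho
      have ho0 : 0 ≤ o := occ_nonneg _ _ _ _
      split_ifs with hx
      · have hw : w = 0 := by rw [hx] at hi; exact le_antisymm (by simpa using hi.2) hi.1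
        rw [hw, zero_div, mul_zero, zero_sub, abs_neg, abs_of_nonneg ho0]
        have := abs_nonneg (b - o)
        have := abs_nonneg (0 - target (sampleLaw M π D ⟨m, hm⟩) (D.d k ⟨m, hm⟩)
          (D.mu ⟨m, hm⟩) (π k ⟨m, hm⟩) (prevDensity π D θ ε data k m hm) x)
        linarith
      · have hmu := hD.mu_pos hx
        set κ := expect (sampleLaw M π D ⟨m, hm⟩) (hit (D.mu ⟨m, hm⟩) x) with hκ
        have hκe : κ = D.smp M π ⟨m, hm⟩ x / D.mu ⟨m, hm⟩ x := by
          rw [hκ, expect_hit, prob_sampleLaw_fst, inv_mul_eq_div]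
        have hκ1 : 4 / 5 ≤ κ := hSt.expect_hit_ge hx
        have hκ2 : κ ≤ 5 / 4 := by
          rw [hκe, div_le_iff₀ hmu]; exact hA.smp_le_mu _ x
        have e1 : D.smp M π ⟨m, hm⟩ x * (w / D.mu ⟨m, hm⟩ x) = κ * w := by
          rw [hκe]; ring
        -- The exact solution lies in the box, as (5/4)² < 2; so clipping does not move it and only
        -- helps the estimate.
        have hoκ : o / κ ∈ Set.Icc 0 (2 * D.d k ⟨m, hm⟩ x) := by
          refine ⟨div_nonneg ho0 (by linarith), ?_⟩
          rw [div_le_iff₀ (by linarith)]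
          have := hA.occ_le k ⟨m, hm⟩ x hx
          nlinarith [hD.nonneg k ⟨m, hm⟩ x]
        set θ' := target (sampleLaw M π D ⟨m, hm⟩) (D.d k ⟨m, hm⟩) (D.mu ⟨m, hm⟩) (π k ⟨m, hm⟩)
            (prevDensity π D θ ε data k m hm) x with hθ'
        have h2 : |θ' - o / κ| ≤ |b - o| / κ := by
          have := abs_clip_sub_clip_le (2 * D.d k ⟨m, hm⟩ x) (b / κ) (o / κ)
          rw [clip_of_mem hoκ, ← sub_div, abs_div, abs_of_pos (show 0 < κ by linarith)] at this
          exact this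
        -- Reweighting by κ cancels the division by κ in the target. The previous error thus enters
        -- with factor exactly 1; any larger constant would grow exponentially along the steps.
        have e2 : κ * w - o = κ * (w - θ') + κ * (θ' - o / κ) := by
          field_simp; ring
        rw [e1, e2, add_zero]
        refine (abs_add_le _ _).trans ?_
        rw [abs_mul, abs_mul, abs_of_pos (show 0 < κ by linarith)]
        refine add_le_add (mul_le_mul_of_nonneg_right hκ2 (abs_nonneg _)) ?_
        calc κ * |θ' - o / κ| ≤ κ * (|b - o| / κ) := by gcongr
          _ = |b - o| := by field_simp
    refine (Finset.sum_le_sum fun x _ => h1 x).trans ?_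
    rw [Finset.sum_add_distrib, Finset.sum_add_distrib, ← Finset.mul_sum]
    have h2 := he m hm
    have h3 := hA.sum_ignored_le hacc.le hπ k ⟨m, hm⟩
    linarith
  induction m with
  | zero =>
    refine (step 0 hm).trans ?_
    simp [expect_push_zero]
  | succ m ih =>
    refine (step (m + 1) hm).trans ?_
    have h1 := sum_abs_expect_push_sub_occ_le hA hD θ ε data k m hm
    have h2 := ih (Nat.lt_of_succ_lt hm)
    push_cast
    linarith

end Flow

/-! ### Typical data -/

section Typical

variable {S A : Type*} [Fintype S] [Fintype A] [DecidableEq S] [DecidableEq A] {H K : ℕ}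

/-- In all windows, the counts of the pairs and of the preceding pairs are typical. -/
def TypicalCounts (q : PMF (Sample S A)) (t : ℝ) {N : ℕ} (data : Fin N → Sample S A) : Prop :=
  ∀ j, 0 < j → j ≤ N →
    (∀ x : S × A, (window N (j / 2) j).card * prob q {z | z.1 = some x} / 2 - 8 * t
      ≤ hits (window N (j / 2) j) {z | z.1 = some x} data) ∧
    ∀ o : Option (S × A), hits (window N (j / 2) j) {z | z.2.1 = o} data
      ≤ 3 / 2 * ((window N (j / 2) j).card * prob q {z | z.2.1 = o}) + 8 * t

/-- The choice r = 1/8 yields the factors 1/2 and 3/2 and the additive 8t. The union runs over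
windows and values only, not over policies. -/
theorem prob_not_typicalCounts_le (q : PMF (Sample S A)) (t : ℝ) (N : ℕ) :
    prob (indep fun _ : Fin N => q) {data | TypicalCounts q t data}ᶜ
      ≤ N * (2 * (Fintype.card S * Fintype.card A) + 1) * Real.exp (-t) := by
  set E₁ : ℕ × (S × A) → Set (Fin N → Sample S A) := fun i =>
    {data | hits (window N (i.1 / 2) i.1) {z | z.1 = some i.2} data
      ≤ (window N (i.1 / 2) i.1).card * prob q {z | z.1 = some i.2}
        - 1 / 8 * (4 * ((window N (i.1 / 2) i.1).card * prob q {z | z.1 = some i.2}))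
        - t / (1 / 8)} with hE₁
  set E₂ : ℕ × Option (S × A) → Set (Fin N → Sample S A) := fun i =>
    {data | (window N (i.1 / 2) i.1).card * prob q {z | z.2.1 = i.2}
        + 1 / 8 * (4 * ((window N (i.1 / 2) i.1).card * prob q {z | z.2.1 = i.2}))
        + t / (1 / 8) ≤ hits (window N (i.1 / 2) i.1) {z | z.2.1 = i.2} data} with hE₂
  have h1 : {data | TypicalCounts q t data}ᶜ
      ⊆ {data | ∃ i ∈ Finset.Icc 1 N ×ˢ Finset.univ, data ∈ E₁ i}
        ∪ {data | ∃ i ∈ Finset.Icc 1 N ×ˢ Finset.univ, data ∈ E₂ i} := by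
    intro data hdata
    by_contra hcon
    rw [Set.mem_union, not_or] at hcon
    refine hdata fun j hj hjN => ⟨fun x => ?_, fun o => ?_⟩
    · by_contra hx
      refine hcon.1 ⟨(j, x), by simp; omega, ?_⟩
      simp only [hE₁, Set.mem_ofPred_eq]
      linarith
    · by_contra hx
      refine hcon.2 ⟨(j, o), by simp; omega, ?_⟩
      simp only [hE₂, Set.mem_ofPred_eq]
      linarith
  refine (prob_mono h1).trans ((prob_union_le _ _ _).trans ((add_le_add
    (prob_biUnion_le_card _ _ E₁ fun i _ =>
      prob_hits_le_le q _ _ (r := 1 / 8) (by norm_num) (by norm_num) t)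
    (prob_biUnion_le_card _ _ E₂ fun i _ =>
      prob_hits_ge_le q _ _ (r := 1 / 8) (by norm_num) (by norm_num) t)).trans (le_of_eq ?_)))
  rw [Finset.card_product, Finset.card_product, Finset.card_univ, Finset.card_univ,
    Fintype.card_option, Fintype.card_prod, Nat.card_Icc, Nat.add_sub_cancel]
  push_cast
  ring

/-- The counts and the deviations of the density estimation are typical at all steps. -/
def TypicalData (M : MDP S A H) (π : Fin K → Policy S A H) (D : Design S A H K) (θ : Params H)
    (ε p t T τ b₀ : ℝ) (data : ∀ h, Fin (D.pool θ ε h) → Sample S A) : Prop :=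
  ∀ m (hm : m < H), TypicalCounts (sampleLaw M π D ⟨m, hm⟩) t (data ⟨m, hm⟩) ∧
    ∀ k j, 0 < j → j ≤ D.iters θ ε k ⟨m, hm⟩ →
      dev (sampleLaw M π D ⟨m, hm⟩) (D.d k ⟨m, hm⟩) (D.mu ⟨m, hm⟩) (π k ⟨m, hm⟩)
          (prevDensity π D θ ε data k m hm) p (D.width k ⟨m, hm⟩ / b₀) j (data ⟨m, hm⟩)
        ≤ τ + 20 * p * D.width k ⟨m, hm⟩ / (D.width k ⟨m, hm⟩ / b₀)
          + (20 * Fintype.card S * p ^ 2 * D.width k ⟨m, hm⟩ / τ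
            + 16 * p * (D.width k ⟨m, hm⟩ / b₀) * T) / j

theorem iters_le_pool (D : Design S A H K) (θ : Params H) (ε : ℝ) (k : Fin K) (h : Fin H) :
    D.iters θ ε k h ≤ D.pool θ ε h :=
  Finset.le_sup (f := fun k => D.iters θ ε k h) (Finset.mem_univ k)

variable {M : MDP S A H} {π : Fin K → Policy S A H} {D : Design S A H K} {acc : ℝ}

/-- Two confidence levels: t for the counts, which all policies share, and T for the deviations,
which need a union over k. -/
theorem prob_not_typicalData_le [Nonempty S] (hA : D.Accurate M π acc) (hD : D.Valid)
    (hacc : 0 < acc) (hπ : ∀ k, (π k).IsDeterministic) (hS : Fintype.card S * (8 * acc) < 1)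
    (θ : Params H) (ε : ℝ) {p t T τ b₀ : ℝ} (hp : 0 < p) (hτ : 0 < τ) (hb₀ : 0 < b₀)
    {Nmax : ℝ} (hN : ∀ h, (D.pool θ ε h : ℝ) ≤ Nmax) :
    prob (indep fun h => indep fun _ : Fin (D.pool θ ε h) => sampleLaw M π D h)
      {data | TypicalData M π D θ ε p t T τ b₀ data}ᶜ
      ≤ H * (Nmax * ((2 * (Fintype.card S * Fintype.card A) + 1) * Real.exp (-t)
          + K * Real.exp (-T))) := by
  set E₁ : Fin H → Set (∀ h, Fin (D.pool θ ε h) → Sample S A) := fun h =>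
    {data | TypicalCounts (sampleLaw M π D h) t (data h)}ᶜ with hE₁
  set bd : Fin K → Fin H → ℕ → ℝ := fun k h j => τ + 20 * p * D.width k h / (D.width k h / b₀)
          + (20 * Fintype.card S * p ^ 2 * D.width k h / τ
            + 16 * p * (D.width k h / b₀) * T) / j with hbd
  set E₂ : Fin H → Fin K × ℕ → Set (∀ h, Fin (D.pool θ ε h) → Sample S A) := fun h i =>
    {data | bd i.1 h i.2 ≤ dev (sampleLaw M π D h) (D.d i.1 h) (D.mu h) (π i.1 h)
          (prevDensity π D θ ε data i.1 h h.isLt) p (D.width i.1 h / b₀) i.2 (data h)} with hE₂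
  set I : Fin H → Finset (Fin K × ℕ) := fun h =>
    (Finset.univ ×ˢ Finset.Icc 1 (D.pool θ ε h)) with hI
  have h1 : {data | TypicalData M π D θ ε p t T τ b₀ data}ᶜ
      ⊆ {data | ∃ h ∈ Finset.univ, data ∈ E₁ h ∪ {data | ∃ i ∈ I h, data ∈ E₂ h i}} := by
    intro data hdata
    by_contra hcon
    simp only [Finset.mem_univ, true_and, Set.mem_ofPred_eq, not_exists, Set.mem_union,
      not_or] at hcon
    refine hdata fun m hm => ⟨?_, fun k j hj hjn => ?_⟩
    · have := (hcon ⟨m, hm⟩).1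
      simpa only [hE₁, Set.mem_compl_iff, Set.mem_ofPred_eq, not_not] using this
    · by_contra hx
      refine (hcon ⟨m, hm⟩).2 (k, j) ⟨?_, ?_⟩
      · have := hjn.trans (iters_le_pool D θ ε k ⟨m, hm⟩)
        simp only [hI, Finset.mem_product, Finset.mem_univ, true_and, Finset.mem_Icc]
        omega
      · exact (not_le.1 hx).le
  refine (prob_mono h1).trans ((prob_biUnion_le_card _ _ _ (b := Nmax *
    ((2 * (Fintype.card S * Fintype.card A) + 1) * Real.exp (-t) + K * Real.exp (-T)))
    fun h _ => ?_).trans (le_of_eq (by simp)))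
  have hE₁p : prob (indep fun h => indep fun _ : Fin (D.pool θ ε h) => sampleLaw M π D h) (E₁ h)
      ≤ D.pool θ ε h * (2 * (Fintype.card S * Fintype.card A) + 1) * Real.exp (-t) := by
    refine prob_indep_le _ h _ fun data => ?_
    refine le_trans (le_of_eq ?_) (prob_not_typicalCounts_le (sampleLaw M π D h) t (D.pool θ ε h))
    congr 1
    ext y
    simp [hE₁]
  have hE₂p : prob (indep fun h => indep fun _ : Fin (D.pool θ ε h) => sampleLaw M π D h)
      {data | ∃ i ∈ I h, data ∈ E₂ h i} ≤ (I h).card * Real.exp (-T) := by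
    refine prob_biUnion_le_card _ _ (E₂ h) fun i hi => prob_indep_le _ h _ fun data => ?_
    simp only [hI, Finset.mem_product, Finset.mem_univ, true_and, Finset.mem_Icc] at hi
    have hSt := stage_sampleLaw hA hD hacc hπ hS θ ε data i.1 h h.isLt
    have hB : 0 < D.width i.1 h / b₀ := div_pos hSt.ρ_pos hb₀
    refine le_trans (le_of_eq ?_) (hSt.prob_dev_ge_le (π i.1 h) hp hB hτ hi.1 hi.2 T)
    congr 1
    ext y
    -- Resampling step h leaves the preceding density fixed, so the bound for one step applies.
    have e : prevDensity π D θ ε (Function.update data h y) i.1 h h.isLt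
        = prevDensity π D θ ε data i.1 h h.isLt :=
      prevDensity_congr π D θ ε i.1 h h.isLt fun l hl =>
        Function.update_of_ne (fun hlh => by rw [hlh] at hl; exact lt_irrefl _ hl) _ _
    simp only [hE₂, Set.mem_ofPred_eq, Function.update_self, e]
    rfl
  refine (prob_union_le _ _ _).trans ((add_le_add hE₁p hE₂p).trans ?_)
  have hIc : ((I h).card : ℝ) = K * D.pool θ ε h := by
    simp [hI]
  rw [hIc]
  calc (D.pool θ ε h : ℝ) * (2 * (Fintype.card S * Fintype.card A) + 1) * Real.exp (-t)
        + K * D.pool θ ε h * Real.exp (-T)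
      = D.pool θ ε h * ((2 * (Fintype.card S * Fintype.card A) + 1) * Real.exp (-t)
        + K * Real.exp (-T)) := by ring
    _ ≤ _ := by gcongr; exact hN h

/-- The error of the density estimates on typical data. -/
theorem TypicalData.sum_abs_ides_sub_target_le [Nonempty S] (hA : D.Accurate M π acc)
    (hD : D.Valid) (hacc : 0 < acc) (hπ : ∀ k, (π k).IsDeterministic)
    (hS : Fintype.card S * (8 * acc) < 1) {θ : Params H} {ε : ℝ} (hε : 0 < ε)
    {p t T τ b₀ C : ℝ} (hp : 1 ≤ p) (ht : 0 ≤ t) (hpt : 80 * t ≤ p) (hT : 0 ≤ T) (hτ : 0 < τ)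
    (hb₀ : 0 < b₀) (hb₁ : b₀ ≤ 1) (hη : ∀ h (i : ℕ), θ.η h (i + 1) = p / ((i + 1 : ℕ) : ℝ))
    (hC : ∀ h, θ.C h = C) (hC0 : 0 < C) (hH : 0 < H)
    {data : ∀ h, Fin (D.pool θ ε h) → Sample S A}
    (hdata : TypicalData M π D θ ε p t T τ b₀ data) (k : Fin K) (m : ℕ) (hm : m < H) :
    ∑ x, |ides π D θ ε data k m hm x
      - target (sampleLaw M π D ⟨m, hm⟩) (D.d k ⟨m, hm⟩) (D.mu ⟨m, hm⟩) (π k ⟨m, hm⟩)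
        (prevDensity π D θ ε data k m hm) x|
      ≤ 3 * τ + 2 * Real.exp (-(p / 10)) + 33 * p * b₀
        + 2 * (21 * Fintype.card S * p ^ 2 / τ + 32 * p * t / (5 * acc) + 16 * p * T / b₀)
          * ε ^ 2 / (C * H ^ 4) := by
  have hSt := stage_sampleLaw hA hD hacc hπ hS θ ε data k m hm
  have hρ : 0 < D.width k ⟨m, hm⟩ := hSt.ρ_pos
  set ρ := D.width k ⟨m, hm⟩ with hρdef
  set n := D.iters θ ε k ⟨m, hm⟩ with hn
  have hH' : (0 : ℝ) < H := by exact_mod_cast hH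
  have hs : (0 : ℝ) < Fintype.card S := hSt.s_pos
  have hp0 : 0 < p := by linarith
  have hnle : C * (H ^ 4 / ε ^ 2 * ρ) ≤ n := by
    rw [hn, Design.iters, hC]
    exact Nat.le_ceil _
  have hn0' : 0 < C * (H ^ 4 / ε ^ 2 * ρ) := by positivity
  have hn0 : 0 < n := by exact_mod_cast hn0'.trans_le hnle
  have hnr : (0 : ℝ) < n := by exact_mod_cast hn0
  set κ₀ : ℝ := 21 * Fintype.card S * p ^ 2 / τ + 32 * p * t / (5 * acc) + 16 * p * T / b₀
    with hκ₀
  have hκ₀0 : 0 ≤ κ₀ := by positivity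
  have h1 : ∀ j, 0 < j → j ≤ n → ∑ x, |sgd (D.d k ⟨m, hm⟩) (θ.η ⟨m, hm⟩) (π k ⟨m, hm⟩)
      (D.mu ⟨m, hm⟩) (prevDensity π D θ ε data k m hm) (data ⟨m, hm⟩) j x
        - target (sampleLaw M π D ⟨m, hm⟩) (D.d k ⟨m, hm⟩) (D.mu ⟨m, hm⟩) (π k ⟨m, hm⟩)
        (prevDensity π D θ ε data k m hm) x|
      ≤ (3 * τ + 2 * Real.exp (-(p / 10)) + 33 * p * b₀) + ρ * κ₀ / j := by
    intro j hj hjn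
    have hjN : j ≤ D.pool θ ε ⟨m, hm⟩ := hjn.trans (iters_le_pool D θ ε k ⟨m, hm⟩)
    obtain ⟨hc, hdev⟩ := hdata m hm
    refine (hSt.sum_abs_sgd_sub_target_le (π k ⟨m, hm⟩) hp (div_pos hρ hb₀) hτ ht hpt
      (fun i => (θ.η_pos _ i).le) (hη _) hj hjN
      (sum_high_prevDensity_le hA hD θ ε hacc hb₀ hb₁ data k m hm)
      (hc j hj hjN).1 (hc j hj hjN).2 (hdev k j hj hjn)).trans (le_of_eq ?_)
    rw [← hρdef]
    have e1 : 33 * p * ρ / (ρ / b₀) = 33 * p * b₀ := by field_simp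
    rw [e1, hκ₀]
    congr 2
    field_simp
    ring
  rw [ides_eq]
  refine (sum_abs_average_sub_le hn0 _ _ (by positivity) h1).trans (add_le_add le_rfl ?_)
  -- The number of iterations is proportional to the width ρ, which cancels.
  calc 2 * (ρ * κ₀) / n ≤ 2 * (ρ * κ₀) / (C * (H ^ 4 / ε ^ 2 * ρ)) := by gcongr
    _ = 2 * κ₀ * ε ^ 2 / (C * H ^ 4) := by field_simp

/-! ### The final estimator -/

/-- The counts of the final sample are typical. -/
def TypicalFresh (M : MDP S A H) (π : Fin K → Policy S A H) (D : Design S A H K) (t : ℝ) {n : ℕ}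
    (fresh : Fin H → Fin n → Option (S × A)) : Prop :=
  ∀ h x, |hits Finset.univ {o | o = some x} (fresh h) - n * D.smp M π h x|
    ≤ 5 * Real.sqrt (t * (n * D.smp M π h x)) + 2 * t

theorem prob_pairLaw (M : MDP S A H) (π : Fin K → Policy S A H) (D : Design S A H K) (h : Fin H)
    (x : S × A) : prob (pairLaw M π D h) {o | o = some x} = D.smp M π h x := by
  rw [prob, expect_pairLaw M π D h _ (by simp), Finset.sum_eq_single x]
  · simp
  · intro y _ hy
    simp [hy]
  · simp

/-- With w = √(ta), the choice r = t/w balances the two Bernstein terms to 4w + w; it is at most 1/2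
once a ≥ 4t. For smaller means r = 1/2 suffices, as then a ≤ 2w. -/
theorem prob_abs_hits_gt_le {Z : Type*} [Fintype Z] {n : ℕ} (q : PMF Z) (Q : Set Z) {t : ℝ}
    (ht : 0 < t) :
    prob (indep fun _ : Fin n => q) {x | 5 * Real.sqrt (t * (n * prob q Q)) + 2 * t
      < |hits Finset.univ Q x - n * prob q Q|} ≤ 2 * Real.exp (-t) := by
  set a : ℝ := n * prob q Q with ha
  have ha0 : 0 ≤ a := mul_nonneg (Nat.cast_nonneg _) (prob_nonneg _ _)
  have hcard : ((Finset.univ : Finset (Fin n)).card : ℝ) = n := by simp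
  set w := Real.sqrt (t * a) with hw
  have hw0 : 0 ≤ w := Real.sqrt_nonneg _
  have hww : w * w = t * a := Real.mul_self_sqrt (by positivity)
  rcases lt_or_ge a (4 * t) with h | h
  · refine le_trans (prob_mono fun x hx => ?_)
      (prob_abs_hits_ge_le q Finset.univ Q (r := 1 / 2) (by norm_num) le_rfl t)
    simp only [Set.mem_ofPred_eq] at hx ⊢
    rw [hcard, ← ha]
    have h1 : a ≤ 2 * w := by
      by_contra hcon
      push Not at hcon
      nlinarith
    linarith
  · have ha1 : 0 < a := by linarith
    have hw1 : 0 < w := Real.sqrt_pos.2 (by positivity)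
    have h2 : t / w ≤ 1 / 2 := by
      rw [div_le_div_iff₀ hw1 two_pos]
      by_contra hcon
      push Not at hcon
      nlinarith
    refine le_trans (prob_mono fun x hx => ?_)
      (prob_abs_hits_ge_le q Finset.univ Q (r := t / w) (by positivity) h2 t)
    simp only [Set.mem_ofPred_eq] at hx ⊢
    rw [hcard, ← ha]
    have e1 : t / w * (4 * a) = 4 * w := by
      field_simp
      linarith
    have e2 : t / (t / w) = w := by field_simp
    rw [e1, e2]
    linarith

theorem prob_not_typicalFresh_le (M : MDP S A H) (π : Fin K → Policy S A H) (D : Design S A H K)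
    {t : ℝ} (ht : 0 < t) (n : ℕ) :
    prob (indep fun h => indep fun _ : Fin n => pairLaw M π D h)
      {fresh | TypicalFresh M π D t fresh}ᶜ
      ≤ H * (Fintype.card S * Fintype.card A) * (2 * Real.exp (-t)) := by
  set E : Fin H × (S × A) → Set (Fin H → Fin n → Option (S × A)) := fun i =>
    {fresh | 5 * Real.sqrt (t * (n * D.smp M π i.1 i.2)) + 2 * t
      < |hits Finset.univ {o | o = some i.2} (fresh i.1) - n * D.smp M π i.1 i.2|} with hE
  have h1 : {fresh | TypicalFresh M π D t fresh}ᶜ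
      ⊆ {fresh | ∃ i ∈ (Finset.univ : Finset (Fin H × (S × A))), fresh ∈ E i} := by
    intro fresh hf
    by_contra hcon
    simp only [Finset.mem_univ, true_and, Set.mem_ofPred_eq, not_exists, hE, not_lt] at hcon
    exact hf fun h x => hcon (h, x)
  refine (prob_mono h1).trans ((prob_biUnion_le_card _ _ E (b := 2 * Real.exp (-t))
    fun i _ => ?_).trans (le_of_eq (by simp)))
  refine prob_indep_le _ i.1 _ fun fresh => ?_
  have := prob_abs_hits_gt_le (n := n) (pairLaw M π D i.1) {o | o = some i.2} ht
  rw [prob_pairLaw] at this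
  refine le_trans (le_of_eq ?_) this
  congr 1
  ext y
  simp [hE]

theorem estimate_eq (M : MDP S A H) (π : Fin K → Policy S A H) (D : Design S A H K)
    (θ : Params H) (ε : ℝ) (data : ∀ h, Fin (D.pool θ ε h) → Sample S A)
    (fresh : Fin H → Fin (D.final θ ε) → Option (S × A)) (k : Fin K) :
    estimate M π D θ ε data fresh k = ∑ h : Fin H, ∑ x,
      ides π D θ ε data k h h.isLt x / D.mu h x * M.r h x.1 x.2
        * (hits Finset.univ {o | o = some x} (fresh h) / D.final θ ε) := by
  rw [estimate, Finset.sum_comm, Finset.sum_div]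
  refine Finset.sum_congr rfl fun h _ => ?_
  have e := sum_mul_hits (Finset.univ : Finset (Fin (D.final θ ε))) (fun o : Option (S × A) => o)
    (fun o => o.elim 0 fun x => ides π D θ ε data k h h.isLt x / D.mu h x * M.r h x.1 x.2)
    (fresh h)
  rw [e, Fintype.sum_option]
  simp only [Option.elim_none, zero_mul, zero_add, Option.elim_some, Finset.sum_div, mul_div_assoc]

/-- The error of the final estimator at one step, caused by the final sample. -/
theorem sum_final_error_le [Nonempty S] (hA : D.Accurate M π acc) (hD : D.Valid)
    (hacc : 0 < acc) (hπ : ∀ k, (π k).IsDeterministic) {θ : Params H} {ε t τ : ℝ} (ht : 0 ≤ t)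
    (hτ : 0 < τ) (data : ∀ h, Fin (D.pool θ ε h) → Sample S A) {n : ℕ} (hn : 0 < n)
    {fresh : Fin H → Fin n → Option (S × A)} (hf : TypicalFresh M π D t fresh) (k : Fin K)
    (h : Fin H) :
    ∑ x, ides π D θ ε data k h h.isLt x / D.mu h x
        * |hits Finset.univ {o | o = some x} (fresh h) / n - D.smp M π h x|
      ≤ τ + (32 * Fintype.card S * t / τ + t / acc) * D.ratio k h / n := by
  have hn' : (0 : ℝ) < n := by exact_mod_cast hn
  have hs : (0 : ℝ) < Fintype.card S := by exact_mod_cast Fintype.card_pos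
  have hcard := hA.card_support_le hD hπ k h
  set s : ℝ := (Fintype.card S : ℝ) with hsdef
  have h1 : ∀ x, ides π D θ ε data k h h.isLt x / D.mu h x
        * |hits Finset.univ {o | o = some x} (fresh h) / n - D.smp M π h x|
      ≤ (if D.d k h x ≠ 0 then τ / s else 0)
        + (32 * s * t / τ + t / acc) / n * (D.d k h x ^ 2 / D.mu h x) := by
    intro x
    have hi := ides_mem hD π θ ε data k h h.isLt x
    by_cases hx : D.d k h x = 0
    · have : ides π D θ ε data k h h.isLt x = 0 := by
        rw [hx] at hi; exact le_antisymm (by simpa using hi.2) hi.1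
      simp [this, hx]
    rw [if_pos hx]
    have hmu := hD.mu_pos hx
    have hd : 0 < D.d k h x := lt_of_le_of_ne (hD.nonneg k h x) (Ne.symm hx)
    have hd5 := hA.le k h x hx
    have hsm := hA.smp_le_mu h x
    have hsm0 := D.smp_nonneg M π h x
    set w := Real.sqrt (t * (n * D.smp M π h x)) with hw
    have hww : w ^ 2 = t * (n * D.smp M π h x) := Real.sq_sqrt (by positivity)
    have hw0 : 0 ≤ w := Real.sqrt_nonneg _
    have h2 : |hits Finset.univ {o | o = some x} (fresh h) / n - D.smp M π h x|
        ≤ (5 * w + 2 * t) / n := by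
      have e : hits Finset.univ {o | o = some x} (fresh h) / n - D.smp M π h x
          = (hits Finset.univ {o | o = some x} (fresh h) - n * D.smp M π h x) / n := by
        field_simp
      rw [e, abs_div, abs_of_pos hn']
      gcongr
      exact hf h x
    have h3 : ides π D θ ε data k h h.isLt x / D.mu h x
        * |hits Finset.univ {o | o = some x} (fresh h) / n - D.smp M π h x|
        ≤ 2 * D.d k h x / D.mu h x * ((5 * w + 2 * t) / n) := by
      have := hi.1
      have := hi.2
      gcongr
    -- The square-root part of the fluctuation is treated by AM-GM over the at most S kept pairs;
    -- the linear part 2t is absorbed in `h7` using d ≥ 5·acc.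
    have h4 := le_add_mul_sq (v := 2 * D.d k h x / D.mu h x * (5 * w / n)) hτ hs
    have h5 : (2 * D.d k h x / D.mu h x * (5 * w / n)) ^ 2
        ≤ 125 * t / n * (D.d k h x ^ 2 / D.mu h x) := by
      have e : (2 * D.d k h x / D.mu h x * (5 * w / n)) ^ 2
          = 100 * D.d k h x ^ 2 / (D.mu h x ^ 2 * n ^ 2) * w ^ 2 := by
        field_simp; ring
      rw [e, hww]
      calc 100 * D.d k h x ^ 2 / (D.mu h x ^ 2 * n ^ 2) * (t * (n * D.smp M π h x))
          ≤ 100 * D.d k h x ^ 2 / (D.mu h x ^ 2 * n ^ 2) * (t * (n * (5 / 4 * D.mu h x))) := by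
            gcongr
        _ = _ := by field_simp; ring
    have h6 : s / (4 * τ) * (2 * D.d k h x / D.mu h x * (5 * w / n)) ^ 2
        ≤ 32 * s * t / τ / n * (D.d k h x ^ 2 / D.mu h x) := by
      calc _ ≤ s / (4 * τ) * (125 * t / n * (D.d k h x ^ 2 / D.mu h x)) := by gcongr
        _ = 125 / 4 * (s * t / τ / n * (D.d k h x ^ 2 / D.mu h x)) := by field_simp
        _ ≤ 32 * (s * t / τ / n * (D.d k h x ^ 2 / D.mu h x)) := by
            gcongr; norm_num
        _ = _ := by ring
    have h7 : 2 * D.d k h x / D.mu h x * (2 * t / n)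
        ≤ t / acc / n * (D.d k h x ^ 2 / D.mu h x) := by
      have e : t / acc / n * (D.d k h x ^ 2 / D.mu h x)
          = D.d k h x / acc * (t / n * (D.d k h x / D.mu h x)) := by field_simp
      have h8 : 5 ≤ D.d k h x / acc := by rw [le_div_iff₀ hacc]; linarith
      have h9 : 0 ≤ t / n * (D.d k h x / D.mu h x) := by positivity
      rw [e]
      calc 2 * D.d k h x / D.mu h x * (2 * t / n) = 4 * (t / n * (D.d k h x / D.mu h x)) := by ring
        _ ≤ D.d k h x / acc * (t / n * (D.d k h x / D.mu h x)) := by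
            gcongr; linarith
    refine h3.trans ?_
    have e1 : 2 * D.d k h x / D.mu h x * ((5 * w + 2 * t) / n)
        = 2 * D.d k h x / D.mu h x * (5 * w / n) + 2 * D.d k h x / D.mu h x * (2 * t / n) := by
      ring
    have e2 : (32 * s * t / τ + t / acc) / n * (D.d k h x ^ 2 / D.mu h x)
        = 32 * s * t / τ / n * (D.d k h x ^ 2 / D.mu h x)
          + t / acc / n * (D.d k h x ^ 2 / D.mu h x) := by ring
    rw [e1, e2]
    linarith
  refine (Finset.sum_le_sum fun x _ => h1 x).trans ?_
  rw [Finset.sum_add_distrib, ← Finset.mul_sum, ← Finset.sum_filter, Finset.sum_const,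
    nsmul_eq_mul]
  refine add_le_add ?_ (le_of_eq ?_)
  · calc _ ≤ s * (τ / s) := by gcongr
      _ = τ := by field_simp
  · rw [Design.ratio]; ring

/-- The final estimate is accurate on typical data. -/
theorem abs_estimate_sub_value_le [Nonempty S] (hA : D.Accurate M π acc) (hD : D.Valid)
    (hacc : 0 < acc) (hπ : ∀ k, (π k).IsDeterministic)
    (hS : Fintype.card S * (8 * acc) < 1) {θ : Params H} {ε t τ e : ℝ} (hε : 0 < ε) (ht : 0 ≤ t)
    (hτ : 0 < τ) (hH : 0 < H) (data : ∀ h, Fin (D.pool θ ε h) → Sample S A) (k : Fin K)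
    (he : ∀ m hm, ∑ x, |ides π D θ ε data k m hm x
      - target (sampleLaw M π D ⟨m, hm⟩) (D.d k ⟨m, hm⟩) (D.mu ⟨m, hm⟩) (π k ⟨m, hm⟩)
        (prevDensity π D θ ε data k m hm) x| ≤ e)
    {fresh : Fin H → Fin (D.final θ ε) → Option (S × A)} (hf : TypicalFresh M π D t fresh) :
    |estimate M π D θ ε data fresh k - M.value (π k)|
      ≤ H * (τ + (32 * Fintype.card S * t / τ + t / acc) * ε ^ 2 / (θ.Cfin * H ^ 2)
        + H * (5 / 4 * e + Fintype.card S * (8 * acc))) := by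
  have hH' : (0 : ℝ) < H := by exact_mod_cast hH
  have hCf := θ.Cfin_pos
  have hs : (0 : ℝ) < Fintype.card S := by exact_mod_cast Fintype.card_pos
  have he0 : 0 ≤ e := (Finset.sum_nonneg fun x _ => abs_nonneg _).trans (he 0 hH)
  have hratio : ∀ h, D.ratio k h ≤ ∑ h, ⨆ k, D.ratio k h := fun h =>
    (le_ciSup (f := fun k => D.ratio k h) (Set.finite_range _).bddAbove k).trans
      (Finset.single_le_sum (f := fun h => ⨆ k, D.ratio k h)
        (fun h _ => (hD.ratio_nonneg k h).trans
          (le_ciSup (f := fun k => D.ratio k h) (Set.finite_range _).bddAbove k))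
        (Finset.mem_univ h))
  have hn : ∀ h, θ.Cfin * (H ^ 2 / ε ^ 2 * D.ratio k h) ≤ D.final θ ε := by
    intro h
    refine le_trans ?_ (Nat.le_ceil _)
    have := hratio h
    gcongr
  have hρ := fun h => hA.ratio_pos hD hacc.le hπ hS k h
  have hn0 : 0 < D.final θ ε := by
    have h1 : 0 < θ.Cfin * (H ^ 2 / ε ^ 2 * D.ratio k ⟨0, hH⟩) := by
      have := hρ ⟨0, hH⟩
      positivity
    exact_mod_cast h1.trans_le (hn ⟨0, hH⟩)
  have hnr : (0 : ℝ) < D.final θ ε := by exact_mod_cast hn0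
  rw [estimate_eq, value_eq, ← Finset.sum_sub_distrib]
  have key : ∀ h : Fin H, |∑ x, ides π D θ ε data k h h.isLt x / D.mu h x * M.r h x.1 x.2
        * (hits Finset.univ {o | o = some x} (fresh h) / D.final θ ε)
        - ∑ x : S × A, occ M (π k) h x * M.r h x.1 x.2|
      ≤ τ + (32 * Fintype.card S * t / τ + t / acc) * ε ^ 2 / (θ.Cfin * H ^ 2)
        + H * (5 / 4 * e + Fintype.card S * (8 * acc)) := by
    intro h
    have h1 := sum_final_error_le hA hD hacc hπ ht hτ data hn0 hf k h
    have h2 := sum_abs_density_sub_occ_le hA hD hacc hπ hS θ ε data k he h h.isLt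
    have h3 : (32 * Fintype.card S * t / τ + t / acc) * D.ratio k h / D.final θ ε
        ≤ (32 * Fintype.card S * t / τ + t / acc) * ε ^ 2 / (θ.Cfin * H ^ 2) := by
      have hr := hρ h
      have hr' := hr.ne'
      calc _ ≤ (32 * Fintype.card S * t / τ + t / acc) * D.ratio k h
            / (θ.Cfin * (H ^ 2 / ε ^ 2 * D.ratio k h)) := by
            gcongr; exact hn h
        _ = _ := by field_simp
    have h4 : ((h : ℕ) + 1 : ℝ) * (5 / 4 * e + Fintype.card S * (8 * acc))
        ≤ H * (5 / 4 * e + Fintype.card S * (8 * acc)) := by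
      have : ((h : ℕ) + 1 : ℝ) ≤ H := by exact_mod_cast h.isLt
      gcongr
    have h5 : ∀ x : S × A, |ides π D θ ε data k h h.isLt x / D.mu h x * M.r h x.1 x.2
        * (hits Finset.univ {o | o = some x} (fresh h) / D.final θ ε)
        - occ M (π k) h x * M.r h x.1 x.2|
        ≤ ides π D θ ε data k h h.isLt x / D.mu h x
          * |hits Finset.univ {o | o = some x} (fresh h) / D.final θ ε - D.smp M π h x|
          + |D.smp M π h x * (ides π D θ ε data k h h.isLt x / D.mu h x) - occ M (π k) h x| := by
      intro x
      set a := ides π D θ ε data k h h.isLt x / D.mu h x with ha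
      have ha0 : 0 ≤ a := div_nonneg (ides_mem hD π θ ε data k h h.isLt x).1 (hD.mu_nonneg h x)
      obtain ⟨hr0, hr1⟩ := M.r_mem h x.1 x.2
      set f := hits Finset.univ {o | o = some x} (fresh h) / D.final θ ε
      have e1 : a * M.r h x.1 x.2 * f - occ M (π k) h x * M.r h x.1 x.2
          = M.r h x.1 x.2 * (a * (f - D.smp M π h x) + (D.smp M π h x * a - occ M (π k) h x)) := by
        ring
      rw [e1, abs_mul, abs_of_nonneg hr0]
      refine (mul_le_of_le_one_left (abs_nonneg _) hr1).trans ((abs_add_le _ _).trans ?_)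
      rw [abs_mul, abs_of_nonneg ha0]
    rw [← Finset.sum_sub_distrib]
    refine (Finset.abs_sum_le_sum_abs _ _).trans ((Finset.sum_le_sum fun x _ => h5 x).trans ?_)
    rw [Finset.sum_add_distrib]
    linarith
  refine (Finset.abs_sum_le_sum_abs _ _).trans ((Finset.sum_le_sum fun h _ => key h).trans ?_)
  rw [Finset.sum_const, Finset.card_univ, Fintype.card_fin, nsmul_eq_mul]

end Typical

/-! ### The choice of the tuning constants -/

section Tuning

/-- The tuning constants for `s` states and the logarithmic factor `t`. -/
def tuning {H : ℕ} (hH : 0 < H) {s ε t : ℝ} (hs : 0 < s) (hε : 0 < ε) (ht : 0 < t) :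
    Params H where
  -- The confidence is s·t rather than t: this phase needs a union over the policies.
  n₀ := ⌈128 * (s * t) / (ε / (64 * s * (H : ℝ) ^ 2))⌉₊
  -- Ignored pairs of one policy then carry mass at most 8·s·acc = ε/(8H²) at each step.
  acc := ε / (64 * s * (H : ℝ) ^ 2)
  -- Of the t³, two factors come from p² and one from the confidence T = s·t of the deviations.
  C _ := 10 ^ 10 * s * t ^ 3
  -- The factor H pays for the tolerance ε/(8H) at each step.
  Cfin := 1280 * s * t * H
  -- The maximum only keeps the unused step size at i = 0 positive.
  η _ i := 80 * t / ((max i 1 : ℕ) : ℝ)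
  n₀_pos := Nat.ceil_pos.2 (by have : (0 : ℝ) < H := by exact_mod_cast hH
                               positivity)
  acc_pos := by have : (0 : ℝ) < H := by exact_mod_cast hH
                positivity
  C_pos _ := by positivity
  Cfin_pos := by have : (0 : ℝ) < H := by exact_mod_cast hH
                 positivity
  η_pos _ i := by have : (0 : ℝ) < ((max i 1 : ℕ) : ℝ) := by
                    exact_mod_cast lt_of_lt_of_le one_pos (le_max_right i 1)
                  positivity

variable {S A H K : ℕ} {ε δ t : ℝ} (hH : 0 < H) (hs : (0 : ℝ) < S) (hε : 0 < ε) (ht : 0 < t)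

theorem ratioPrev_le {D : Design (Fin S) (Fin A) H K} (hD : D.Valid) (hSA : (1 : ℝ) ≤ S * A)
    (k : Fin K) (h : Fin H) : D.ratioPrev k h ≤ S * A := by
  obtain ⟨m, hm⟩ := h
  cases m with
  | zero => rw [ratioPrev_zero]; exact hSA
  | succ m => rw [ratioPrev_succ]; simpa using hD.ratio_le k ⟨m, Nat.lt_of_succ_lt hm⟩

theorem pool_le {D : Design (Fin S) (Fin A) H K} (hD : D.Valid) (hSA : (1 : ℝ) ≤ S * A)
    (h : Fin H) :
    (D.pool (tuning hH hs hε ht) ε h : ℝ)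
      ≤ 2 * 10 ^ 10 * S * t ^ 3 * H ^ 4 * (S * A) / ε ^ 2 + 1 := by
  have hH' : (0 : ℝ) < H := by exact_mod_cast hH
  have h0 : (0 : ℝ) ≤ 2 * 10 ^ 10 * S * t ^ 3 * H ^ 4 * (S * A) / ε ^ 2 := by positivity
  have h1 : D.pool (tuning hH hs hε ht) ε h
      ≤ ⌈2 * 10 ^ 10 * (S : ℝ) * t ^ 3 * H ^ 4 * (S * A) / ε ^ 2⌉₊ := by
    refine Finset.sup_le fun k _ => Nat.ceil_mono ?_
    have h2 : D.ratio k h ≤ S * A := by simpa using hD.ratio_le k h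
    have h3 := ratioPrev_le hD hSA k h
    calc (10 ^ 10 * (S : ℝ) * t ^ 3) * ((H : ℝ) ^ 4 / ε ^ 2 * (D.ratio k h + D.ratioPrev k h))
        ≤ (10 ^ 10 * (S : ℝ) * t ^ 3) * ((H : ℝ) ^ 4 / ε ^ 2 * (S * A + S * A)) := by gcongr
      _ = _ := by ring
  calc (D.pool (tuning hH hs hε ht) ε h : ℝ)
      ≤ ⌈2 * 10 ^ 10 * (S : ℝ) * t ^ 3 * H ^ 4 * (S * A) / ε ^ 2⌉₊ := by exact_mod_cast h1
    _ ≤ _ := (Nat.ceil_lt_add_one h0).le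

theorem final_le [Nonempty (Fin K)] {D : Design (Fin S) (Fin A) H K} (hD : D.Valid) :
    (D.final (tuning hH hs hε ht) ε : ℝ)
      ≤ 1280 * S * t * H ^ 4 * (S * A) / ε ^ 2 + 1 := by
  have hH' : (0 : ℝ) < H := by exact_mod_cast hH
  have h0 : (0 : ℝ) ≤ 1280 * S * t * H ^ 4 * (S * A) / ε ^ 2 := by positivity
  have h1 : D.final (tuning hH hs hε ht) ε
      ≤ ⌈1280 * (S : ℝ) * t * H ^ 4 * (S * A) / ε ^ 2⌉₊ := by
    refine Nat.ceil_mono ?_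
    have h2 : ∑ h, ⨆ k, D.ratio k h ≤ ∑ _h : Fin H, (S * A : ℝ) :=
      Finset.sum_le_sum fun h _ => ciSup_le fun k => by simpa using hD.ratio_le k h
    rw [Finset.sum_const, Finset.card_univ, Fintype.card_fin, nsmul_eq_mul] at h2
    calc (1280 * (S : ℝ) * t * H) * ((H : ℝ) ^ 2 / ε ^ 2 * ∑ h, ⨆ k, D.ratio k h)
        ≤ (1280 * (S : ℝ) * t * H) * ((H : ℝ) ^ 2 / ε ^ 2 * (H * (S * A))) := by gcongr
      _ = _ := by ring
  calc (D.final (tuning hH hs hε ht) ε : ℝ)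
      ≤ ⌈1280 * (S : ℝ) * t * H ^ 4 * (S * A) / ε ^ 2⌉₊ := by exact_mod_cast h1
    _ ≤ _ := (Nat.ceil_lt_add_one h0).le

/-- The number of episodes in terms of the logarithmic factor. -/
theorem episodes_le [Nonempty (Fin K)] {D : Design (Fin S) (Fin A) H K} (hD : D.Valid)
    (hSA : (1 : ℝ) ≤ S * A) :
    (D.episodes (tuning hH hs hε ht) ε : ℝ)
      ≤ K * (8192 * S ^ 2 * H ^ 2 * t / ε + 1)
        + H * (2 * (2 * 10 ^ 10 * S * t ^ 3 * H ^ 4 * (S * A) / ε ^ 2 + 1))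
        + H * (1280 * S * t * H ^ 4 * (S * A) / ε ^ 2 + 1) := by
  have hH' : (0 : ℝ) < H := by exact_mod_cast hH
  have h1 : ((tuning hH hs hε ht).n₀ : ℝ) ≤ 8192 * S ^ 2 * H ^ 2 * t / ε + 1 := by
    have h0 : (0 : ℝ) ≤ 128 * (S * t) / (ε / (64 * S * (H : ℝ) ^ 2)) := by positivity
    refine (Nat.ceil_lt_add_one h0).le.trans (le_of_eq ?_)
    field_simp
    ring
  have h2 : ∑ h, 2 * (D.pool (tuning hH hs hε ht) ε h : ℝ)
      ≤ ∑ _h : Fin H, 2 * (2 * 10 ^ 10 * S * t ^ 3 * H ^ 4 * (S * A) / ε ^ 2 + 1) :=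
    Finset.sum_le_sum fun h _ =>
      mul_le_mul_of_nonneg_left (pool_le hH hs hε ht hD hSA h) (by norm_num)
  rw [Finset.sum_const, Finset.card_univ, Fintype.card_fin, nsmul_eq_mul] at h2
  have h3 := final_le hH hs hε ht hD
  rw [Design.episodes]
  push_cast
  gcongr

/-- The probability that some estimate is inaccurate is at most the sum of the probabilities that
the three kinds of samples are not typical. -/
theorem le_toOuterMeasure_caesar (M : MDP (Fin S) (Fin A) H)
    (π : Fin K → Policy (Fin S) (Fin A) H)
    (solve : (Fin K → Fin S × Fin A → ℝ) → PMF (Fin K)) (hεH : ε ≤ H)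
    (hπ : ∀ k, (π k).IsDeterministic) (hsolve : IsSolver solve) (ht1 : 1 ≤ t)
    (hexp : Real.exp (-(8 * t)) ≤ ε / (64 * H ^ 2)) (hA : (1 : ℝ) ≤ A) (hδ : 0 < δ)
    (h₁ : (K * (H * (S * A)) : ℝ) * (2 * Real.exp (-(S * t))) ≤ δ / 3)
    (h₂ : H * ((2 * 10 ^ 10 * S * t ^ 3 * H ^ 4 * (S * A) / ε ^ 2 + 1)
      * ((2 * (S * A) + 1) * Real.exp (-t) + K * Real.exp (-(S * t)))) ≤ δ / 3)
    (h₃ : H * (S * A) * (2 * Real.exp (-t)) ≤ δ / 3) :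
    1 - ENNReal.ofReal δ ≤ (caesar M π (tuning hH hs hε ht) ε solve).toOuterMeasure
      {o | ∀ k, |o.1 k - M.value (π k)| ≤ ε} := by
  have hH' : (1 : ℝ) ≤ H := by exact_mod_cast hH
  have hS1 : (1 : ℝ) ≤ S := by exact_mod_cast (Nat.cast_pos.1 hs : 0 < S)
  haveI : Nonempty (Fin S) := ⟨⟨0, Nat.cast_pos.1 hs⟩⟩
  set θ := tuning hH hs hε ht with hθ
  have hδ3 : 0 ≤ δ / 3 := by positivity
  have hsplit : δ = δ / 3 + (δ / 3 + δ / 3) := by ring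
  set e : ℝ := ε / (8 * H ^ 2) with he
  have he0 : 0 < e := by positivity
  have hacc : θ.acc = ε / (64 * S * (H : ℝ) ^ 2) := rfl
  have hacc' : θ.acc = e / (8 * S) := by rw [hacc, he]; field_simp; norm_num
  have hacc0 : 0 < θ.acc := θ.acc_pos
  have hSacc : S * (8 * θ.acc) = e := by rw [hacc']; field_simp
  have he8 : e ≤ 1 / 8 := by
    rw [he, div_le_div_iff₀ (by positivity) (by norm_num)]
    nlinarith
  have hSlt : (Fintype.card (Fin S) : ℝ) * (8 * θ.acc) < 1 := by
    rw [Fintype.card_fin, hSacc]; linarith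
  have hSA : (1 : ℝ) ≤ S * A := by nlinarith
  set p : ℝ := 80 * t with hp
  -- Chosen so that the truncation term 33·p·b₀ equals e/4. With τ = e/12 below, the error of one
  -- step splits into four terms of at most e/4.
  set b₀ : ℝ := e / (132 * p) with hb₀
  have hp1 : 1 ≤ p := by linarith
  have hb₀0 : 0 < b₀ := by positivity
  have hb₀1 : b₀ ≤ 1 := by
    rw [hb₀, div_le_one (by positivity)]; linarith
  have hη : ∀ h (i : ℕ), θ.η h (i + 1) = p / ((i + 1 : ℕ) : ℝ) := by
    intro h i
    show 80 * t / ((max (i + 1) 1 : ℕ) : ℝ) = _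
    rw [max_eq_left (by omega)]
  have hC : ∀ h, θ.C h = 10 ^ 10 * S * t ^ 3 := fun h => rfl
  unfold caesar
  rw [hsplit]
  refine one_sub_le_toOuterMeasure_bind (G := {data | (design θ solve data).Accurate M π θ.acc})
    hδ3 (add_nonneg hδ3 hδ3) ?_ fun data₀ hacc₀ => ?_
  · refine (prob_not_accurate_le M π θ solve (t := S * t) ?_).trans ?_
    · have hn : 128 * (S * t) / θ.acc ≤ θ.n₀ := Nat.le_ceil _
      have hn0 : (0 : ℝ) < θ.n₀ := by exact_mod_cast θ.n₀_pos
      rw [div_le_iff₀ hacc0] at hn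
      rw [div_le_iff₀ hn0]
      linarith
    · simpa using h₁
  have hD : (design θ solve data₀).Valid := design_valid hsolve data₀
  set D := design θ solve data₀ with hDdef
  have hAcc : D.Accurate M π θ.acc := hacc₀
  refine one_sub_le_toOuterMeasure_bind
    (G := {data | TypicalData M π D θ ε p t (S * t) (e / 12) b₀ data}) hδ3 hδ3 ?_
    fun data hdata => ?_
  · refine (prob_not_typicalData_le hAcc hD hacc0 hπ hSlt θ ε (by linarith) (by positivity)
      hb₀0 fun h => pool_le hH hs hε ht hD hSA h).trans ?_
    simpa using h₂
  rw [PMF.toOuterMeasure_map_apply]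
  refine one_sub_le_toOuterMeasure hδ3 (le_trans (prob_mono ?_)
    ((prob_not_typicalFresh_le M π D (t := t) ht (D.final θ ε)).trans (by simpa using h₃)))
  intro fresh hfresh hf
  refine hfresh fun k => ?_
  have hstage : ∀ m hm, ∑ x, |ides π D θ ε data k m hm x
      - target (sampleLaw M π D ⟨m, hm⟩) (D.d k ⟨m, hm⟩) (D.mu ⟨m, hm⟩) (π k ⟨m, hm⟩)
        (prevDensity π D θ ε data k m hm) x| ≤ e := by
    intro m hm
    refine (TypicalData.sum_abs_ides_sub_target_le hAcc hD hacc0 hπ hSlt hε hp1 ht.le le_rfl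
      (by positivity) (by positivity) hb₀0 hb₀1 hη hC (by positivity) hH hdata k m hm).trans ?_
    rw [Fintype.card_fin]
    have k₁ : 2 * Real.exp (-(p / 10)) ≤ e / 4 := by
      have e1 : p / 10 = 8 * t := by rw [hp]; ring
      have e2 : e / 4 = 2 * (ε / (64 * H ^ 2)) := by rw [he]; field_simp; norm_num
      rw [e1, e2]
      linarith
    have k₂ : 33 * p * b₀ = e / 4 := by rw [hb₀]; field_simp; norm_num
    have k₃ : 2 * (21 * S * p ^ 2 / (e / 12) + 32 * p * t / (5 * θ.acc) + 16 * p * (S * t) / b₀)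
        * ε ^ 2 / (10 ^ 10 * S * t ^ 3 * H ^ 4) ≤ e / 4 := by
      have e1 : ε = 8 * H ^ 2 * e := by rw [he]; field_simp
      have e2 : 2 * (21 * S * p ^ 2 / (e / 12) + 32 * p * t / (5 * θ.acc)
          + 16 * p * (S * t) / b₀) * ε ^ 2 / (10 ^ 10 * S * t ^ 3 * H ^ 4)
          = e * (128 * (252 * 6400 + 4096 + 2112 * 6400 * t) / (10 ^ 10 * t)) := by
        rw [hb₀, hacc', hp, e1]
        field_simp
        ring
      rw [e2]
      have e3 : 128 * (252 * 6400 + 4096 + 2112 * 6400 * t) / (10 ^ 10 * t) ≤ 1 / 4 := by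
        rw [div_le_div_iff₀ (by positivity) (by norm_num)]
        linarith
      calc _ ≤ e * (1 / 4) := by gcongr
        _ = e / 4 := by ring
    linarith
  refine (abs_estimate_sub_value_le hAcc hD hacc0 hπ hSlt hε ht.le (τ := ε / (8 * H))
    (by positivity) hH data k hstage hf).trans ?_
  rw [Fintype.card_fin, hSacc]
  have k₁ : (32 * S * t / (ε / (8 * H)) + t / θ.acc) * ε ^ 2 / (θ.Cfin * H ^ 2)
      ≤ ε / (4 * H) := by
    have e1 : (32 * S * t / (ε / (8 * H)) + t / θ.acc) * ε ^ 2 / (θ.Cfin * H ^ 2)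
        = ε / H * ((256 + 64 * H) / (1280 * H)) := by
      show (32 * S * t / (ε / (8 * H)) + t / (ε / (64 * S * (H : ℝ) ^ 2))) * ε ^ 2
        / ((1280 * S * t * H) * H ^ 2) = _
      field_simp
      ring
    have e2 : ((256 + 64 * H) / (1280 * H) : ℝ) ≤ 1 / 4 := by
      rw [div_le_div_iff₀ (by positivity) (by norm_num)]
      linarith
    rw [e1]
    calc _ ≤ ε / H * (1 / 4) := by gcongr
      _ = _ := by field_simp
  have e1 : ε = 8 * H ^ 2 * e := by rw [he]; field_simp
  -- The total is ε/8 + ε/4 + 9ε/32, which is less than ε.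
  calc H * (ε / (8 * H) + (32 * S * t / (ε / (8 * H)) + t / θ.acc) * ε ^ 2 / (θ.Cfin * H ^ 2)
        + H * (5 / 4 * e + e))
      ≤ H * (ε / (8 * H) + ε / (4 * H) + H * (5 / 4 * e + e)) := by gcongr
    _ = ε / 8 + ε / 4 + 9 / 4 * (H ^ 2 * e) := by field_simp; ring
    _ ≤ ε := by linarith

end Tuning

/-! ### Choice of the confidence parameter -/

section Confidence

variable {S A H K ε δ : ℝ}

theorem two_le_instanceSize (hS : 1 ≤ S) (hA : 1 ≤ A) (hε : 0 < ε) (hεH : ε ≤ H)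
    (hδ : 0 < δ) (hδ1 : δ < 1) : 2 ≤ 2 * S * A * H / (ε * δ) := by
  rw [le_div_iff₀ (by positivity)]
  have h1 : 1 ≤ S * A := one_le_mul_of_one_le_of_one_le hS hA
  have h2 : ε * δ ≤ H := by nlinarith
  nlinarith

theorem half_le_log_instanceSize (hS : 1 ≤ S) (hA : 1 ≤ A) (hε : 0 < ε) (hεH : ε ≤ H)
    (hδ : 0 < δ) (hδ1 : δ < 1) : 1 / 2 ≤ Real.log (2 * S * A * H / (ε * δ)) := by
  have := Real.log_le_log (by norm_num) (two_le_instanceSize hS hA hε hεH hδ hδ1)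
  have := Real.log_two_gt_d9
  linarith

/-- With `E = exp (H L)` all the parameters of an instance are at most `E`. -/
theorem instance_bounds (hS : 1 ≤ S) (hA : 1 ≤ A) (hH : 1 ≤ H) (hε : 0 < ε) (hεH : ε ≤ H)
    (hδ : 0 < δ) (hδ1 : δ < 1) {E : ℝ}
    (hE : E = Real.exp (H * Real.log (2 * S * A * H / (ε * δ)))) :
    2 ≤ E ∧ S ≤ E ∧ A ≤ E ∧ H ≤ E ∧ 1 / ε ≤ E ∧ 1 / δ ≤ E := by
  have hY := two_le_instanceSize hS hA hε hεH hδ hδ1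
  have hL := half_le_log_instanceSize hS hA hε hεH hδ hδ1
  have hSA : 1 ≤ S * A := one_le_mul_of_one_le_of_one_le hS hA
  have hεδ : ε * δ ≤ H := by nlinarith
  have hYE : 2 * S * A * H / (ε * δ) ≤ E := by
    rw [hE]
    calc 2 * S * A * H / (ε * δ) = Real.exp (Real.log (2 * S * A * H / (ε * δ))) :=
          (Real.exp_log (by linarith)).symm
      _ ≤ _ := Real.exp_le_exp.2 (by nlinarith)
  refine ⟨hY.trans hYE, ?_, ?_, ?_, ?_, ?_⟩
  · refine le_trans ?_ hYE
    rw [le_div_iff₀ (by positivity)]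
    have : S * (ε * δ) ≤ S * H := by gcongr
    have : S * H * 1 ≤ S * H * (2 * A) := by gcongr; linarith
    linarith
  · refine le_trans ?_ hYE
    rw [le_div_iff₀ (by positivity)]
    have : A * (ε * δ) ≤ A * H := by gcongr
    have : A * H * 1 ≤ A * H * (2 * S) := by gcongr; linarith
    linarith
  -- For ε close to H the logarithm does not control H. Only L ≥ log 2 is available, and 2^H
  -- dominates H; this is why E is exp(H·L) and not exp(L).
  · have h1 := Real.log_two_gt_d9
    have h2 := Real.log_le_log (by norm_num) hY
    have h3 : H * Real.log 2 ≤ H * Real.log (2 * S * A * H / (ε * δ)) := by gcongr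
    have h4 := Real.quadratic_le_exp_of_nonneg (x := H * Real.log 2) (by positivity)
    have h5 : Real.exp (H * Real.log 2) ≤ E := by rw [hE]; exact Real.exp_le_exp.2 h3
    have h6 : H * 0.69 ≤ H * Real.log 2 := by gcongr; linarith
    nlinarith [sq_nonneg (H - 1)]
  · refine le_trans ?_ hYE
    rw [div_le_div_iff₀ hε (by positivity)]
    have : 1 * ε ≤ S * A * H * ε := by
      gcongr
      exact one_le_mul_of_one_le_of_one_le hSA hH
    nlinarith
  · refine le_trans ?_ hYE
    rw [div_le_div_iff₀ hδ (by positivity)]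
    have : 1 * H ≤ S * A * H := by gcongr
    nlinarith

/-- Every polynomial prefactor is at most a power of E = exp(H·L), while exp(-t) is E to the power
-200. The number K, at most E^S, only meets exp(-S·t). -/
theorem confidence_bounds (hS : 1 ≤ S) (hA : 1 ≤ A) (hH : 1 ≤ H) (hε : 0 < ε) (hεH : ε ≤ H)
    (hδ : 0 < δ) (hδ1 : δ < 1) (hK : 0 ≤ K) {L t : ℝ}
    (hL : L = Real.log (2 * S * A * H / (ε * δ))) (hKL : K ≤ Real.exp (S * (H * L)))
    (ht : t = 200 * (H * L)) :
    Real.exp (-(8 * t)) ≤ ε / (64 * H ^ 2) ∧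
    K * (H * (S * A)) * (2 * Real.exp (-(S * t))) ≤ δ / 3 ∧
    H * ((2 * 10 ^ 10 * S * t ^ 3 * H ^ 4 * (S * A) / ε ^ 2 + 1)
      * ((2 * (S * A) + 1) * Real.exp (-t) + K * Real.exp (-(S * t)))) ≤ δ / 3 ∧
    H * (S * A) * (2 * Real.exp (-t)) ≤ δ / 3 := by
  have hL2 : 1 / 2 ≤ L := hL ▸ half_le_log_instanceSize hS hA hε hεH hδ hδ1
  obtain ⟨E, hE⟩ : ∃ E, E = Real.exp (H * L) := ⟨_, rfl⟩
  obtain ⟨h2, hSE, hAE, hHE, hεE, hδE⟩ := instance_bounds hS hA hH hε hεH hδ hδ1 (hL ▸ hE)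
  have hx : 1 / 2 ≤ H * L := by nlinarith
  have hxE : H * L ≤ E := by
    rw [hE]
    linarith [Real.add_one_le_exp (H * L)]
  -- One of the 200 factors is reserved to absorb K ≤ exp(S·H·L), so exponent 199 serves both tails.
  obtain ⟨q, hq⟩ : ∃ q, q = Real.exp (-(199 * (H * L))) := ⟨_, rfl⟩
  have hq0 : 0 < q := hq ▸ Real.exp_pos _
  have hE0 : 0 < E := by linarith
  have hE1 : 1 ≤ E := by linarith
  have hqE : E ^ 199 * q = 1 := by
    rw [hE, hq, ← Real.exp_nat_mul, ← Real.exp_add]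
    norm_num
  have hpow : ∀ n ≤ 190, E ^ n * q ≤ E⁻¹ ^ 9 := by
    intro n hn
    have e1 : E ^ 190 * q = E⁻¹ ^ 9 := by
      rw [inv_pow]
      refine eq_inv_of_mul_eq_one_left ?_
      rw [← hqE]
      ring
    rw [← e1]
    gcongr
  have hEi : E⁻¹ ≤ 1 / 2 := by
    rw [inv_le_comm₀ hE0 (by norm_num)]
    linarith
  have hEi0 : 0 < E⁻¹ := by positivity
  have hEδ : E⁻¹ ≤ δ := by
    rw [inv_le_comm₀ hE0 hδ, ← one_div]
    exact hδE
  have hEε : E⁻¹ ≤ ε := by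
    rw [inv_le_comm₀ hE0 hε, ← one_div]
    exact hεE
  have key : ∀ n ≤ 190, E ^ n * q ≤ δ / 3 := by
    intro n hn
    refine (hpow n hn).trans ?_
    have : E⁻¹ ^ 9 ≤ E⁻¹ * (1 / 2) ^ 8 := by
      calc E⁻¹ ^ 9 = E⁻¹ * E⁻¹ ^ 8 := by ring
        _ ≤ _ := by gcongr
    linarith
  have hexpt : Real.exp (-t) ≤ q := by
    rw [hq, ht]
    exact Real.exp_le_exp.2 (by linarith)
  have hKq : K * Real.exp (-(S * t)) ≤ q := by
    calc K * Real.exp (-(S * t)) ≤ Real.exp (S * (H * L)) * Real.exp (-(S * t)) := by gcongr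
      _ = Real.exp (-(199 * (S * (H * L)))) := by
        rw [← Real.exp_add, ht]
        congr 1
        ring
      _ ≤ q := by
        rw [hq]
        refine Real.exp_le_exp.2 ?_
        nlinarith
  refine ⟨?_, ?_, ?_, ?_⟩
  · have h8 : Real.exp (-(8 * t)) ≤ E⁻¹ ^ 9 := by
      rw [hE, ← Real.exp_neg, ← Real.exp_nat_mul]
      refine Real.exp_le_exp.2 ?_
      rw [ht]
      push_cast
      linarith
    rw [le_div_iff₀ (by positivity)]
    calc Real.exp (-(8 * t)) * (64 * H ^ 2) ≤ E⁻¹ ^ 9 * (64 * E ^ 2) := by gcongr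
      _ = E⁻¹ * (64 * E⁻¹ ^ 6) := by field_simp
      _ ≤ E⁻¹ * (64 * (1 / 2) ^ 6) := by gcongr
      _ ≤ ε := by linarith
  · calc K * (H * (S * A)) * (2 * Real.exp (-(S * t)))
        = H * (S * A) * 2 * (K * Real.exp (-(S * t))) := by ring
      _ ≤ E * (E * E) * E * q := by gcongr
      _ = E ^ 4 * q := by ring
      _ ≤ δ / 3 := key 4 (by norm_num)
  -- 71 = 58 + 12 + 1: the numerical constant 16·10^16 is below 2^58 ≤ E^58, the parameters have
  -- total degree 12, and one more factor E ≥ 2 absorbs the added 1.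
  · have hbig : 2 * 10 ^ 10 * S * t ^ 3 * H ^ 4 * (S * A) / ε ^ 2 + 1 ≤ E ^ 71 := by
      have e0 : (200 * (H * L)) ≤ 200 * E := by linarith
      have e1 : 2 * 10 ^ 10 * S * t ^ 3 * H ^ 4 * (S * A) / ε ^ 2
          = 2 * 10 ^ 10 * S * (200 * (H * L)) ^ 3 * H ^ 4 * (S * A) * (1 / ε) ^ 2 := by
        rw [ht]
        field_simp
      have e2 : 2 * 10 ^ 10 * S * (200 * (H * L)) ^ 3 * H ^ 4 * (S * A) * (1 / ε) ^ 2
          ≤ 2 * 10 ^ 10 * E * (200 * E) ^ 3 * E ^ 4 * (E * E) * E ^ 2 := by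
        gcongr
      have e3 : (2 : ℝ) ^ 58 ≤ E ^ 58 := by gcongr
      have e4 : (16 * 10 ^ 16 : ℝ) * E ^ 12 ≤ E ^ 58 * E ^ 12 := by
        gcongr
        exact le_trans (by norm_num) e3
      have e5 : 1 ≤ E ^ 70 := one_le_pow₀ hE1
      have e6 : 2 * E ^ 70 ≤ E * E ^ 70 := by gcongr
      calc _ ≤ E ^ 58 * E ^ 12 + 1 := by
            rw [e1]
            nlinarith
        _ = E ^ 70 + 1 := by ring
        _ ≤ E * E ^ 70 := by linarith
        _ = E ^ 71 := by ring
    have hsmall : (2 * (S * A) + 1) * Real.exp (-t) + K * Real.exp (-(S * t)) ≤ E ^ 4 * q := by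
      calc (2 * (S * A) + 1) * Real.exp (-t) + K * Real.exp (-(S * t))
          ≤ (2 * (E * E) + 1) * q + q := by gcongr
        _ = (2 * E ^ 2 + 2) * q := by ring
        _ ≤ E ^ 4 * q := by
          gcongr
          nlinarith [sq_nonneg (E ^ 2 - 2)]
    have hL0 : 0 < L := by linarith
    have ht0 : 0 < t := by
      rw [ht]
      positivity
    calc H * ((2 * 10 ^ 10 * S * t ^ 3 * H ^ 4 * (S * A) / ε ^ 2 + 1)
        * ((2 * (S * A) + 1) * Real.exp (-t) + K * Real.exp (-(S * t))))
        ≤ E * (E ^ 71 * (E ^ 4 * q)) := by gcongr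
      _ = E ^ 76 * q := by ring
      _ ≤ δ / 3 := key 76 (by norm_num)
  · calc H * (S * A) * (2 * Real.exp (-t)) ≤ E * (E * E) * (E * q) := by gcongr
      _ = E ^ 4 * q := by ring
      _ ≤ δ / 3 := key 4 (by norm_num)

/-- The exponent 8 comes from the factors H, H⁴ and, through t³, H³. Lower powers of L are raised to
the eighth using 2L ≥ 1, and the rounding terms K + 3H fit into the second summand because H/ε ≥ 1.
-/
theorem sample_size_le (hS : 1 ≤ S) (hA : 1 ≤ A) (hH : 1 ≤ H) (hK : 1 ≤ K) (hε : 0 < ε)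
    (hεH : ε ≤ H) {L t : ℝ} (hL : 1 / 2 ≤ L) (ht : t = 200 * (H * L)) :
    K * (8192 * S ^ 2 * H ^ 2 * t / ε + 1)
      + H * (2 * (2 * 10 ^ 10 * S * t ^ 3 * H ^ 4 * (S * A) / ε ^ 2 + 1))
      + H * (1280 * S * t * H ^ 4 * (S * A) / ε ^ 2 + 1)
      ≤ 10 ^ 20 * H ^ 8 * S ^ 2 * A / ε ^ 2 * L ^ 8
        + 10 ^ 20 * K * (S * A * H) ^ 8 / ε * L ^ 8 := by
  have hL1 : 1 ≤ 2 * L := by linarith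
  have l8 : 1 ≤ 256 * L ^ 8 := by
    have := one_le_pow₀ (n := 8) hL1
    rw [mul_pow] at this
    linarith
  have l7 : L ≤ 128 * L ^ 8 := by
    have := mul_le_mul_of_nonneg_left (one_le_pow₀ (n := 7) hL1) (by linarith : 0 ≤ L)
    rw [mul_pow] at this
    linarith
  have l5 : L ^ 3 ≤ 32 * L ^ 8 := by
    have := mul_le_mul_of_nonneg_left (one_le_pow₀ (n := 5) hL1) (by positivity : 0 ≤ L ^ 3)
    rw [mul_pow] at this
    linarith
  have hX : 0 ≤ H ^ 8 * S ^ 2 * A / ε ^ 2 := by positivity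
  have hY : 0 ≤ K * (S * A * H) ^ 8 / ε := by positivity
  have a1 : H * (2 * (2 * 10 ^ 10 * S * t ^ 3 * H ^ 4 * (S * A) / ε ^ 2))
      = 32 * 10 ^ 16 * (H ^ 8 * S ^ 2 * A / ε ^ 2) * L ^ 3 := by
    rw [ht]
    ring
  have a2 : H * (1280 * S * t * H ^ 4 * (S * A) / ε ^ 2)
      ≤ 256000 * (H ^ 8 * S ^ 2 * A / ε ^ 2) * L := by
    have e1 : H * (1280 * S * t * H ^ 4 * (S * A) / ε ^ 2)
        = 256000 * (H ^ 6 * S ^ 2 * A / ε ^ 2) * L := by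
      rw [ht]
      ring
    rw [e1]
    gcongr
    norm_num
  have hpw : S ^ 2 * H ^ 3 ≤ (S * A * H) ^ 8 := by
    have e1 : S ^ 2 ≤ S ^ 8 := pow_le_pow_right₀ hS (by norm_num)
    have e2 : H ^ 3 ≤ H ^ 8 := pow_le_pow_right₀ hH (by norm_num)
    have e3 : 1 ≤ A ^ 8 := one_le_pow₀ hA
    calc S ^ 2 * H ^ 3 ≤ S ^ 8 * H ^ 8 := by gcongr
      _ = S ^ 8 * 1 * H ^ 8 := by ring
      _ ≤ S ^ 8 * A ^ 8 * H ^ 8 := by gcongr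
      _ = _ := by ring
  have a3 : K * (8192 * S ^ 2 * H ^ 2 * t / ε) ≤ 1638400 * (K * (S * A * H) ^ 8 / ε) * L := by
    have e1 : K * (8192 * S ^ 2 * H ^ 2 * t / ε)
        = 1638400 * (K * (S ^ 2 * H ^ 3) / ε) * L := by
      rw [ht]
      ring
    rw [e1]
    gcongr
  have a4 : K + 3 * H ≤ 4 * (K * (S * A * H) ^ 8 / ε) := by
    have e1 : 1 ≤ H / ε := (one_le_div hε).2 hεH
    have e2 : H ^ 2 ≤ (S * A * H) ^ 8 := by
      refine le_trans ?_ hpw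
      calc H ^ 2 ≤ H ^ 3 := pow_le_pow_right₀ hH (by norm_num)
        _ = 1 * H ^ 3 := by ring
        _ ≤ S ^ 2 * H ^ 3 := by
          gcongr
          exact one_le_pow₀ hS
    have e3 : K + 3 * H ≤ 4 * (K * H) := by nlinarith
    calc K + 3 * H ≤ 4 * (K * H) * 1 := by linarith
      _ ≤ 4 * (K * H) * (H / ε) := by gcongr
      _ = 4 * (K * H ^ 2 / ε) := by ring
      _ ≤ _ := by gcongr
  have b1 := mul_le_mul_of_nonneg_left l5 hX
  have b2 := mul_le_mul_of_nonneg_left l7 hX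
  have b3 := mul_le_mul_of_nonneg_left l7 hY
  have b4 := mul_le_mul_of_nonneg_left l8 hY
  have hL8 : 0 ≤ L ^ 8 := by positivity
  have c1 := mul_nonneg hX hL8
  have c2 := mul_nonneg hY hL8
  have r1 : 10 ^ 20 * H ^ 8 * S ^ 2 * A / ε ^ 2 * L ^ 8
      = 10 ^ 20 * (H ^ 8 * S ^ 2 * A / ε ^ 2 * L ^ 8) := by ring
  have r2 : 10 ^ 20 * K * (S * A * H) ^ 8 / ε * L ^ 8
      = 10 ^ 20 * (K * (S * A * H) ^ 8 / ε * L ^ 8) := by ring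
  rw [r1, r2]
  linarith

end Confidence

/-! ### The number of deterministic policies -/

theorem card_le_of_injective_of_isDeterministic {S A H K : ℕ}
    {π : Fin K → Policy (Fin S) (Fin A) H} (hinj : Function.Injective π)
    (hdet : ∀ k, (π k).IsDeterministic) : K ≤ A ^ (S * H) := by
  choose g hg using hdet
  have hg' : Function.Injective g := by
    intro k l hkl
    refine hinj (funext fun h => funext fun s => ?_)
    rw [hg k, hg l, hkl]
  simpa [pow_mul] using Fintype.card_le_of_injective g hg'

end Caesar

end

/-! ### The main theorem -/

theorem mainTheorem4 :
    ∃ (C : ℝ) (c : ℕ), 0 < C ∧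
      ∀ (S A H K : ℕ) (ε δ : ℝ), 0 < ε → ε ≤ H → 0 < δ → δ < 1 →
        ∃ θ : Caesar.Params H,
          ∀ (M : Caesar.MDP (Fin S) (Fin A) H) (π : Fin K → Caesar.Policy (Fin S) (Fin A) H)
            (solve : (Fin K → Fin S × Fin A → ℝ) → PMF (Fin K)),
            Function.Injective π → (∀ k, (π k).IsDeterministic) → Caesar.IsSolver solve →
              1 - ENNReal.ofReal δ ≤ (Caesar.caesar M π θ ε solve).toOuterMeasure
                  {o | ∀ k, |o.1 k - M.value (π k)| ≤ ε} ∧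
              ∀ o ∈ (Caesar.caesar M π θ ε solve).support,
                (o.2 : ℝ) ≤
                  C * (H : ℝ) ^ c * (S : ℝ) ^ 2 * (A : ℝ) / ε ^ 2
                      * Real.log (2 * S * A * H / (ε * δ)) ^ c
                    + C * K * ((S : ℝ) * A * H) ^ c / ε
                      * Real.log (2 * S * A * H / (ε * δ)) ^ c := by
  refine ⟨10 ^ 20, 8, by norm_num, fun S A H K ε δ hε hεH hδ hδ1 => ?_⟩
  have hH : 0 < H := by exact_mod_cast hε.trans_le hεH
  have hH1 : (1 : ℝ) ≤ H := by exact_mod_cast hH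
  by_cases hSA : 0 < S ∧ 0 < A
  · have hS1 : (1 : ℝ) ≤ S := by exact_mod_cast hSA.1
    have hA1 : (1 : ℝ) ≤ A := by exact_mod_cast hSA.2
    have hs : (0 : ℝ) < S := by linarith
    have hL := Caesar.half_le_log_instanceSize hS1 hA1 hε hεH hδ hδ1
    have hY := Caesar.two_le_instanceSize hS1 hA1 hε hεH hδ hδ1
    obtain ⟨L, hLdef⟩ : ∃ L, L = Real.log (2 * S * A * H / (ε * δ)) := ⟨_, rfl⟩
    rw [← hLdef] at hL ⊢
    obtain ⟨t, htdef⟩ : ∃ t, t = 200 * (H * L) := ⟨_, rfl⟩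
    have ht1 : 1 ≤ t := by
      rw [htdef]
      nlinarith
    have ht : 0 < t := by linarith
    refine ⟨Caesar.tuning hH hs hε ht, fun M π solve hinj hdet hsolve => ?_⟩
    -- The solver returns a distribution on `Fin K`, which excludes K = 0.
    have : Nonempty (Fin K) := ⟨(solve fun _ _ => 0).support_nonempty.some⟩
    have hK1 : (1 : ℝ) ≤ K := by exact_mod_cast Fin.pos_iff_nonempty.2 this
    -- Distinctness and determinism enter here: K ≤ A^(SH), and A ≤ exp L.
    have hKL : (K : ℝ) ≤ Real.exp (S * (H * L)) := by
      have hAL : (A : ℝ) ≤ Real.exp L := by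
        rw [hLdef, Real.exp_log (by linarith), le_div_iff₀ (by positivity)]
        have e1 : ε * δ ≤ H := by nlinarith
        have e2 : A * (ε * δ) ≤ A * H := by gcongr
        have e3 : (A * H : ℝ) * 1 ≤ A * H * (2 * S) := by gcongr; linarith
        linarith
      calc (K : ℝ) ≤ (A : ℝ) ^ (S * H) := by
            exact_mod_cast Caesar.card_le_of_injective_of_isDeterministic hinj hdet
        _ ≤ Real.exp L ^ (S * H) := by gcongr
        _ = _ := by
          rw [← Real.exp_nat_mul]
          push_cast
          ring_nf
    obtain ⟨h₀, h₁, h₂, h₃⟩ := Caesar.confidence_bounds hS1 hA1 hH1 hε hεH hδ hδ1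
      (by linarith) hLdef hKL htdef
    refine ⟨Caesar.le_toOuterMeasure_caesar hH hs hε ht M π solve hεH hdet hsolve ht1 h₀ hA1
      hδ h₁ h₂ h₃, fun o ho => ?_⟩
    simp only [Caesar.caesar, PMF.mem_support_bind_iff, PMF.mem_support_map_iff] at ho
    obtain ⟨data₀, -, data, -, fresh, -, rfl⟩ := ho
    exact (Caesar.episodes_le hH hs hε ht (Caesar.design_valid hsolve data₀)
      (one_le_mul_of_one_le_of_one_le hS1 hA1)).trans
      (Caesar.sample_size_le hS1 hA1 hH1 hK1 hε hεH hL htdef)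
  -- Without states or actions the instance is contradictory: the initial law has a state in its
  -- support, and the policy has an action there.
  · refine ⟨Caesar.tuning hH one_pos hε one_pos, fun M π solve _ _ _ => absurd ?_ hSA⟩
    have s := M.ν.support_nonempty.some
    exact ⟨s.pos, (π (solve fun _ _ => 0).support_nonempty.some ⟨0, hH⟩ s).support_nonempty.some.pos⟩
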